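/- Let $N\in\mathbb N$, $1<p<N$ and $C_0,C_1>0$. For $r>0$ let $K_r\subset\mathbb R^N$ denote the open cube of side length $r$ centred at the origin. There is a constant $C>0$, depending only on $N,p,C_0,C_1$, with the following property. Let $R>0$ and let $A:K_{8R}\times\mathbb R\times\mathbb R^N\to\mathbb R^N$ satisfy $$A(x,s,z)\cdot z\ \ge\ C_0|z|^p,\qquad |A(x,s,z)|\ \le\ C_1|z|^{p-1}$$ for a.e. $x\in K_{8R}$ and all $s\in\mathbb R$, $z\in\mathbb R^N$. Let $u\ge 0$ be a locally bounded weak solution of $\operatorname{div}A(x,u,Du)=0$ in $K_{8R}$, i.e. $u\in W^{1,p}_{\rm loc}(K_{8R})\cap L^\infty_{\rm loc}(K_{8R})$, the function $x\mapsto A(x,u(x),Du(x))$ is measurable, and $$\int_{K_{8R}}A(x,u,Du)\cdot D\varphi\,dx=0\qquad\text{for all }\varphi\in C_c^\infty(K_{8R}).$$ Then $$\sup_{K_R}u\ \le\ C\,\inf_{K_R}u,$$ where $\sup$ and $\inf$ are the essential supremum and infimum (equivalently, those of the continuous representative of $u$). -/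

import Mathlib

open MeasureTheory Set
open scoped ContDiff

/-- The open cube `K_r(x₀)` of side length `r` and centre `x₀` in `ℝ^N`. -/
def cube {N : ℕ} (x₀ : EuclideanSpace ℝ (Fin N)) (r : ℝ) : Set (EuclideanSpace ℝ (Fin N)) :=
  {x | ∀ i, |x i - x₀ i| < r / 2}

/-- `φ ∈ C_c^∞(U)`, for `U` open. -/
structure IsTestFunction {N : ℕ} (U : Set (EuclideanSpace ℝ (Fin N)))
    (φ : EuclideanSpace ℝ (Fin N) → ℝ) : Prop where
  contDiff : ContDiff ℝ ∞ φ
  hasCompactSupport : HasCompactSupport φ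
  tsupport_subset : tsupport φ ⊆ U

/-- `f ∈ L^q_loc(U)` for `U` open: `f` is in `L^q` on every compact subset of `U`. -/
def MemLpLoc {N : ℕ} {F : Type*} [NormedAddCommGroup F] (f : EuclideanSpace ℝ (Fin N) → F)
    (q : ENNReal) (U : Set (EuclideanSpace ℝ (Fin N))) : Prop :=
  ∀ L : Set (EuclideanSpace ℝ (Fin N)), L ⊆ U → IsCompact L → MemLp f q (volume.restrict L)

/-- `G` is the weak gradient of `u` in `U`, both being in `L^p_loc(U)`; thus
`u ∈ W^{1,p}_loc(U)` with `Du = G`. Here `fderiv ℝ φ x v` is `Dφ(x) · v`. -/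
structure HasWeakGradient {N : ℕ} (p : ℝ) (U : Set (EuclideanSpace ℝ (Fin N)))
    (u : EuclideanSpace ℝ (Fin N) → ℝ)
    (G : EuclideanSpace ℝ (Fin N) → EuclideanSpace ℝ (Fin N)) : Prop where
  memLpLoc : MemLpLoc u (ENNReal.ofReal p) U
  memLpLoc_grad : MemLpLoc G (ENNReal.ofReal p) U
  integral_eq : ∀ φ : EuclideanSpace ℝ (Fin N) → ℝ, IsTestFunction U φ →
    ∀ v : EuclideanSpace ℝ (Fin N),
      ∫ x in U, u x * fderiv ℝ φ x v = -∫ x in U, inner ℝ (G x) v * φ x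

/-- The `p`-growth conditions `A(x,s,z) · z ≥ C₀ |z|^p` and `|A(x,s,z)| ≤ C₁ |z|^(p-1)`, for almost
every `x ∈ U` and all `s`, `z`. -/
def HasPGrowth {N : ℕ} (p C₀ C₁ : ℝ) (U : Set (EuclideanSpace ℝ (Fin N)))
    (A : EuclideanSpace ℝ (Fin N) → ℝ → EuclideanSpace ℝ (Fin N) → EuclideanSpace ℝ (Fin N)) :
    Prop :=
  ∀ᵐ x ∂(volume.restrict U), ∀ (s : ℝ) (z : EuclideanSpace ℝ (Fin N)),
    C₀ * ‖z‖ ^ p ≤ inner ℝ (A x s z) z ∧ ‖A x s z‖ ≤ C₁ * ‖z‖ ^ (p - 1)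

/-- `u` is a local weak solution of `div A(x, u, Du) = 0` in the open set `U`: `u` belongs to
`W^{1,p}_loc(U)`, the flux `x ↦ A(x, u(x), Du(x))` is measurable (as is automatic for a
Carathéodory or a Borel function `A`), and `∫ A(x, u, Du) · Dφ dx = 0` for all `φ ∈ C_c^∞(U)`. -/
def IsWeakSolution {N : ℕ} (p : ℝ) (U : Set (EuclideanSpace ℝ (Fin N)))
    (A : EuclideanSpace ℝ (Fin N) → ℝ → EuclideanSpace ℝ (Fin N) → EuclideanSpace ℝ (Fin N))
    (u : EuclideanSpace ℝ (Fin N) → ℝ) : Prop :=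
  ∃ G : EuclideanSpace ℝ (Fin N) → EuclideanSpace ℝ (Fin N), HasWeakGradient p U u G ∧
    AEStronglyMeasurable (fun x => A x (u x) (G x)) (volume.restrict U) ∧
    ∀ φ : EuclideanSpace ℝ (Fin N) → ℝ, IsTestFunction U φ →
      ∫ x in U, fderiv ℝ φ x (A x (u x) (G x)) = 0

/-! The proof is De Giorgi's method combined with expansion of positivity; a peak selection replaces
the John–Nirenberg lemma and covering arguments. The equation enters only through `IsFlux`: the
vector field `a = A(x, u, Du)` is frozen and keeps its growth bounds and zero weak divergence. This
survives adding a constant to `u`, restriction and dilation, so one may work at unit scale.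

Energy estimates: test with `η ^ p * H(u)`, `H` nondecreasing on the range of `u`. Coercivity
controls `η ^ p * H'(u) * |Du| ^ p`. Three choices of `H` yield a Caccioppoli inequality for
truncations of `u`, one for truncations of `-log u`, and a bound for `|D log u|` in `L^p` that does
not depend on `u`. With the Sobolev inequality, the first two put `u` and `-log u` in the class
`IsDeGiorgi`. For `w` in this class, De Giorgi iteration (`exists_critical_mass`) shows that `w ≤ k
+ κ` on a smaller cube once the `L^p` norm of `(w - k)₊` is at most `ν κ`.

This has two consequences. For `w = u`: if `u ≤ A m` and `u ≥ m / 4` only on a set of small measure,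
then `u ≤ m / 2` on a smaller cube (`exists_sup_estimate`). For `w = -log u`: if `u ≥ m` on a set of
measure at least `α`, the logarithmic bound and a Poincaré inequality bound `(-log u + log m)₊` in
`L^p`; as `κ` may be taken large, no smallness is needed, and `u ≥ γ m` follows
(`exists_expansion`).

Harnack: suppose `u` exceeds `M` on a nonnull part of the unit cube. Doubling a cube costs a factor
`γ₂ = 2 ^ (-β)` of positivity. `exists_peak` finds a point near which `u` exceeds `m` at scale `δ`,
with `m δ ^ β ≥ M / 2`, while `u` is at most a multiple of `m` nearby. The sup estimate then makes
`u ≥ m / 2` on a fixed fraction of a cube of size `δ / 8`. Expanding from there to unit scale loses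
about `δ ^ β`, exactly what the peak has gained, so `u ≥ c M` on the whole unit cube. -/

/-! ### Mollification in `L^p`. -/

section Mollification
open Filter Topology ContinuousLinearMap
open scoped Convolution ENNReal

variable {E F : Type*} [NormedAddCommGroup E] [InnerProductSpace ℝ E] [FiniteDimensional ℝ E]
  [MeasurableSpace E] [BorelSpace E] [NormedAddCommGroup F] [NormedSpace ℝ F]

/-- The normalised bump is a probability density, so Jensen's inequality (monotonicity of `L^q`
norms for a probability measure) bounds the convolution pointwise by an average of translates;
Tonelli and translation invariance finish. -/
theorem lintegral_enorm_convolution_normed_rpow_le (φ : ContDiffBump (0 : E)) {q : ℝ} (hq : 1 ≤ q)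
    {f : E → F} (hf : StronglyMeasurable f) :
    ∫⁻ x, ‖(φ.normed volume ⋆[lsmul ℝ ℝ, volume] f) x‖ₑ ^ q ≤ ∫⁻ x, ‖f x‖ₑ ^ q := by
  have hq0 : 0 < q := by linarith
  set ρ : E → ℝ≥0∞ := fun t => ENNReal.ofReal (φ.normed volume t) with hρ
  have hρm : Measurable ρ := (φ.continuous_normed.measurable).ennreal_ofReal
  have hρ1 : ∫⁻ t, ρ t = 1 := by
    rw [← ofReal_integral_eq_lintegral_ofReal φ.integrable_normed
      (Eventually.of_forall fun x => φ.nonneg_normed x), φ.integral_normed, ENNReal.ofReal_one]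
  set ν : Measure E := volume.withDensity ρ with hν
  have : IsProbabilityMeasure ν := ⟨by simp [hν, hρ1]⟩
  have key : ∀ x, ‖(φ.normed volume ⋆[lsmul ℝ ℝ, volume] f) x‖ₑ ^ q
      ≤ ∫⁻ t, ρ t * ‖f (x - t)‖ₑ ^ q := by
    intro x
    have hm : StronglyMeasurable fun t => f (x - t) :=
      hf.comp_measurable (measurable_const.sub measurable_id)
    have h1 : ‖(φ.normed volume ⋆[lsmul ℝ ℝ, volume] f) x‖ₑ ≤ ∫⁻ t, ‖f (x - t)‖ₑ ∂ν := by
      rw [hν, lintegral_withDensity_eq_lintegral_mul _ hρm hm.enorm]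
      refine (enorm_integral_le_lintegral_enorm _).trans (lintegral_mono fun t => ?_)
      simp only [lsmul_apply, enorm_smul, Pi.mul_apply, hρ]
      rw [Real.enorm_eq_ofReal (φ.nonneg_normed t)]
    have h2 := eLpNorm'_le_eLpNorm'_of_exponent_le (μ := ν) zero_lt_one hq hm.aestronglyMeasurable
    simp only [eLpNorm', ENNReal.rpow_one, one_div, inv_one] at h2
    have h3 : (∫⁻ t, ‖f (x - t)‖ₑ ∂ν) ^ q ≤ ∫⁻ t, ‖f (x - t)‖ₑ ^ q ∂ν := by
      refine (ENNReal.rpow_le_rpow h2 hq0.le).trans ?_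
      rw [← ENNReal.rpow_mul, inv_mul_cancel₀ hq0.ne', ENNReal.rpow_one]
    refine (ENNReal.rpow_le_rpow h1 hq0.le).trans (h3.trans ?_)
    rw [hν, lintegral_withDensity_eq_lintegral_mul _ hρm (hm.enorm.pow_const _)]
    rfl
  refine (lintegral_mono key).trans ?_
  rw [lintegral_lintegral_swap]
  · have : ∀ t, ∫⁻ x, ρ t * ‖f (x - t)‖ₑ ^ q = ρ t * ∫⁻ x, ‖f x‖ₑ ^ q := by
      intro t
      rw [lintegral_const_mul']
      · congr 1
        exact lintegral_sub_right_eq_self (fun x => ‖f x‖ₑ ^ q) t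
      · simp [hρ]
    simp_rw [this]
    rw [lintegral_mul_const _ hρm, hρ1, one_mul]
  · refine Measurable.aemeasurable ?_
    refine (hρm.comp measurable_snd).mul (Measurable.pow_const ?_ _)
    exact (hf.comp_measurable (measurable_fst.sub measurable_snd)).enorm

theorem eLpNorm_convolution_normed_le (φ : ContDiffBump (0 : E)) {p : ℝ≥0∞} (hp1 : 1 ≤ p)
    (hp : p ≠ ⊤) {f : E → F} (hf : MemLp f p volume) :
    eLpNorm (φ.normed volume ⋆[lsmul ℝ ℝ, volume] f) p volume ≤ eLpNorm f p volume := by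
  obtain ⟨g, hg, hfg⟩ := hf.1
  have h1 : (φ.normed volume ⋆[lsmul ℝ ℝ, volume] f) = φ.normed volume ⋆[lsmul ℝ ℝ, volume] g :=
    convolution_congr _ (ae_eq_refl _) hfg
  rw [h1, eLpNorm_congr_ae hfg]
  have hp0 : p ≠ 0 := (zero_lt_one.trans_le hp1).ne'
  rw [eLpNorm_eq_lintegral_rpow_enorm_toReal hp0 hp, eLpNorm_eq_lintegral_rpow_enorm_toReal hp0 hp]
  refine ENNReal.rpow_le_rpow ?_ (by positivity)
  exact lintegral_enorm_convolution_normed_rpow_le φ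
    (by simpa using (ENNReal.toReal_le_toReal (by simp) hp).2 hp1) hg

theorem dist_convolution_normed_le (φ : ContDiffBump (0 : E)) [CompleteSpace F] {g : E → F}
    (hg : Continuous g) {ε : ℝ} (h : ∀ x y, dist x y < φ.rOut → dist (g x) (g y) ≤ ε) (x : E) :
    dist ((φ.normed volume ⋆[lsmul ℝ ℝ, volume] g) x) (g x) ≤ ε :=
  φ.dist_normed_convolution_le hg.aestronglyMeasurable fun y hy => h y x hy

/-- Convolution with a normalised bump is an `L^p` contraction, so it suffices to treat a continuous
compactly supported `g` close to `f`; there convergence is uniform, on a fixed compact set. -/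
theorem tendsto_eLpNorm_convolution_sub [CompleteSpace F] {φ : ℕ → ContDiffBump (0 : E)}
    (hφ : Tendsto (fun n => (φ n).rOut) atTop (𝓝 0)) {p : ℝ≥0∞} (hp1 : 1 ≤ p)
    (hp : p ≠ ⊤) {f : E → F} (hf : MemLp f p volume) :
    Tendsto (fun n => eLpNorm ((φ n).normed volume ⋆[lsmul ℝ ℝ, volume] f - f) p volume)
      atTop (𝓝 0) := by
  rw [ENNReal.tendsto_nhds_zero]
  intro ε hε
  have hε3 : ε / 3 ≠ 0 := (ENNReal.div_pos hε.ne' (by simp)).ne'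
  obtain ⟨g, hgc, hfg, hg, hgp⟩ := hf.exists_hasCompactSupport_eLpNorm_sub_le hp hε3
  set K := Metric.cthickening 1 (tsupport g) with hK
  have hKc : IsCompact K := hgc.isCompact.cthickening
  obtain ⟨δ, hδ, hδK⟩ : ∃ δ : ℝ, 0 < δ ∧ ENNReal.ofReal δ * volume K ^ (1 / p.toReal) ≤ ε / 3 := by
    have hfin : volume K ^ (1 / p.toReal) ≠ ⊤ :=
      ENNReal.rpow_ne_top_of_nonneg (by positivity) hKc.measure_lt_top.ne
    obtain ⟨r, hr, hr'⟩ := ENNReal.exists_nnreal_pos_mul_lt hfin hε3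
    exact ⟨r, hr, by simpa using hr'.le⟩
  obtain ⟨η, hη, hunif⟩ := Metric.uniformContinuous_iff.1 (hgc.uniformContinuous_of_continuous hg) δ hδ
  have ev : ∀ᶠ n in atTop, (φ n).rOut < min η 1 := hφ.eventually_lt_const (by positivity)
  filter_upwards [ev] with n hn
  have hd := dist_convolution_normed_le (φ n) hg (ε := δ)
    (fun x y hxy => (hunif (hxy.trans (hn.trans_le (min_le_left _ _)))).le)
  have hli : LocallyIntegrable f volume := hf.locallyIntegrable hp1
  have hlg : LocallyIntegrable g volume := hg.locallyIntegrable
  have hcf : HasCompactSupport ((φ n).normed (volume : Measure E)) := (φ n).hasCompactSupport_normed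
  have e : (φ n).normed volume ⋆[lsmul ℝ ℝ, volume] f - f =
      ((φ n).normed volume ⋆[lsmul ℝ ℝ, volume] (f - g)) +
        (((φ n).normed volume ⋆[lsmul ℝ ℝ, volume] g - g) + (g - f)) := by
    have : f = (f - g) + g := by simp
    conv_lhs => rw [this, ConvolutionExists.distrib_add
      (fun x => hcf.convolutionExists_left _ (φ n).continuous_normed (hli.sub hlg) x)
      (fun x => hcf.convolutionExists_left _ (φ n).continuous_normed hlg x)]
    abel
  have hcont : ∀ {h : E → F}, LocallyIntegrable h volume →
      AEStronglyMeasurable ((φ n).normed volume ⋆[lsmul ℝ ℝ, volume] h) volume := fun hh =>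
    (hcf.continuous_convolution_left _ (φ n).continuous_normed hh).aestronglyMeasurable
  have h2 : eLpNorm ((φ n).normed volume ⋆[lsmul ℝ ℝ, volume] g - g) p volume ≤ ε / 3 := by
    refine (eLpNorm_sub_le_of_dist_bdd volume hp hKc.measurableSet hδ.le hd ?_ ?_).trans hδK
    · refine (support_convolution_subset_swap _).trans ?_
      rw [(φ n).support_normed_eq]
      rintro _ ⟨y, hy, z, hz, rfl⟩
      refine Metric.mem_cthickening_of_dist_le _ y _ _ (subset_tsupport g hy) ?_
      have := hz
      simp only [Metric.mem_ball, dist_zero_right] at this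
      simpa [dist_eq_norm] using this.le.trans (hn.le.trans (min_le_right _ _))
    · exact (subset_tsupport g).trans (Metric.self_subset_cthickening _)
  rw [e]
  calc _ ≤ _ := eLpNorm_add_le (hcont (hli.sub hlg))
        (((hcont hlg).sub hgp.1).add (hgp.1.sub hf.1)) hp1
    _ ≤ ε / 3 + (ε / 3 + ε / 3) := by
        refine add_le_add ((eLpNorm_convolution_normed_le _ hp1 hp (hf.sub hgp)).trans hfg)
          ((eLpNorm_add_le ((hcont hlg).sub hgp.1) (hgp.1.sub hf.1) hp1).trans
            (add_le_add h2 ?_))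
        rw [eLpNorm_sub_comm]; exact hfg
    _ = ε := by rw [← add_assoc, ENNReal.add_thirds]

/-- A sequence of bump functions shrinking to the origin. -/
noncomputable def shrinkingBump (E : Type*) [NormedAddCommGroup E] (n : ℕ) :
    ContDiffBump (0 : E) where
  rIn := 1 / ((n : ℝ) + 1)
  rOut := 2 * (1 / ((n : ℝ) + 1))
  rIn_pos := by positivity
  rIn_lt_rOut := by
    have : (0 : ℝ) < 1 / ((n : ℝ) + 1) := by positivity
    linarith

theorem tendsto_shrinkingBump_rOut (E : Type*) [NormedAddCommGroup E] :
    Tendsto (fun n => (shrinkingBump E n).rOut) atTop (𝓝 0) := by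
  have := (tendsto_one_div_add_atTop_nhds_zero_nat (𝕜 := ℝ)).const_mul 2
  simpa [shrinkingBump] using this

end Mollification

/-! ### Weak gradients, the product and chain rules, and approximation by `C¹` functions. -/

section WeakGradient
open Filter Topology ContinuousLinearMap
open scoped Convolution ENNReal

/-- Euclidean space of dimension `N`. -/
abbrev Euc (N : ℕ) : Type := EuclideanSpace ℝ (Fin N)

variable {N : ℕ}

theorem tendsto_eLpNorm_of_dominated {α F : Type*} [MeasurableSpace α] {μ : Measure α}
    [NormedAddCommGroup F] {p : ℝ≥0∞} (hp0 : p ≠ 0) (hp : p ≠ ⊤) {g : ℕ → α → F} {h : α → ℝ}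
    (hg : ∀ n, AEStronglyMeasurable (g n) μ) (hh : MemLp h p μ)
    (hle : ∀ n, ∀ᵐ x ∂μ, ‖g n x‖ ≤ h x)
    (hlim : ∀ᵐ x ∂μ, Tendsto (fun n => g n x) atTop (𝓝 0)) :
    Tendsto (fun n => eLpNorm (g n) p μ) atTop (𝓝 0) := by
  have hpos : 0 < p.toReal := ENNReal.toReal_pos hp0 hp
  simp_rw [eLpNorm_eq_lintegral_rpow_enorm_toReal hp0 hp]
  have : Tendsto (fun n => ∫⁻ x, ‖g n x‖ₑ ^ p.toReal ∂μ) atTop (𝓝 (∫⁻ _, 0 ∂μ)) := by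
    refine tendsto_lintegral_of_dominated_convergence' (fun x => ‖h x‖ₑ ^ p.toReal)
      (fun n => (hg n).enorm.pow_const _) (fun n => ?_) ?_ ?_
    · filter_upwards [hle n] with x hx
      refine ENNReal.rpow_le_rpow ?_ hpos.le
      exact enorm_le_iff_norm_le.2 (hx.trans (le_abs_self _))
    · have := hh.2
      rw [eLpNorm_lt_top_iff_lintegral_rpow_enorm_lt_top hp0 hp] at this
      exact this.ne
    · filter_upwards [hlim] with x hx
      have := (hx.enorm).ennrpow_const p.toReal
      simpa [ENNReal.zero_rpow_of_pos hpos] using this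
  rw [lintegral_zero] at this
  have h2 := this.ennrpow_const (1 / p.toReal)
  rwa [ENNReal.zero_rpow_of_pos (by positivity)] at h2

theorem tendsto_eLpNorm_of_eq_add {α F : Type*} [MeasurableSpace α] {μ : Measure α}
    [NormedAddCommGroup F] {p : ℝ≥0∞} (hp : 1 ≤ p) {S T₁ T₂ T₃ : ℕ → α → F}
    (h₁ : ∀ n, AEStronglyMeasurable (T₁ n) μ) (h₂ : ∀ n, AEStronglyMeasurable (T₂ n) μ)
    (h₃ : ∀ n, AEStronglyMeasurable (T₃ n) μ) (hS : ∀ n x, S n x = T₁ n x + (T₂ n x + T₃ n x))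
    (l₁ : Tendsto (fun n => eLpNorm (T₁ n) p μ) atTop (𝓝 0))
    (l₂ : Tendsto (fun n => eLpNorm (T₂ n) p μ) atTop (𝓝 0))
    (l₃ : Tendsto (fun n => eLpNorm (T₃ n) p μ) atTop (𝓝 0)) :
    Tendsto (fun n => eLpNorm (S n) p μ) atTop (𝓝 0) := by
  have hall := l₁.add (l₂.add l₃)
  simp only [add_zero] at hall
  refine tendsto_of_tendsto_of_tendsto_of_le_of_le tendsto_const_nhds hall (fun n => zero_le) ?_
  intro n
  have e : S n = T₁ n + (T₂ n + T₃ n) := funext (hS n)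
  simp only [e]
  refine (eLpNorm_add_le (h₁ n) ((h₂ n).add (h₃ n)) hp).trans ?_
  gcongr
  exact eLpNorm_add_le (h₂ n) (h₃ n) hp

theorem memLp_of_tendsto_eLpNorm_sub {α F : Type*} [MeasurableSpace α] {μ : Measure α}
    [NormedAddCommGroup F] {p : ℝ≥0∞} {g : ℕ → α → F} {f : α → F}
    (hg : ∀ n, MemLp (g n) p μ) (hf : AEStronglyMeasurable f μ)
    (h : Tendsto (fun n => eLpNorm (g n - f) p μ) atTop (𝓝 0)) : MemLp f p μ := by
  obtain ⟨n, hn⟩ := (h.eventually_lt_const (zero_lt_one)).exists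
  have h2 : MemLp (g n - f) p μ := ⟨(hg n).1.sub hf, hn.trans ENNReal.one_lt_top⟩
  simpa using (hg n).sub h2

theorem MemLpLoc.memLp_of_le {F F' : Type*} [NormedAddCommGroup F] [NormedAddCommGroup F']
    {f : Euc N → F} {q : ℝ≥0∞} {U K : Set (Euc N)} (hf : MemLpLoc f q U) (hK : IsCompact K)
    (hKU : K ⊆ U) {g : Euc N → F'} {B : ℝ}
    (hg : AEStronglyMeasurable g (volume.restrict K))
    (hle : ∀ x ∈ K, ‖g x‖ ≤ B * ‖f x‖) (h0 : ∀ x, x ∉ K → g x = 0) :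
    MemLp g q volume := by
  have e : g = K.indicator g := by
    ext x
    by_cases hx : x ∈ K
    · simp [hx]
    · simp [hx, h0 x hx]
  rw [e, memLp_indicator_iff_restrict hK.measurableSet]
  exact (hf K hKU hK).of_le_mul hg
    ((ae_restrict_iff' hK.measurableSet).2 (Eventually.of_forall hle))

theorem MemLpLoc.smul_left {F : Type*} [NormedAddCommGroup F] [NormedSpace ℝ F]
    {f : Euc N → F} {q : ℝ≥0∞} {U : Set (Euc N)} (hf : MemLpLoc f q U) {c : Euc N → ℝ}
    (hc : Continuous c) (hcc : HasCompactSupport c) (hcU : tsupport c ⊆ U) :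
    MemLp (fun x => c x • f x) q volume := by
  obtain ⟨B, hB⟩ := hcc.exists_bound_of_continuous hc
  refine hf.memLp_of_le hcc.isCompact hcU (B := B)
    (hc.aestronglyMeasurable.smul (hf _ hcU hcc.isCompact).1) (fun x _ => ?_) fun x hx => ?_
  · rw [norm_smul]; gcongr; exact hB x
  · simp [image_eq_zero_of_notMem_tsupport hx]

theorem MemLpLoc.smul_right {F : Type*} [NormedAddCommGroup F] [NormedSpace ℝ F]
    {f : Euc N → ℝ} {q : ℝ≥0∞} {U : Set (Euc N)} (hf : MemLpLoc f q U) {c : Euc N → F}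
    (hc : Continuous c) (hcc : HasCompactSupport c) (hcU : tsupport c ⊆ U) :
    MemLp (fun x => f x • c x) q volume := by
  obtain ⟨B, hB⟩ := hcc.exists_bound_of_continuous hc
  refine hf.memLp_of_le hcc.isCompact hcU (B := B)
    ((hf _ hcU hcc.isCompact).1.smul hc.aestronglyMeasurable) (fun x _ => ?_) fun x hx => ?_
  · rw [norm_smul, mul_comm]; gcongr; exact hB x
  · simp [image_eq_zero_of_notMem_tsupport hx]

theorem MemLpLoc.innerSL_comp {G : Euc N → Euc N} {q : ℝ≥0∞} {U : Set (Euc N)}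
    (hG : MemLpLoc G q U) : MemLpLoc (fun x => innerSL ℝ (G x)) q U := fun L hL hLc =>
  (hG L hL hLc).of_le (((innerSL ℝ).continuous).comp_aestronglyMeasurable (hG L hL hLc).1)
    (Eventually.of_forall fun x => by simp)

/-- The gradient of `θ u`, as a linear form, where `G` is the weak gradient of `u`. -/
noncomputable def cutoffGrad (θ u : Euc N → ℝ) (G : Euc N → Euc N) (x : Euc N) : Euc N →L[ℝ] ℝ :=
  u x • fderiv ℝ θ x + θ x • innerSL ℝ (G x)

variable {p : ℝ} {U : Set (Euc N)} {u : Euc N → ℝ} {G : Euc N → Euc N}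

theorem HasWeakGradient.memLp_cutoffGrad (h : HasWeakGradient p U u G) {θ : Euc N → ℝ}
    (hθ : IsTestFunction U θ) : MemLp (cutoffGrad θ u G) (ENNReal.ofReal p) volume :=
  (h.memLpLoc.smul_right (hθ.contDiff.continuous_fderiv (by simp))
    (hθ.hasCompactSupport.fderiv ℝ)
    ((tsupport_fderiv_subset ℝ).trans hθ.tsupport_subset)).add
  (h.memLpLoc_grad.innerSL_comp.smul_left hθ.contDiff.continuous hθ.hasCompactSupport hθ.tsupport_subset)

theorem HasWeakGradient.memLp_cutoff (h : HasWeakGradient p U u G) {θ : Euc N → ℝ}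
    (hθ : IsTestFunction U θ) : MemLp (fun x => θ x * u x) (ENNReal.ofReal p) volume :=
  h.memLpLoc.smul_left hθ.contDiff.continuous hθ.hasCompactSupport hθ.tsupport_subset

/-- With the cutoff, `θ φ` is an admissible test function for every smooth `φ`, so `θ u` has a weak
gradient on the whole space. -/
theorem HasWeakGradient.integral_cutoff_mul_fderiv (hp : 1 ≤ p)
    (h : HasWeakGradient p U u G)
    {θ : Euc N → ℝ} (hθ : IsTestFunction U θ) {φ : Euc N → ℝ} (hφ : ContDiff ℝ ∞ φ) (v : Euc N) :
    ∫ x, (θ x * u x) * fderiv ℝ φ x v = -∫ x, cutoffGrad θ u G x v * φ x := by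
  have hp1 : 1 ≤ ENNReal.ofReal p := by simpa using hp
  have hlu : MemLpLoc u 1 U := fun L hL hLc => by
    have : Fact (volume L < ⊤) := ⟨hLc.measure_lt_top⟩
    exact (h.memLpLoc L hL hLc).mono_exponent hp1
  have hlG : MemLpLoc G 1 U := fun L hL hLc => by
    have : Fact (volume L < ⊤) := ⟨hLc.measure_lt_top⟩
    exact (h.memLpLoc_grad L hL hLc).mono_exponent hp1
  have hθφ : IsTestFunction U (fun x => θ x * φ x) :=
    ⟨hθ.contDiff.mul hφ, hθ.hasCompactSupport.mul_right,
      (tsupport_mul_subset_left).trans hθ.tsupport_subset⟩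
  have hcφ : Continuous (fderiv ℝ φ) := hφ.continuous_fderiv (by simp)
  have hcθ : Continuous (fderiv ℝ θ) := hθ.contDiff.continuous_fderiv (by simp)
  have i1 : Integrable (fun x => (θ x * u x) * fderiv ℝ φ x v) volume := by
    have := hlu.smul_left (c := fun x => θ x * fderiv ℝ φ x v)
      (hθ.contDiff.continuous.mul (hcφ.clm_apply continuous_const)) hθ.hasCompactSupport.mul_right
      (tsupport_mul_subset_left.trans hθ.tsupport_subset)
    refine (memLp_one_iff_integrable.1 this).congr (Eventually.of_forall fun x => ?_)
    simp only [smul_eq_mul]; ring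
  have i2 : Integrable (fun x => u x * fderiv ℝ θ x v * φ x) volume := by
    have := hlu.smul_left (c := fun x => φ x * fderiv ℝ θ x v)
      (hφ.continuous.mul (hcθ.clm_apply continuous_const))
      ((hθ.hasCompactSupport.fderiv_apply ℝ v).mul_left)
      ((tsupport_mul_subset_right.trans (tsupport_fderiv_apply_subset ℝ v)).trans
        hθ.tsupport_subset)
    refine (memLp_one_iff_integrable.1 this).congr (Eventually.of_forall fun x => ?_)
    simp only [smul_eq_mul]; ring
  have i3 : Integrable (fun x => inner ℝ (G x) v * (θ x * φ x)) volume := by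
    have := hlG.smul_left (c := fun x => θ x * φ x)
      (hθφ.contDiff.continuous) hθφ.hasCompactSupport hθφ.tsupport_subset
    refine ((memLp_one_iff_integrable.1 this).inner_const v).congr
      (Eventually.of_forall fun x => ?_)
    simp only [real_inner_smul_left]; ring
  have z : ∀ x, x ∉ U → θ x = 0 ∧ fderiv ℝ θ x = 0 := fun x hx =>
    ⟨image_eq_zero_of_notMem_tsupport fun hx' => hx (hθ.tsupport_subset hx'),
      image_eq_zero_of_notMem_tsupport fun hx' =>
        hx (hθ.tsupport_subset (tsupport_fderiv_subset ℝ hx'))⟩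
  have main := h.integral_eq _ hθφ v
  have hder : ∀ x, fderiv ℝ (fun x => θ x * φ x) x v
      = θ x * fderiv ℝ φ x v + φ x * fderiv ℝ θ x v := fun x => by
    rw [fderiv_fun_mul (hθ.contDiff.differentiable (by simp) x)
      (hφ.differentiable (by simp) x)]
    simp
  rw [setIntegral_eq_integral_of_forall_compl_eq_zero,
    setIntegral_eq_integral_of_forall_compl_eq_zero] at main
  · have e1 : ∫ x, u x * fderiv ℝ (fun x => θ x * φ x) x v =
        (∫ x, (θ x * u x) * fderiv ℝ φ x v) + ∫ x, u x * fderiv ℝ θ x v * φ x := by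
      rw [← integral_add i1 i2]
      refine integral_congr_ae (Eventually.of_forall fun x => ?_)
      simp only [hder]; ring
    have e2 : ∫ x, cutoffGrad θ u G x v * φ x =
        (∫ x, u x * fderiv ℝ θ x v * φ x) + ∫ x, inner ℝ (G x) v * (θ x * φ x) := by
      rw [← integral_add i2 i3]
      refine integral_congr_ae (Eventually.of_forall fun x => ?_)
      simp [cutoffGrad]; ring
    rw [e1] at main
    rw [e2]; linarith
  · intro x hx; simp [(z x hx).1]
  · intro x hx; rw [hder]; simp [(z x hx).1, (z x hx).2]

/-- Differentiation falls on the kernel; testing the weak gradient with the reflected kernel `y ↦ φ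
(x - y)` moves it to `θ u`. -/
theorem HasWeakGradient.fderiv_convolution_cutoff (hp : 1 ≤ p)
    (h : HasWeakGradient p U u G) {θ : Euc N → ℝ} (hθ : IsTestFunction U θ)
    (φ : ContDiffBump (0 : Euc N)) (x : Euc N) :
    HasFDerivAt (φ.normed volume ⋆[lsmul ℝ ℝ, volume] fun x => θ x * u x)
      ((φ.normed volume ⋆[lsmul ℝ ℝ, volume] cutoffGrad θ u G) x) x := by
  have hp1 : 1 ≤ ENNReal.ofReal p := by simpa using hp
  have hli := (h.memLp_cutoff hθ).locallyIntegrable hp1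
  have hlG := (h.memLp_cutoffGrad hθ).locallyIntegrable hp1
  have hcf := φ.hasCompactSupport_normed (μ := (volume : Measure (Euc N)))
  have hφs : ContDiff ℝ ∞ (φ.normed (volume : Measure (Euc N))) := φ.contDiff_normed
  have hder := hcf.hasFDerivAt_convolution_left (lsmul ℝ ℝ) (hφs.of_le (by simp)) hli x
  refine hder.congr_fderiv (ContinuousLinearMap.ext fun v => Eq.symm ?_)
  have c1 : ConvolutionExistsAt (φ.normed volume) (cutoffGrad θ u G) x (lsmul ℝ ℝ) volume :=
    hcf.convolutionExists_left _ φ.continuous_normed hlG x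
  have c2 : ConvolutionExistsAt (fderiv ℝ (φ.normed volume)) (fun x => θ x * u x) x
      ((lsmul ℝ ℝ).precompL (Euc N)) volume :=
    (hcf.fderiv ℝ).convolutionExists_left _ (hφs.continuous_fderiv (by simp)) hli x
  rw [convolution_def, convolution_def, ContinuousLinearMap.integral_apply c1,
    ContinuousLinearMap.integral_apply c2]
  have hψ : ContDiff ℝ ∞ fun y => φ.normed volume (x - y) := hφs.comp (contDiff_const.sub contDiff_id)
  have main := h.integral_cutoff_mul_fderiv hp hθ hψ v
  have e : ∀ y, fderiv ℝ (fun y => φ.normed volume (x - y)) y v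
      = - fderiv ℝ (φ.normed volume) (x - y) v := fun y => by
    have h1 : HasFDerivAt (fun y : Euc N => x - y) (-ContinuousLinearMap.id ℝ (Euc N)) y :=
      (hasFDerivAt_id y).const_sub x
    have := ((hφs.differentiable (by simp) (x - y)).hasFDerivAt).comp y h1
    rw [show (fun y => φ.normed volume (x - y)) = φ.normed volume ∘ fun y => x - y from rfl,
      this.fderiv]
    simp
  simp only [e] at main
  rw [← integral_sub_left_eq_self _ volume x, ← integral_sub_left_eq_self (fun t =>
    (((lsmul ℝ ℝ).precompL (Euc N)) (fderiv ℝ (φ.normed volume) t)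
      ((fun x => θ x * u x) (x - t))) v) volume x]
  simp only [sub_sub_cancel, lsmul_apply, smul_apply, smul_eq_mul,
    precompL_apply]
  simp only [mul_neg, integral_neg, neg_inj] at main
  symm
  rw [integral_congr_ae (g := fun y => θ y * u y * fderiv ℝ (φ.normed volume) (x - y) v)
    (Eventually.of_forall fun y => by simp only; ring), main]
  exact integral_congr_ae (Eventually.of_forall fun y => by simp only; ring)

/-- `f` is an almost everywhere limit of `C¹` functions supported in `K` whose derivatives
converge to `F ∈ L^p` in `L^p`. -/
def IsC1Limit (p : ℝ) (K : Set (Euc N)) (f : Euc N → ℝ) (F : Euc N → Euc N →L[ℝ] ℝ) : Prop :=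
  MemLp F (ENNReal.ofReal p) volume ∧ ∃ φ : ℕ → Euc N → ℝ, (∀ n, ContDiff ℝ 1 (φ n)) ∧ (∀ n, tsupport (φ n) ⊆ K) ∧
    (∀ᵐ x, Tendsto (fun n => φ n x) atTop (𝓝 (f x))) ∧
    Tendsto (fun n => eLpNorm (fderiv ℝ (φ n) - F) (ENNReal.ofReal p) volume) atTop (𝓝 0)

theorem exists_testFunction_eq_one {K : Set (Euc N)} (hK : IsCompact K) (hU : IsOpen U)
    (hKU : K ⊆ U) : ∃ θ : Euc N → ℝ, IsTestFunction U θ ∧ (∀ x, 0 ≤ θ x) ∧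
      ∀ x ∈ K, θ x = 1 ∧ fderiv ℝ θ x = 0 := by
  obtain ⟨K', hK', hKK', hK'U⟩ := exists_compact_between hK hU hKU
  obtain ⟨K'', hK'', hKK'', hK''K'⟩ := exists_compact_between hK isOpen_interior hKK'
  obtain ⟨f, hf, hr, hs, h1⟩ := exists_contMDiff_support_eq_eq_one_iff
    (modelWithCornersSelf ℝ (Euc N)) (n := ⊤) isOpen_interior hK''.isClosed hK''K'
  have hts : tsupport f ⊆ K' := by
    rw [tsupport, hs]
    exact (closure_mono interior_subset).trans hK'.isClosed.closure_subset
  refine ⟨f, ⟨hf.contDiff, hK'.of_isClosed_subset (isClosed_tsupport f) hts, hts.trans hK'U⟩,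
    fun x => (hr ⟨x, rfl⟩).1, fun x hx => ⟨(h1 x).1 (interior_subset (hKK'' hx)), ?_⟩⟩
  have : f =ᶠ[𝓝 x] fun _ => 1 := by
    filter_upwards [isOpen_interior.mem_nhds (hKK'' hx)] with y hy
    exact (h1 y).1 (interior_subset hy)
  rw [this.fderiv_eq, fderiv_fun_const]; rfl

theorem HasWeakGradient.exists_approx_cutoff (hp : 1 ≤ p) (h : HasWeakGradient p U u G)
    {θ : Euc N → ℝ} (hθ : IsTestFunction U θ) :
    ∃ (w : ℕ → Euc N → ℝ) (W : ℕ → Euc N → Euc N →L[ℝ] ℝ),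
      (∀ n x, HasFDerivAt (w n) (W n x) x) ∧ (∀ n, Continuous (W n)) ∧
      (∀ᵐ x, Tendsto (fun n => w n x) atTop (𝓝 (θ x * u x))) ∧
      Tendsto (fun n => eLpNorm (w n - fun x => θ x * u x) (ENNReal.ofReal p) volume) atTop (𝓝 0) ∧
      Tendsto (fun n => eLpNorm (W n - cutoffGrad θ u G) (ENNReal.ofReal p) volume)
        atTop (𝓝 0) := by
  have hp1 : 1 ≤ ENNReal.ofReal p := by simpa using hp
  have hfm := h.memLp_cutoff hθ
  have hFm := h.memLp_cutoffGrad hθ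
  have hρ := tendsto_shrinkingBump_rOut (Euc N)
  exact ⟨_, _, fun n x => h.fderiv_convolution_cutoff hp hθ (shrinkingBump (Euc N) n) x,
    fun n => (shrinkingBump (Euc N) n).hasCompactSupport_normed.continuous_convolution_left _
      (shrinkingBump (Euc N) n).continuous_normed (hFm.locallyIntegrable hp1),
    ContDiffBump.ae_convolution_tendsto_right_of_locallyIntegrable (K := 2) hρ
      (Eventually.of_forall fun n => le_rfl) (hfm.locallyIntegrable hp1),
    tendsto_eLpNorm_convolution_sub hρ hp1 ENNReal.ofReal_ne_top hfm,
    tendsto_eLpNorm_convolution_sub hρ hp1 ENNReal.ofReal_ne_top hFm⟩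

/-- The approximants are `η * H(w n)`, where `w n` mollifies `θ u` and `θ = 1` on the support of
`η`. This supplies the test functions `η H(u)` and makes the Sobolev and Poincaré inequalities
applicable to them. -/
theorem isC1Limit_mul_comp (hp : 1 ≤ p) (hU : IsOpen U) (h : HasWeakGradient p U u G)
    {η : Euc N → ℝ} (hη : ContDiff ℝ 1 η) (hηc : HasCompactSupport η) (hηU : tsupport η ⊆ U)
    {H H' : ℝ → ℝ} (hH : ∀ t, HasDerivAt H (H' t) t) (hH' : Continuous H') {B : ℝ}
    (hB : ∀ t, |H' t| ≤ B) :
    IsC1Limit p (tsupport η) (fun x => η x * H (u x))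
      (fun x => H (u x) • fderiv ℝ η x + (η x * H' (u x)) • innerSL ℝ (G x)) := by
  have hp1 : 1 ≤ ENNReal.ofReal p := by simpa using hp
  have hp0 : ENNReal.ofReal p ≠ 0 := (zero_lt_one.trans_le hp1).ne'
  obtain ⟨θ, hθ, -, hθ1⟩ := exists_testFunction_eq_one hηc.isCompact hU hηU
  have hfm := h.memLp_cutoff hθ
  have hFm := h.memLp_cutoffGrad hθ
  obtain ⟨w, W, hder, hWc, hlim, hwf, hWF⟩ := h.exists_approx_cutoff hp hθ
  obtain ⟨f, hf⟩ : ∃ f : Euc N → ℝ, f = fun x => θ x * u x := ⟨_, rfl⟩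
  obtain ⟨F, hF⟩ : ∃ F, F = cutoffGrad θ u G := ⟨_, rfl⟩
  have hfu : ∀ x ∈ tsupport η, f x = u x ∧ F x = innerSL ℝ (G x) :=
    fun x hx => by simp [hf, hF, cutoffGrad, hθ1 x hx]
  have hlim : ∀ᵐ x, Tendsto (fun n => w n x) atTop (𝓝 (f x)) := by rw [hf]; exact hlim
  rw [← hf] at hfm hwf
  rw [← hF] at hFm hWF
  have hw1 : ∀ n, ContDiff ℝ 1 (w n) := fun n => by
    rw [contDiff_one_iff_fderiv]
    refine ⟨fun x => (hder n x).differentiableAt, ?_⟩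
    rw [show fderiv ℝ (w n) = W n from funext fun x => (hder n x).fderiv]
    exact hWc n
  have hH1 : ContDiff ℝ 1 H := by
    rw [contDiff_one_iff_deriv]
    refine ⟨fun t => (hH t).differentiableAt, ?_⟩
    rwa [show deriv H = H' from funext fun t => (hH t).deriv]
  have hη0 : ∀ x, x ∉ tsupport η → η x = 0 ∧ fderiv ℝ η x = 0 := fun x hx =>
    ⟨image_eq_zero_of_notMem_tsupport hx, image_eq_zero_of_notMem_tsupport fun hx' =>
      hx (tsupport_fderiv_subset ℝ hx')⟩
  obtain ⟨B1, hB1⟩ := hηc.exists_bound_of_continuous hη.continuous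
  obtain ⟨B2, hB2⟩ := (hηc.fderiv ℝ).exists_bound_of_continuous (hη.continuous_fderiv (by simp))
  have hB0 : 0 ≤ B := (abs_nonneg _).trans (hB 0)
  have hLip : ∀ s t, |H s - H t| ≤ B * |s - t| := fun s t => by
    simpa using Convex.norm_image_sub_le_of_norm_hasDerivWithin_le
      (fun x _ => (hH x).hasDerivWithinAt) (fun x _ => hB x) convex_univ (mem_univ t) (mem_univ s)
  -- The gradient error splits into three parts: `T1` is small because `H` is Lipschitz, `T2`
  -- because `H'` is bounded, and `T3`, where `H'` is merely continuous, by dominated convergence.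
  set T1 : ℕ → Euc N → Euc N →L[ℝ] ℝ := fun n x => (H (w n x) - H (f x)) • fderiv ℝ η x
  set T2 : ℕ → Euc N → Euc N →L[ℝ] ℝ := fun n x => (η x * H' (w n x)) • (W n - F) x
  set T3 : ℕ → Euc N → Euc N →L[ℝ] ℝ := fun n x => (η x * (H' (w n x) - H' (f x))) • F x
  have hsum : ∀ n x, (fderiv ℝ (fun x => η x * H (w n x)) -
      (fun x => H (u x) • fderiv ℝ η x + (η x * H' (u x)) • innerSL ℝ (G x))) x =
      T1 n x + (T2 n x + T3 n x) := fun n x => by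
    have d1 : HasFDerivAt (fun x => η x * H (w n x)) _ x :=
      ((hη.differentiable (by simp) x).hasFDerivAt).mul ((hH _).comp_hasFDerivAt x (hder n x))
    rw [Pi.sub_apply, d1.fderiv]
    simp only [T1, T2, T3, Pi.sub_apply]
    by_cases hx : x ∈ tsupport η
    · rw [(hfu x hx).1, (hfu x hx).2]
      module
    · simp [(hη0 x hx).1, (hη0 x hx).2]
  have hηm : AEStronglyMeasurable η (volume : Measure (Euc N)) := hη.continuous.aestronglyMeasurable
  have hwm : ∀ n, AEStronglyMeasurable (w n) volume := fun n =>
    (hw1 n).continuous.aestronglyMeasurable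
  have hdm : AEStronglyMeasurable (fderiv ℝ η) (volume : Measure (Euc N)) :=
    (hη.continuous_fderiv (by simp)).aestronglyMeasurable
  have hT1m : ∀ n, AEStronglyMeasurable (T1 n) volume := fun n =>
    ((hH1.continuous.comp_aestronglyMeasurable (hwm n)).sub
      (hH1.continuous.comp_aestronglyMeasurable hfm.1)).smul hdm
  have hT2m : ∀ n, AEStronglyMeasurable (T2 n) volume := fun n =>
    (hηm.mul (hH'.comp_aestronglyMeasurable (hwm n))).smul
      ((hWc n).aestronglyMeasurable.sub hFm.1)
  have hT3m : ∀ n, AEStronglyMeasurable (T3 n) volume := fun n =>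
    (hηm.mul ((hH'.comp_aestronglyMeasurable (hwm n)).sub
      (hH'.comp_aestronglyMeasurable hfm.1))).smul hFm.1
  have c1 : Tendsto (fun n => eLpNorm (T1 n) (ENNReal.ofReal p) volume) atTop (𝓝 0) := by
    have hh := ENNReal.Tendsto.const_mul (a := ENNReal.ofReal (B * B2))
      hwf (Or.inr (by simp))
    rw [mul_zero] at hh
    refine tendsto_of_tendsto_of_tendsto_of_le_of_le tendsto_const_nhds hh (fun n => zero_le) ?_
    intro n
    refine eLpNorm_le_mul_eLpNorm_of_ae_le_mul (Eventually.of_forall fun x => ?_) _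
    simp only [T1, norm_smul, Real.norm_eq_abs, Pi.sub_apply]
    calc _ ≤ (B * |w n x - f x|) * B2 := by gcongr; exacts [hLip _ _, hB2 x]
      _ = _ := by ring
  have c2 : Tendsto (fun n => eLpNorm (T2 n) (ENNReal.ofReal p) volume) atTop (𝓝 0) := by
    have hh := ENNReal.Tendsto.const_mul (a := ENNReal.ofReal (B1 * B))
      hWF (Or.inr (by simp))
    rw [mul_zero] at hh
    refine tendsto_of_tendsto_of_tendsto_of_le_of_le tendsto_const_nhds hh (fun n => zero_le) ?_
    intro n
    refine eLpNorm_le_mul_eLpNorm_of_ae_le_mul (Eventually.of_forall fun x => ?_) _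
    simp only [T2, norm_smul, norm_mul, Real.norm_eq_abs]
    gcongr
    exacts [(abs_nonneg _).trans (hB1 x), hB1 x, hB _]
  have c3 : Tendsto (fun n => eLpNorm (T3 n) (ENNReal.ofReal p) volume) atTop (𝓝 0) := by
    refine tendsto_eLpNorm_of_dominated hp0 ENNReal.ofReal_ne_top hT3m
      (hFm.norm.const_mul (B1 * (B + B))) (fun n => Eventually.of_forall fun x => ?_) ?_
    · simp only [T3, norm_smul, norm_mul, Real.norm_eq_abs]
      gcongr
      exacts [(abs_nonneg _).trans (hB1 x), hB1 x, (abs_sub _ _).trans (add_le_add (hB _) (hB _))]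
    · filter_upwards [hlim] with x hx
      have h1 : Tendsto (fun n => H' (w n x) - H' (f x)) atTop (𝓝 0) := by
        simpa using ((hH'.tendsto _).comp hx).sub_const (H' (f x))
      simpa using (h1.const_mul (η x)).smul_const (F x)
  have hconv := tendsto_eLpNorm_of_eq_add hp1 hT1m hT2m hT3m hsum c1 c2 c3
  have hφ1 : ∀ n, ContDiff ℝ 1 fun x => η x * H (w n x) := fun n => hη.mul (hH1.comp (hw1 n))
  refine ⟨memLp_of_tendsto_eLpNorm_sub (fun n => ?_) ?_ hconv,
    fun n x => η x * H (w n x), hφ1, fun n => tsupport_mul_subset_left, ?_, hconv⟩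
  · exact ((hφ1 n).continuous_fderiv (by simp)).memLp_of_hasCompactSupport
      (HasCompactSupport.fderiv ℝ hηc.mul_right)
  · have e : (fun x => H (u x) • fderiv ℝ η x + (η x * H' (u x)) • innerSL ℝ (G x)) =
        fun x => H (f x) • fderiv ℝ η x + (η x * H' (f x)) • F x := by
      ext1 x
      by_cases hx : x ∈ tsupport η
      · rw [(hfu x hx).1, (hfu x hx).2]
      · simp [(hη0 x hx).1, (hη0 x hx).2]
    rw [e]
    exact ((hH1.continuous.comp_aestronglyMeasurable hfm.1).smul hdm).add
      ((hηm.mul (hH'.comp_aestronglyMeasurable hfm.1)).smul hFm.1)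
  · filter_upwards [hlim] with x hx
    by_cases hxη : x ∈ tsupport η
    · rw [← (hfu x hxη).1]
      exact ((hH1.continuous.tendsto _).comp hx).const_mul _
    · simp [(hη0 x hxη).1]

end WeakGradient

/-! ### The weak equation with Sobolev test functions, and the Sobolev inequality. -/

section WeakEquation
open Filter Topology ContinuousLinearMap
open scoped Convolution ENNReal

variable {N : ℕ}

/-- `u ∈ W^{1,p}_loc(U)` with gradient `G`, together with a flux `a` which satisfies the `p`-growth
conditions and is weakly divergence free. -/
structure IsFlux (p C₀ C₁ : ℝ) (U : Set (Euc N)) (u : Euc N → ℝ) (G a : Euc N → Euc N) : Prop where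
  grad : HasWeakGradient p U u G
  meas : AEStronglyMeasurable a (volume.restrict U)
  growth : ∀ᵐ x ∂(volume.restrict U), C₀ * ‖G x‖ ^ p ≤ inner ℝ (a x) (G x) ∧
    ‖a x‖ ≤ C₁ * ‖G x‖ ^ (p - 1)
  weak : ∀ φ : Euc N → ℝ, IsTestFunction U φ → ∫ x in U, fderiv ℝ φ x (a x) = 0

variable {p C₀ C₁ : ℝ} {U : Set (Euc N)} {u : Euc N → ℝ} {G a : Euc N → Euc N}

/-- The exponent is conjugate to `p`, so pairing with the flux is continuous for `L^p` convergence
of gradients. -/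
theorem IsFlux.memLp_flux (hp : 1 < p) (h : IsFlux p C₀ C₁ U u G a) {K : Set (Euc N)}
    (hK : IsCompact K) (hKU : K ⊆ U) :
    MemLp a (ENNReal.ofReal p / ENNReal.ofReal (p - 1)) (volume.restrict K) := by
  have h1 := (h.grad.memLpLoc_grad K hKU hK).norm_rpow_div (ENNReal.ofReal (p - 1))
  rw [ENNReal.toReal_ofReal (by linarith)] at h1
  refine h1.of_le_mul (c := C₁) (h.meas.mono_measure (Measure.restrict_mono hKU le_rfl)) ?_
  filter_upwards [ae_restrict_of_ae_restrict_of_subset hKU h.growth] with x hx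
  rw [Real.norm_of_nonneg (by positivity)]
  exact hx.2

theorem IsFlux.holderTriple (hp : 1 < p) : ENNReal.HolderTriple (ENNReal.ofReal p)
    (ENNReal.ofReal p / ENNReal.ofReal (p - 1)) 1 := by
  constructor
  have h1 : 0 < p - 1 := by linarith
  have h0 : 0 < p := by linarith
  rw [ENNReal.inv_div (Or.inl (by simp)) (Or.inl (by simpa using hp)), ← ENNReal.ofReal_inv_of_pos h0,
    ← ENNReal.ofReal_div_of_pos h0, ← ENNReal.ofReal_add (by positivity) (by positivity), inv_one,
    ENNReal.ofReal_eq_one]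
  field_simp
  ring

theorem IsFlux.integrable_apply (hp : 1 < p) (h : IsFlux p C₀ C₁ U u G a) {K : Set (Euc N)}
    (hK : IsCompact K) (hKU : K ⊆ U) {F : Euc N → Euc N →L[ℝ] ℝ}
    (hF : MemLp F (ENNReal.ofReal p) volume) :
    Integrable (fun x => F x (a x)) (volume.restrict K) := by
  have := IsFlux.holderTriple hp
  rw [← memLp_one_iff_integrable]
  have ha := h.memLp_flux hp hK hKU
  refine ⟨?_, (eLpNorm_le_eLpNorm_mul_eLpNorm_of_nnnorm (hF.restrict K).1 ha.1
    (fun T v => T v) 1 (Eventually.of_forall fun x => ?_)).trans_lt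
    (ENNReal.mul_lt_top (ENNReal.mul_lt_top (by simp) (hF.restrict K).2) ha.2)⟩
  · exact (ContinuousLinearMap.apply ℝ ℝ).flip.aestronglyMeasurable_comp₂ (hF.restrict K).1 ha.1
  · rw [one_mul]; exact ContinuousLinearMap.le_opNNNorm _ _

theorem IsFlux.integral_eq_zero_of_tendsto (hp : 1 < p) (hU : IsOpen U)
    (h : IsFlux p C₀ C₁ U u G a)
    {K : Set (Euc N)} (hK : IsCompact K) (hKU : K ⊆ U) {ψ : ℕ → Euc N → ℝ}
    (hψ1 : ∀ n, ContDiff ℝ 1 (ψ n)) (hψK : ∀ᶠ n in atTop, tsupport (ψ n) ⊆ K)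
    (h0 : ∀ᶠ n in atTop, ∫ x in U, fderiv ℝ (ψ n) x (a x) = 0) {F : Euc N → Euc N →L[ℝ] ℝ}
    (hF : MemLp F (ENNReal.ofReal p) volume)
    (hlim : Tendsto (fun n => eLpNorm (fderiv ℝ (ψ n) - F) (ENNReal.ofReal p) volume)
      atTop (𝓝 0)) : ∫ x in K, F x (a x) = 0 := by
  have := IsFlux.holderTriple hp
  have ha := h.memLp_flux hp hK hKU
  have hm : ∀ᶠ n in atTop, MemLp (fderiv ℝ (ψ n)) (ENNReal.ofReal p) volume := by
    filter_upwards [hψK] with n hn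
    exact ((hψ1 n).continuous_fderiv (by simp)).memLp_of_hasCompactSupport
      (HasCompactSupport.fderiv ℝ (hK.of_isClosed_subset (isClosed_tsupport _) hn))
  have hL : Tendsto (fun n => ∫ x in K, fderiv ℝ (ψ n) x (a x)) atTop (𝓝 (∫ x in K, F x (a x))) := by
    refine tendsto_integral_of_L1' _ (h.integrable_apply hp hK hKU hF).1
      (hm.mono fun n hn => h.integrable_apply hp hK hKU hn) ?_
    have hb := ENNReal.Tendsto.mul_const (b := eLpNorm a
      (ENNReal.ofReal p / ENNReal.ofReal (p - 1)) (volume.restrict K)) hlim (Or.inr ha.2.ne)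
    rw [zero_mul] at hb
    refine tendsto_of_tendsto_of_tendsto_of_le_of_le' tendsto_const_nhds hb
      (Eventually.of_forall fun _ => zero_le) ?_
    filter_upwards [hm] with n hn
    have := eLpNorm_le_eLpNorm_mul_eLpNorm_of_nnnorm (p := ENNReal.ofReal p)
      (q := ENNReal.ofReal p / ENNReal.ofReal (p - 1)) (r := 1) ((hn.sub hF).restrict K).1 ha.1
      (fun T v => T v) 1 (Eventually.of_forall fun x => by
        rw [one_mul]; exact ContinuousLinearMap.le_opNNNorm _ _)
    rw [ENNReal.coe_one, one_mul] at this
    refine le_trans (le_of_eq ?_) (this.trans (by gcongr; exact Measure.restrict_le_self))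
    rfl
  refine tendsto_nhds_unique (hL.congr' ?_) tendsto_const_nhds
  filter_upwards [hψK, h0] with n hn hn0
  rw [← hn0]
  symm
  refine setIntegral_eq_of_subset_of_forall_sdiff_eq_zero hU.measurableSet hKU fun x hx => ?_
  rw [image_eq_zero_of_notMem_tsupport (f := fderiv ℝ (ψ n)) fun hx' =>
    hx.2 (hn (tsupport_fderiv_subset ℝ hx'))]
  rfl

/-- Mollifying `φ` gives smooth test functions, eventually supported in a fixed compact thickening
of its support, whose gradients converge in `L^p`. -/
theorem IsFlux.integral_eq_zero_of_contDiff_one (hp : 1 < p) (hU : IsOpen U)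
    (h : IsFlux p C₀ C₁ U u G a) {φ : Euc N → ℝ} (hφ : ContDiff ℝ 1 φ) (hφc : HasCompactSupport φ)
    (hφU : tsupport φ ⊆ U) : ∫ x in U, fderiv ℝ φ x (a x) = 0 := by
  have hp1 : 1 ≤ ENNReal.ofReal p := by simpa using hp.le
  obtain ⟨δ, hδ, hδU⟩ := hφc.isCompact.exists_cthickening_subset_open hU hφU
  have hK : IsCompact (Metric.cthickening δ (tsupport φ)) := hφc.isCompact.cthickening
  have hF : MemLp (fderiv ℝ φ) (ENNReal.ofReal p) volume :=
    (hφ.continuous_fderiv (by simp)).memLp_of_hasCompactSupport (hφc.fderiv ℝ)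
  have hρ := tendsto_shrinkingBump_rOut (Euc N)
  have hφl : LocallyIntegrable φ volume := hφ.continuous.locallyIntegrable
  have hsm : ∀ n, ContDiff ℝ ∞ ((shrinkingBump (Euc N) n).normed volume ⋆[lsmul ℝ ℝ, volume] φ) :=
    fun n => (shrinkingBump (Euc N) n).hasCompactSupport_normed.contDiff_convolution_left _
      (shrinkingBump (Euc N) n).contDiff_normed hφl
  have hts : ∀ᶠ n in atTop,
      tsupport ((shrinkingBump (Euc N) n).normed volume ⋆[lsmul ℝ ℝ, volume] φ) ⊆
        Metric.cthickening δ (tsupport φ) := by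
    filter_upwards [hρ.eventually_lt_const hδ] with n hn
    refine closure_minimal ((support_convolution_subset_swap _).trans ?_) hK.isClosed
    rw [ContDiffBump.support_normed_eq]
    rintro _ ⟨y, hy, z, hz, rfl⟩
    refine Metric.mem_cthickening_of_dist_le _ y _ _ (subset_tsupport φ hy) ?_
    have := hz
    simp only [Metric.mem_ball, dist_zero_right] at this
    simpa [dist_eq_norm] using (this.trans hn).le
  have h1 := h.integral_eq_zero_of_tendsto hp hU hK hδU (ψ := fun n =>
    (shrinkingBump (Euc N) n).normed volume ⋆[lsmul ℝ ℝ, volume] φ)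
    (fun n => (hsm n).of_le (by simp)) hts ?_ hF ?_
  · rw [← h1]
    refine setIntegral_eq_of_subset_of_forall_sdiff_eq_zero hU.measurableSet hδU fun x hx => ?_
    rw [image_eq_zero_of_notMem_tsupport (f := fderiv ℝ φ) fun hx' =>
      hx.2 (Metric.self_subset_cthickening _ (tsupport_fderiv_subset ℝ hx'))]
    rfl
  · filter_upwards [hts] with n hn
    exact h.weak _ ⟨hsm n, hK.of_isClosed_subset (isClosed_tsupport _) hn, hn.trans hδU⟩
  · have := tendsto_eLpNorm_convolution_sub hρ hp1 ENNReal.ofReal_ne_top hF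
    refine this.congr fun n => ?_
    congr 2
    ext1 x
    symm
    refine HasFDerivAt.fderiv ?_
    exact hφc.hasFDerivAt_convolution_right (lsmul ℝ ℝ)
      (shrinkingBump (Euc N) n).continuous_normed.locallyIntegrable hφ x

theorem IsFlux.integral_eq_zero (hp : 1 < p) (hU : IsOpen U) (h : IsFlux p C₀ C₁ U u G a)
    {K : Set (Euc N)} (hK : IsCompact K) (hKU : K ⊆ U) {f : Euc N → ℝ} {F : Euc N → Euc N →L[ℝ] ℝ}
    (hf : IsC1Limit p K f F) : ∫ x in K, F x (a x) = 0 := by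
  obtain ⟨hF, φ, h1, hs, -, hlim⟩ := hf
  exact h.integral_eq_zero_of_tendsto hp hU hK hKU h1 (Eventually.of_forall hs)
    (Eventually.of_forall fun n => h.integral_eq_zero_of_contDiff_one hp hU (h1 n)
      (hK.of_isClosed_subset (isClosed_tsupport _) (hs n)) ((hs n).trans hKU)) hF hlim

/-- The Sobolev inequality. -/
theorem exists_sobolev_const (N : ℕ) {p : ℝ} (hp : 1 ≤ p) (hpN : p < N) :
    ∃ S : ℝ, 0 < S ∧ ∀ (K : Set (Euc N)) (f : Euc N → ℝ) (F : Euc N → Euc N →L[ℝ] ℝ),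
      IsCompact K → IsC1Limit p K f F →
      eLpNorm f (ENNReal.ofReal ((p⁻¹ - (N : ℝ)⁻¹)⁻¹)) volume ≤
        ENNReal.ofReal S * eLpNorm F (ENNReal.ofReal p) volume := by
  have hN : 0 < N := by
    have : (0 : ℝ) < N := by linarith
    exact_mod_cast this
  have hp1 : 1 ≤ ENNReal.ofReal p := by simpa using hp
  set q := (p⁻¹ - (N : ℝ)⁻¹)⁻¹ with hq
  have hq0 : 0 ≤ q := by
    rw [hq, inv_nonneg, sub_nonneg]
    exact inv_anti₀ (by linarith) hpN.le
  set S := SNormLESNormFDerivOfEqConst ℝ (volume : Measure (Euc N)) p.toNNReal with hS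
  refine ⟨S + 1, by positivity, fun K f F hK ⟨hF, φ, h1, hs, hae, hlim⟩ => ?_⟩
  have hsob : ∀ n, eLpNorm (φ n) (ENNReal.ofReal q) volume ≤
      S * eLpNorm (fderiv ℝ (φ n)) (ENNReal.ofReal p) volume := fun n => by
    refine eLpNorm_le_eLpNorm_fderiv_of_eq volume (h1 n)
      (hK.of_isClosed_subset (isClosed_tsupport _) (hs n)) (p := p.toNNReal) (p' := q.toNNReal)
      (by simpa using hp) (by simpa using hN) ?_
    rw [NNReal.coe_inv, Real.coe_toNNReal p (by linarith), finrank_euclideanSpace_fin, hq]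
    exact (congrArg _ (Real.coe_toNNReal _ hq0)).trans (inv_inv _)
  have hb : ∀ n, eLpNorm (φ n) (ENNReal.ofReal q) volume ≤
      S * (eLpNorm (fderiv ℝ (φ n) - F) (ENNReal.ofReal p) volume
        + eLpNorm F (ENNReal.ofReal p) volume) := fun n => by
    refine (hsob n).trans ?_
    gcongr
    have hm : AEStronglyMeasurable (fderiv ℝ (φ n)) (volume : Measure (Euc N)) :=
      ((h1 n).continuous_fderiv (by simp)).aestronglyMeasurable
    have := eLpNorm_add_le (hm.sub hF.1) hF.1 hp1
    rwa [sub_add_cancel] at this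
  have hlim2 : Tendsto (fun n => (S : ℝ≥0∞) * (eLpNorm (fderiv ℝ (φ n) - F) (ENNReal.ofReal p) volume
        + eLpNorm F (ENNReal.ofReal p) volume)) atTop
      (𝓝 (S * (0 + eLpNorm F (ENNReal.ofReal p) volume))) :=
    ENNReal.Tendsto.const_mul (hlim.add_const _) (Or.inr (by simp))
  -- Fatou's lemma: almost everywhere convergence of the approximants is enough, and membership of
  -- `f` in `L^q` is part of the conclusion.
  have hfat := Lp.eLpNorm_lim_le_liminf_eLpNorm (p := ENNReal.ofReal q)
    (fun n => (h1 n).continuous.aestronglyMeasurable) f hae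
  refine hfat.trans ((liminf_le_liminf (Eventually.of_forall hb)).trans ?_)
  rw [hlim2.liminf_eq, zero_add]
  gcongr
  rw [ENNReal.ofReal_add (by positivity) (by positivity), ENNReal.ofReal_coe_nnreal]
  exact le_self_add

end WeakEquation

/-! ### A Poincaré inequality on convex sets by integration along segments. -/

section Poincare
open Filter Topology
open scoped ENNReal

variable {N : ℕ}

theorem lintegral_rotate {α β γ : Type*} [MeasurableSpace α] [MeasurableSpace β]
    [MeasurableSpace γ] (μ : Measure α) (ν : Measure β) (κ : Measure γ) [SFinite μ] [SFinite ν]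
    [SFinite κ] {f : α → β → γ → ℝ≥0∞} (hf : Measurable fun z : (α × β) × γ => f z.1.1 z.1.2 z.2) :
    ∫⁻ x, ∫⁻ y, ∫⁻ t, f x y t ∂κ ∂ν ∂μ = ∫⁻ t, ∫⁻ x, ∫⁻ y, f x y t ∂ν ∂μ ∂κ := by
  have h1 : ∀ x, ∫⁻ y, ∫⁻ t, f x y t ∂κ ∂ν = ∫⁻ t, ∫⁻ y, f x y t ∂ν ∂κ := fun x =>
    lintegral_lintegral_swap (hf.comp ((measurable_const.prodMk measurable_fst).prodMk
      measurable_snd)).aemeasurable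
  simp_rw [h1]
  refine lintegral_lintegral_swap (Measurable.aemeasurable ?_)
  exact Measurable.lintegral_prod_right' (f := fun z : (α × γ) × β => f z.1.1 z.2 z.1.2)
    (hf.comp (((measurable_fst.comp measurable_fst).prodMk measurable_snd).prodMk
      (measurable_snd.comp measurable_fst)))

/-- By convexity the contraction towards `x₀` stays in `Q`, and its inverse Jacobian `s ^ (-N)` is
at most `2 ^ N` because `s ≥ 1 / 2`. -/
theorem lintegral_comp_const_add_smul_le {Q : Set (Euc N)} (hQ : Convex ℝ Q)
    (hQm : MeasurableSet Q) {g : Euc N → ℝ≥0∞} (hg : Measurable g) {x₀ : Euc N} (hx₀ : x₀ ∈ Q)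
    {s : ℝ} (hs : 1 / 2 ≤ s) (hs1 : s ≤ 1) :
    ∫⁻ x in Q, g ((1 - s) • x₀ + s • x) ≤ 2 ^ N * ∫⁻ x in Q, g x := by
  have hs0 : 0 < s := by linarith
  have hm : Measurable (Q.indicator g) := hg.indicator hQm
  calc ∫⁻ x in Q, g ((1 - s) • x₀ + s • x)
      ≤ ∫⁻ x in Q, Q.indicator g ((1 - s) • x₀ + s • x) := by
        refine setLIntegral_mono' hQm fun x hx => ?_
        rw [indicator_of_mem (hQ hx₀ hx (by linarith) hs0.le (by ring))]
    _ ≤ ∫⁻ x, Q.indicator g ((1 - s) • x₀ + s • x) := setLIntegral_le_lintegral _ _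
    _ = ∫⁻ y, Q.indicator g ((1 - s) • x₀ + y) ∂(Measure.map (s • ·) volume) := by
        rw [lintegral_map (f := fun y => Q.indicator g ((1 - s) • x₀ + y))
          (hm.comp (measurable_const_add _)) (measurable_const_smul s)]
    _ = ENNReal.ofReal |(s ^ N)⁻¹| * ∫⁻ y, Q.indicator g ((1 - s) • x₀ + y) := by
        rw [Measure.map_addHaar_smul _ hs0.ne', lintegral_smul_measure, finrank_euclideanSpace_fin]
        rfl
    _ = ENNReal.ofReal |(s ^ N)⁻¹| * ∫⁻ y in Q, g y := by
        rw [lintegral_add_left_eq_self, lintegral_indicator hQm]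
    _ ≤ 2 ^ N * ∫⁻ y in Q, g y := by
        gcongr
        rw [abs_of_pos (by positivity), ← inv_pow]
        rw [show (2 : ℝ≥0∞) ^ N = ENNReal.ofReal (2 ^ N) by
          rw [ENNReal.ofReal_pow (by norm_num)]; norm_num]
        refine ENNReal.ofReal_le_ofReal (pow_le_pow_left₀ (by positivity) ?_ _)
        rw [inv_le_comm₀ hs0 (by norm_num)]
        linarith

/-- One of the weights `1 - t`, `t` is at least `1 / 2`; the change of variables is made in the
corresponding variable, so the bound is uniform in `t`. -/
theorem lintegral_lintegral_segment_le {Q : Set (Euc N)} (hQ : Convex ℝ Q)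
    (hQm : MeasurableSet Q) {g : Euc N → ℝ≥0∞} (hg : Measurable g) {t : ℝ} (ht : t ∈ Icc (0 : ℝ) 1) :
    ∫⁻ x in Q, ∫⁻ y in Q, g ((1 - t) • x + t • y) ≤
      volume Q * (2 ^ N * ∫⁻ x in Q, g x) := by
  rcases le_total t (1 / 2) with h | h
  · rw [lintegral_lintegral_swap]
    · refine (setLIntegral_mono' hQm (g := fun _ => 2 ^ N * ∫⁻ x in Q, g x) fun y hy => ?_).trans
        (by rw [setLIntegral_const, mul_comm])
      have := lintegral_comp_const_add_smul_le hQ hQm hg hy (s := 1 - t) (by linarith)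
        (by linarith [ht.1])
      simpa only [sub_sub_cancel, add_comm] using this
    · refine Measurable.aemeasurable (hg.comp ?_)
      exact (measurable_fst.const_smul (1 - t)).add (measurable_snd.const_smul t)
  · refine (setLIntegral_mono' hQm (g := fun _ => 2 ^ N * ∫⁻ x in Q, g x) fun x hx => ?_).trans
      (by rw [setLIntegral_const, mul_comm])
    exact lintegral_comp_const_add_smul_le hQ hQm hg hx h ht.2

theorem enorm_sub_rpow_le_lintegral_segment {p : ℝ} (hp : 1 ≤ p) {φ : Euc N → ℝ}
    (hφ : ContDiff ℝ 1 φ) {d : ℝ} (x y : Euc N) (hd : ‖x - y‖ ≤ d) :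
    ‖φ x - φ y‖ₑ ^ p ≤ ENNReal.ofReal d ^ p *
      ∫⁻ t in Icc (0 : ℝ) 1, ‖fderiv ℝ φ ((1 - t) • x + t • y)‖ₑ ^ p := by
  have hp0 : 0 < p := by linarith
  have hcd : Continuous (fderiv ℝ φ) := hφ.continuous_fderiv (by simp)
  have hcγ : Continuous fun t : ℝ => (1 - t) • x + t • y := by fun_prop
  have hder : ∀ t : ℝ, HasDerivAt (fun t : ℝ => φ ((1 - t) • x + t • y))
      (fderiv ℝ φ ((1 - t) • x + t • y) (y - x)) t := fun t => by
    have h1 : HasDerivAt (fun t : ℝ => (1 - t) • x + t • y) (y - x) t := by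
      have ha := ((hasDerivAt_id t).const_sub 1).smul_const x
      have hb := (hasDerivAt_id t).smul_const y
      have hab := ha.add hb
      rw [neg_one_smul, one_smul, neg_add_eq_sub] at hab
      exact hab
    exact ((hφ.differentiable (by simp) _).hasFDerivAt).comp_hasDerivAt t h1
  have hint : ∫ t in (0 : ℝ)..1, fderiv ℝ φ ((1 - t) • x + t • y) (y - x) = φ y - φ x := by
    rw [intervalIntegral.integral_eq_sub_of_hasDerivAt (fun t _ => hder t)]
    · simp
    · exact ((hcd.comp hcγ).clm_apply continuous_const).intervalIntegrable _ _
  have hpr : IsProbabilityMeasure (volume.restrict (Icc (0 : ℝ) 1)) := ⟨by simp⟩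
  have h1 : ‖φ x - φ y‖ₑ ≤ ENNReal.ofReal d *
      ∫⁻ t in Icc (0 : ℝ) 1, ‖fderiv ℝ φ ((1 - t) • x + t • y)‖ₑ := by
    rw [← enorm_neg, neg_sub, ← hint, intervalIntegral.integral_of_le zero_le_one,
      ← integral_Icc_eq_integral_Ioc, ← lintegral_const_mul' _ _ ENNReal.ofReal_ne_top]
    refine (enorm_integral_le_lintegral_enorm _).trans (lintegral_mono fun t => ?_)
    refine (ContinuousLinearMap.le_opENorm _ _).trans ?_
    rw [mul_comm]
    gcongr
    rw [← ofReal_norm, norm_sub_rev]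
    exact ENNReal.ofReal_le_ofReal hd
  have h2 := eLpNorm'_le_eLpNorm'_of_exponent_le (μ := volume.restrict (Icc (0 : ℝ) 1))
    (f := fun t => fderiv ℝ φ ((1 - t) • x + t • y)) zero_lt_one hp
    (hcd.comp hcγ).aestronglyMeasurable
  simp only [eLpNorm', ENNReal.rpow_one, one_div, inv_one] at h2
  refine (ENNReal.rpow_le_rpow (h1.trans (mul_le_mul_right h2 _)) hp0.le).trans ?_
  rw [ENNReal.mul_rpow_of_nonneg _ _ hp0.le, ← ENNReal.rpow_mul, inv_mul_cancel₀ hp0.ne',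
    ENNReal.rpow_one]

/-- The difference is integrated along the segment from `x` to `y`; after exchanging integrals, each
parameter `t` is handled by `lintegral_lintegral_segment_le`. -/
theorem lintegral_lintegral_enorm_sub_rpow_le {p : ℝ} (hp : 1 ≤ p) {Q : Set (Euc N)}
    (hQ : Convex ℝ Q) (hQm : MeasurableSet Q) {d : ℝ} (hd : ∀ x ∈ Q, ∀ y ∈ Q, ‖x - y‖ ≤ d)
    {φ : Euc N → ℝ} (hφ : ContDiff ℝ 1 φ) :
    ∫⁻ x in Q, ∫⁻ y in Q, ‖φ x - φ y‖ₑ ^ p ≤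
      ENNReal.ofReal d ^ p * (volume Q * (2 ^ N * ∫⁻ x in Q, ‖fderiv ℝ φ x‖ₑ ^ p)) := by
  have hp0 : 0 < p := by linarith
  set g : Euc N → ℝ≥0∞ := fun x => ‖fderiv ℝ φ x‖ₑ ^ p with hg
  have hgm : Measurable g :=
    (hφ.continuous_fderiv (by simp)).enorm.measurable.pow_const _
  have hne : ENNReal.ofReal d ^ p ≠ ⊤ := by simp [hp0.le]
  have hjoint : Measurable fun z : (Euc N × Euc N) × ℝ => g ((1 - z.2) • z.1.1 + z.2 • z.1.2) := by
    refine hgm.comp (Continuous.measurable ?_)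
    fun_prop
  calc ∫⁻ x in Q, ∫⁻ y in Q, ‖φ x - φ y‖ₑ ^ p
      ≤ ∫⁻ x in Q, ∫⁻ y in Q, ENNReal.ofReal d ^ p *
          ∫⁻ t in Icc (0 : ℝ) 1, g ((1 - t) • x + t • y) :=
        setLIntegral_mono' hQm fun x hx => setLIntegral_mono' hQm fun y hy =>
          enorm_sub_rpow_le_lintegral_segment hp hφ x y (hd x hx y hy)
    _ = ENNReal.ofReal d ^ p * ∫⁻ x in Q, ∫⁻ y in Q,
          ∫⁻ t in Icc (0 : ℝ) 1, g ((1 - t) • x + t • y) := by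
        simp_rw [lintegral_const_mul' _ _ hne]
    _ = ENNReal.ofReal d ^ p * ∫⁻ t in Icc (0 : ℝ) 1, ∫⁻ x in Q, ∫⁻ y in Q,
          g ((1 - t) • x + t • y) := by
        rw [lintegral_rotate _ _ _ hjoint]
    _ ≤ ENNReal.ofReal d ^ p * ∫⁻ t in Icc (0 : ℝ) 1, volume Q * (2 ^ N * ∫⁻ x in Q, g x) := by
        refine mul_le_mul_right ?_ _
        exact setLIntegral_mono' measurableSet_Icc fun t ht =>
          lintegral_lintegral_segment_le hQ hQm hgm ht
    _ = _ := by simp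

theorem eLpNorm_rpow_eq_lintegral {α F : Type*} [MeasurableSpace α] [NormedAddCommGroup F]
    {p : ℝ} (hp : 0 < p) (f : α → F) (μ : Measure α) :
    eLpNorm f (ENNReal.ofReal p) μ ^ p = ∫⁻ x, ‖f x‖ₑ ^ p ∂μ := by
  rw [eLpNorm_eq_lintegral_rpow_enorm_toReal (by simpa using hp) ENNReal.ofReal_ne_top,
    ENNReal.toReal_ofReal hp.le, ← ENNReal.rpow_mul, one_div, inv_mul_cancel₀ hp.ne',
    ENNReal.rpow_one]

theorem IsC1Limit.lintegral_lintegral_enorm_sub_rpow_le {p : ℝ} (hp : 1 ≤ p) {Q : Set (Euc N)}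
    (hQ : Convex ℝ Q) (hQm : MeasurableSet Q) (hQfin : volume Q ≠ ⊤)
    {d : ℝ} (hd : ∀ x ∈ Q, ∀ y ∈ Q, ‖x - y‖ ≤ d)
    {K : Set (Euc N)} {f : Euc N → ℝ} {F : Euc N → Euc N →L[ℝ] ℝ} (hf : IsC1Limit p K f F) :
    ∫⁻ x in Q, ∫⁻ y in Q, ‖f x - f y‖ₑ ^ p ≤
      ENNReal.ofReal d ^ p * (volume Q * (2 ^ N * ∫⁻ x in Q, ‖F x‖ₑ ^ p)) := by
  have hp0 : 0 < p := by linarith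
  have hp1 : 1 ≤ ENNReal.ofReal p := by simpa using hp
  obtain ⟨hF, φ, h1, -, hae, hlim⟩ := hf
  set c : ℝ≥0∞ := ENNReal.ofReal d ^ p * (volume Q * 2 ^ N) with hc
  have hcfin : c ≠ ⊤ := ENNReal.mul_ne_top (by simp [hp0.le]) (ENNReal.mul_ne_top hQfin (by simp))
  set μ := (volume : Measure (Euc N)).restrict Q with hμ
  have haeQ : ∀ᵐ x ∂μ, Tendsto (fun n => φ n x) atTop (𝓝 (f x)) := ae_restrict_of_ae hae
  have hm : ∀ n, Measurable fun z : Euc N × Euc N => ‖φ n z.1 - φ n z.2‖ₑ ^ p := fun n =>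
    (((h1 n).continuous.comp continuous_fst).sub
      ((h1 n).continuous.comp continuous_snd)).enorm.measurable.pow_const _
  have hlimsub : ∀ᵐ x ∂μ, ∀ᵐ y ∂μ,
      Tendsto (fun n => ‖φ n x - φ n y‖ₑ ^ p) atTop (𝓝 (‖f x - f y‖ₑ ^ p)) := by
    filter_upwards [haeQ] with x hx
    filter_upwards [haeQ] with y hy
    exact (hx.sub hy).enorm.ennrpow_const p
  have hb : ∀ n, ∫⁻ x, ∫⁻ y, ‖φ n x - φ n y‖ₑ ^ p ∂μ ∂μ ≤
      c * (eLpNorm (fderiv ℝ (φ n) - F) (ENNReal.ofReal p) volume +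
        eLpNorm F (ENNReal.ofReal p) μ) ^ p := fun n => by
    refine (_root_.lintegral_lintegral_enorm_sub_rpow_le hp hQ hQm hd (h1 n)).trans ?_
    rw [← eLpNorm_rpow_eq_lintegral hp0, hc, mul_assoc, mul_assoc]
    gcongr
    have hmn : AEStronglyMeasurable (fderiv ℝ (φ n)) μ :=
      ((h1 n).continuous_fderiv (by simp)).aestronglyMeasurable
    have h3 := eLpNorm_add_le (hmn.sub hF.1.restrict) hF.1.restrict hp1
    rw [sub_add_cancel] at h3
    refine h3.trans ?_
    gcongr
    exact Measure.restrict_le_self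
  have hlim2 : Tendsto (fun n => c * (eLpNorm (fderiv ℝ (φ n) - F) (ENNReal.ofReal p) volume +
        eLpNorm F (ENNReal.ofReal p) μ) ^ p) atTop
        (𝓝 (c * (0 + eLpNorm F (ENNReal.ofReal p) μ) ^ p)) :=
    ENNReal.Tendsto.const_mul ((hlim.add_const _).ennrpow_const p) (Or.inr hcfin)
  calc ∫⁻ x, ∫⁻ y, ‖f x - f y‖ₑ ^ p ∂μ ∂μ
      = ∫⁻ x, ∫⁻ y, liminf (fun n => ‖φ n x - φ n y‖ₑ ^ p) atTop ∂μ ∂μ := by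
        refine lintegral_congr_ae ?_
        filter_upwards [hlimsub] with x hx
        refine lintegral_congr_ae ?_
        filter_upwards [hx] with y hy
        exact hy.liminf_eq.symm
    _ ≤ ∫⁻ x, liminf (fun n => ∫⁻ y, ‖φ n x - φ n y‖ₑ ^ p ∂μ) atTop ∂μ :=
        lintegral_mono fun x => lintegral_liminf_le fun n => (hm n).comp measurable_prodMk_left
    _ ≤ liminf (fun n => ∫⁻ x, ∫⁻ y, ‖φ n x - φ n y‖ₑ ^ p ∂μ ∂μ) atTop :=
        lintegral_liminf_le fun n => (hm n).lintegral_prod_right'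
    _ ≤ c * eLpNorm F (ENNReal.ofReal p) μ ^ p := by
        refine (liminf_le_liminf (Eventually.of_forall hb)).trans ?_
        rw [hlim2.liminf_eq, zero_add]
    _ = _ := by rw [eLpNorm_rpow_eq_lintegral hp0, hc]; ring

/-- A Poincaré inequality for functions vanishing on a set of positive measure. -/
theorem IsC1Limit.poincare {p : ℝ} (hp : 1 ≤ p) {Q : Set (Euc N)}
    (hQ : Convex ℝ Q) (hQm : MeasurableSet Q) (hQfin : volume Q ≠ ⊤)
    {d : ℝ} (hd : ∀ x ∈ Q, ∀ y ∈ Q, ‖x - y‖ ≤ d)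
    {K : Set (Euc N)} {f : Euc N → ℝ} {F : Euc N → Euc N →L[ℝ] ℝ} (hf : IsC1Limit p K f F)
    {E : Set (Euc N)} (hEQ : E ⊆ Q) (hE : ∀ᵐ x ∂(volume.restrict E), f x = 0) :
    volume E * ∫⁻ y in Q, ‖f y‖ₑ ^ p ≤
      ENNReal.ofReal d ^ p * (volume Q * (2 ^ N * ∫⁻ x in Q, ‖F x‖ₑ ^ p)) := by
  refine le_trans ?_ (hf.lintegral_lintegral_enorm_sub_rpow_le hp hQ hQm hQfin hd)
  -- In the double integral, keep only those `x` in the zero set `E`: there `f x - f y` reduces to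
  -- `-f y`.
  refine le_trans (le_of_eq ?_) (lintegral_mono_set hEQ)
  rw [mul_comm, ← setLIntegral_const]
  refine lintegral_congr_ae ?_
  filter_upwards [hE] with x hx
  simp [hx]

end Poincare

/-! ### The abstract energy estimate. -/

section Caccioppoli
open Filter Topology
open scoped ENNReal

variable {N : ℕ}

/-- Hölder bounds the right side by `‖X‖ ^ (p - 1) * ‖Y‖`, and dividing by the finite quantity `‖X‖
^ (p - 1)` replaces absorption through Young's inequality. If `Y` is not in `L^p` the bound is
trivial. -/
theorem eLpNorm_le_of_integral_rpow_le {α : Type*} [MeasurableSpace α] {μ : Measure α} {p : ℝ}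
    (hp : 1 < p) {X Y : α → ℝ} (hX : MemLp X (ENNReal.ofReal p) μ) (hY : AEStronglyMeasurable Y μ)
    (hX0 : ∀ᵐ x ∂μ, 0 ≤ X x) (hY0 : ∀ᵐ x ∂μ, 0 ≤ Y x) {c d : ℝ} (hc : 0 < c) (hd : 0 < d)
    (h : MemLp Y (ENNReal.ofReal p) μ → c * ∫ x, X x ^ p ∂μ ≤ d * ∫ x, X x ^ (p - 1) * Y x ∂μ) :
    eLpNorm X (ENNReal.ofReal p) μ ≤ ENNReal.ofReal (d / c) * eLpNorm Y (ENNReal.ofReal p) μ := by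
  have hp0 : 0 < p := by linarith
  have hp1 : 0 < p - 1 := by linarith
  by_cases hYp : MemLp Y (ENNReal.ofReal p) μ
  swap
  · have : eLpNorm Y (ENNReal.ofReal p) μ = ⊤ := by
      by_contra hne
      exact hYp ⟨hY, lt_top_iff_ne_top.2 hne⟩
    rw [this, ENNReal.mul_top (by simpa using div_pos hd hc)]
    exact le_top
  specialize h hYp
  have hconj : (p / (p - 1)).HolderConjugate p := (Real.HolderConjugate.conjExponent hp).symm
  have hXp : MemLp (fun x => X x ^ (p - 1)) (ENNReal.ofReal (p / (p - 1))) μ := by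
    have h1 := hX.norm_rpow_div (ENNReal.ofReal (p - 1))
    rw [ENNReal.toReal_ofReal hp1.le, ← ENNReal.ofReal_div_of_pos hp1] at h1
    refine h1.ae_eq ?_
    filter_upwards [hX0] with x hx
    rw [Real.norm_of_nonneg hx]
  have hol := integral_mul_le_Lp_mul_Lq_of_nonneg hconj
    (hX0.mono fun x hx => Real.rpow_nonneg hx (p - 1)) hY0 hXp hYp
  have e1 : ∫ x, (X x ^ (p - 1)) ^ (p / (p - 1)) ∂μ = ∫ x, X x ^ p ∂μ := by
    refine integral_congr_ae ?_
    filter_upwards [hX0] with x hx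
    rw [← Real.rpow_mul hx, mul_div_cancel₀ _ hp1.ne']
  rw [e1] at hol
  have eX : eLpNorm X (ENNReal.ofReal p) μ = ENNReal.ofReal ((∫ x, X x ^ p ∂μ) ^ (1 / p)) := by
    rw [hX.eLpNorm_eq_integral_rpow_norm (by simpa using hp0) ENNReal.ofReal_ne_top,
      ENNReal.toReal_ofReal hp0.le, one_div]
    congr 2
    refine integral_congr_ae ?_
    filter_upwards [hX0] with x hx
    rw [Real.norm_of_nonneg hx]
  have eY : eLpNorm Y (ENNReal.ofReal p) μ = ENNReal.ofReal ((∫ x, Y x ^ p ∂μ) ^ (1 / p)) := by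
    rw [hYp.eLpNorm_eq_integral_rpow_norm (by simpa using hp0) ENNReal.ofReal_ne_top,
      ENNReal.toReal_ofReal hp0.le, one_div]
    congr 2
    refine integral_congr_ae ?_
    filter_upwards [hY0] with x hx
    rw [Real.norm_of_nonneg hx]
  rw [eX, eY, ← ENNReal.ofReal_mul (by positivity)]
  refine ENNReal.ofReal_le_ofReal ?_
  have hA : 0 ≤ ∫ x, X x ^ p ∂μ := integral_nonneg_of_ae (hX0.mono fun x hx => Real.rpow_nonneg hx p)
  have hB : 0 ≤ ∫ x, Y x ^ p ∂μ := integral_nonneg_of_ae (hY0.mono fun x hx => Real.rpow_nonneg hx p)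
  generalize (∫ x, X x ^ p ∂μ) = A at *
  generalize (∫ x, Y x ^ p ∂μ) = B at *
  rcases hA.eq_or_lt with hA0 | hA0
  · rw [← hA0, Real.zero_rpow (by positivity)]
    positivity
  have h1 : c * A ≤ d * (A ^ (1 / (p / (p - 1))) * B ^ (1 / p)) :=
    h.trans (by gcongr)
  have h2 : A = A ^ (1 / (p / (p - 1))) * A ^ (1 / p) := by
    rw [← Real.rpow_add hA0]
    conv_lhs => rw [← Real.rpow_one A]
    congr 1
    field_simp
    ring
  have h3 : 0 < A ^ (1 / (p / (p - 1))) := by positivity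
  rw [div_mul_eq_mul_div, le_div_iff₀ hc]
  nlinarith

variable {p C₀ C₁ : ℝ} {U : Set (Euc N)} {u : Euc N → ℝ} {G a : Euc N → Euc N}

theorem IsC1Limit.mono {K L : Set (Euc N)} {f : Euc N → ℝ} {F : Euc N → Euc N →L[ℝ] ℝ}
    (h : IsC1Limit p K f F) (hKL : K ⊆ L) : IsC1Limit p L f F := by
  obtain ⟨hF, φ, h1, hs, h2⟩ := h
  exact ⟨hF, φ, h1, fun n => (hs n).trans hKL, h2⟩

theorem IsFlux.aestronglyMeasurable_comp (h : IsFlux p C₀ C₁ U u G a) {K : Set (Euc N)}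
    (hK : IsCompact K) (hKU : K ⊆ U) {H : ℝ → ℝ} (hH : Measurable H) :
    AEStronglyMeasurable (fun x => H (u x)) (volume.restrict K) :=
  (hH.comp_aemeasurable (h.grad.memLpLoc K hKU hK).1.aemeasurable).aestronglyMeasurable

/-- Test the equation with `η ^ p * H(u)`. Coercivity bounds the term with `H'` below, and the
growth of the flux bounds the term with `fderiv ℝ η` above. `X` stands for the quantity to be
estimated and `Y` for its bound; each application only has to choose `H`, `X` and `Y`. -/
theorem IsFlux.eLpNorm_le (hp : 1 < p) (hC₀ : 0 < C₀) (hC₁ : 0 < C₁) (hU : IsOpen U)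
    (h : IsFlux p C₀ C₁ U u G a)
    {η : Euc N → ℝ} (hη : ContDiff ℝ 1 η) (hηc : HasCompactSupport η) (hηU : tsupport η ⊆ U)
    (hη0 : ∀ x, 0 ≤ η x)
    {H H' : ℝ → ℝ} (hH : ∀ t, HasDerivAt H (H' t) t) (hH' : Continuous H') {B : ℝ}
    (hB : ∀ t, |H' t| ≤ B) {X Y : Euc N → ℝ} {c : ℝ} (hc : 0 < c)
    (hX : MemLp X (ENNReal.ofReal p) (volume.restrict (tsupport η)))
    (hY : AEStronglyMeasurable Y (volume.restrict (tsupport η)))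
    (hX0 : ∀ᵐ x ∂(volume.restrict U), 0 ≤ X x) (hY0 : ∀ᵐ x ∂(volume.restrict U), 0 ≤ Y x)
    (hXH : ∀ᵐ x ∂(volume.restrict U), X x ^ p ≤ c * (η x ^ p * H' (u x) * ‖G x‖ ^ p))
    (hH'0 : ∀ᵐ x ∂(volume.restrict U), 0 ≤ H' (u x))
    (hXY : ∀ᵐ x ∂(volume.restrict U), η x ^ (p - 1) * |H (u x)| * ‖fderiv ℝ η x‖ * ‖G x‖ ^ (p - 1) ≤
      X x ^ (p - 1) * Y x) :
    eLpNorm X (ENNReal.ofReal p) (volume.restrict (tsupport η)) ≤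
      ENNReal.ofReal (p * C₁ * c / C₀) *
        eLpNorm Y (ENNReal.ofReal p) (volume.restrict (tsupport η)) := by
  have hp0 : 0 < p := by linarith
  set K := tsupport η with hK
  have hKc : IsCompact K := hηc.isCompact
  have hζ : ContDiff ℝ 1 fun x => η x ^ p := by
    exact_mod_cast ContDiff.rpow_const_of_le (m := 1) (by exact_mod_cast hη) (by exact_mod_cast hp.le)
  have hζK : tsupport (fun x => η x ^ p) ⊆ K := by
    refine closure_mono fun x hx => ?_
    simp only [Function.mem_support] at hx ⊢
    rintro h0
    exact hx (by rw [h0, Real.zero_rpow hp0.ne'])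
  have hζd : ∀ x, fderiv ℝ (fun x => η x ^ p) x = (p * η x ^ (p - 1)) • fderiv ℝ η x := fun x =>
    (((hη.differentiable (by simp) x).hasFDerivAt).rpow_const (Or.inr hp.le)).fderiv
  have hlim := (isC1Limit_mul_comp hp.le hU h.grad hζ
    (hKc.of_isClosed_subset (isClosed_tsupport _) hζK) (hζK.trans hηU) hH hH' hB).mono hζK
  have hz := h.integral_eq_zero hp hU hKc hηU hlim
  have hFi := h.integrable_apply hp hKc hηU hlim.1
  refine (eLpNorm_le_of_integral_rpow_le hp hX hY
    (ae_restrict_of_ae_restrict_of_subset hηU hX0) (ae_restrict_of_ae_restrict_of_subset hηU hY0)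
    hC₀ (d := p * C₁ * c) (by positivity) fun hYp => ?_)
  have hconj : (p / (p - 1)).HolderConjugate p := (Real.HolderConjugate.conjExponent hp).symm
  have hp1 : 0 < p - 1 := by linarith
  have hX0' := ae_restrict_of_ae_restrict_of_subset hηU hX0
  have hXp : MemLp (fun x => X x ^ (p - 1)) (ENNReal.ofReal p / ENNReal.ofReal (p - 1))
      (volume.restrict K) := by
    have h1 := hX.norm_rpow_div (ENNReal.ofReal (p - 1))
    rw [ENNReal.toReal_ofReal hp1.le] at h1
    refine h1.ae_eq ?_
    filter_upwards [hX0'] with x hx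
    rw [Real.norm_of_nonneg hx]
  have hi1 : Integrable (fun x => X x ^ (p - 1) * Y x) (volume.restrict K) := by
    have := (IsFlux.holderTriple hp).symm
    exact hXp.integrable_mul hYp
  have hi2 : Integrable (fun x => X x ^ p) (volume.restrict K) := by
    have := hX.integrable_norm_rpow (by simpa using hp0) ENNReal.ofReal_ne_top
    rw [ENNReal.toReal_ofReal hp0.le] at this
    refine this.congr ?_
    filter_upwards [hX0'] with x hx
    rw [Real.norm_of_nonneg hx]
  have key : ∀ᵐ x ∂(volume.restrict K), C₀ * X x ^ p ≤ c *
      ((H (u x) • fderiv ℝ (fun x => η x ^ p) x + (η x ^ p * H' (u x)) • innerSL ℝ (G x)) (a x))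
      + p * C₁ * c * (X x ^ (p - 1) * Y x) := by
    filter_upwards [ae_restrict_of_ae_restrict_of_subset hηU h.growth,
      ae_restrict_of_ae_restrict_of_subset hηU hXH, ae_restrict_of_ae_restrict_of_subset hηU hH'0,
      ae_restrict_of_ae_restrict_of_subset hηU hXY] with x hg hx1 hx2 hx3
    rw [hζd]
    simp only [add_apply, smul_apply, smul_eq_mul, innerSL_apply_apply]
    have hη0x := hη0 x
    have b1 : C₀ * X x ^ p ≤ c * (η x ^ p * H' (u x) * inner ℝ (G x) (a x)) := by
      calc C₀ * X x ^ p ≤ C₀ * (c * (η x ^ p * H' (u x) * ‖G x‖ ^ p)) := by gcongr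
        _ = c * (η x ^ p * H' (u x) * (C₀ * ‖G x‖ ^ p)) := by ring
        _ ≤ _ := by
          rw [real_inner_comm]
          gcongr
          exact hg.1
    have b2 : |H (u x) * (p * η x ^ (p - 1) * fderiv ℝ η x (a x))| ≤
        p * C₁ * (X x ^ (p - 1) * Y x) := by
      rw [abs_mul, abs_mul, abs_of_nonneg (a := p * η x ^ (p - 1)) (by positivity)]
      calc |H (u x)| * (p * η x ^ (p - 1) * |fderiv ℝ η x (a x)|)
          ≤ |H (u x)| * (p * η x ^ (p - 1) * (‖fderiv ℝ η x‖ * (C₁ * ‖G x‖ ^ (p - 1)))) := by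
            gcongr
            refine ((fderiv ℝ η x).le_opNorm (a x)).trans ?_
            gcongr
            exact hg.2
        _ = p * C₁ * (η x ^ (p - 1) * |H (u x)| * ‖fderiv ℝ η x‖ * ‖G x‖ ^ (p - 1)) := by ring
        _ ≤ _ := by gcongr
    have b3 := neg_le_of_abs_le b2
    nlinarith
  have hI := integral_mono_ae (hi2.const_mul C₀) ((hFi.const_mul c).add (hi1.const_mul (p * C₁ * c)))
    key
  rw [integral_const_mul, integral_add' (hFi.const_mul c) (hi1.const_mul (p * C₁ * c)),
    integral_const_mul, integral_const_mul, hz, mul_zero, zero_add] at hI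
  exact hI

end Caccioppoli

/-! ### Smooth truncations. -/

section Huber
open Filter Topology
open scoped ENNReal

/-- The piecewise linear function which is `0` up to `k` and `1` from `k + d` on. -/
noncomputable def ramp (k d t : ℝ) : ℝ := max 0 (min 1 ((t - k) / d))

/-- The primitive of `ramp`, a convex `C¹` approximation of `t ↦ max (t - k) 0`. -/
noncomputable def huber (k d t : ℝ) : ℝ := ∫ s in k..t, ramp k d s

/-- The primitive of the `p`-th power of `ramp`. -/
noncomputable def huberPow (p k d t : ℝ) : ℝ := ∫ s in k..t, ramp k d s ^ p

variable {k d p : ℝ}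

theorem continuous_ramp : Continuous (ramp k d) := by unfold ramp; fun_prop

theorem ramp_nonneg (t : ℝ) : 0 ≤ ramp k d t := le_max_left _ _

theorem ramp_le_one (t : ℝ) : ramp k d t ≤ 1 := max_le zero_le_one (min_le_left _ _)

theorem ramp_mono (hd : 0 < d) : Monotone (ramp k d) := fun s t hst => by
  unfold ramp; gcongr

theorem ramp_eq_zero (hd : 0 < d) {t : ℝ} (ht : t ≤ k) : ramp k d t = 0 :=
  max_eq_left ((min_le_right _ _).trans (div_nonpos_of_nonpos_of_nonneg (by linarith) hd.le))

theorem ramp_eq_one (hd : 0 < d) {t : ℝ} (ht : k + d ≤ t) : ramp k d t = 1 := by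
  unfold ramp
  rw [min_eq_left, max_eq_right zero_le_one]
  rw [le_div_iff₀ hd]; linarith

theorem hasDerivAt_huber (t : ℝ) : HasDerivAt (huber k d) (ramp k d t) t :=
  intervalIntegral.integral_hasDerivAt_right (continuous_ramp.intervalIntegrable _ _)
    (continuous_ramp.stronglyMeasurableAtFilter _ _) continuous_ramp.continuousAt

theorem continuous_ramp_rpow (hp : 0 ≤ p) : Continuous fun t => ramp k d t ^ p :=
  continuous_ramp.rpow_const fun _ => Or.inr hp

theorem hasDerivAt_huberPow (hp : 0 ≤ p) (t : ℝ) :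
    HasDerivAt (huberPow p k d) (ramp k d t ^ p) t :=
  intervalIntegral.integral_hasDerivAt_right ((continuous_ramp_rpow hp).intervalIntegrable _ _)
    ((continuous_ramp_rpow hp).stronglyMeasurableAtFilter _ _) (continuous_ramp_rpow hp).continuousAt

theorem huber_eq_zero (hd : 0 < d) {t : ℝ} (ht : t ≤ k) : huber k d t = 0 := by
  unfold huber
  rw [intervalIntegral.integral_symm, intervalIntegral.integral_of_le ht,
    setIntegral_eq_zero_of_forall_eq_zero, neg_zero]
  exact fun s hs => ramp_eq_zero hd hs.2

theorem huberPow_eq_zero (hp : 0 < p) (hd : 0 < d) {t : ℝ} (ht : t ≤ k) : huberPow p k d t = 0 := by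
  unfold huberPow
  rw [intervalIntegral.integral_symm, intervalIntegral.integral_of_le ht,
    setIntegral_eq_zero_of_forall_eq_zero, neg_zero]
  exact fun s hs => by rw [ramp_eq_zero hd hs.2, Real.zero_rpow hp.ne']

theorem huber_nonneg (hd : 0 < d) (t : ℝ) : 0 ≤ huber k d t := by
  rcases le_total t k with ht | ht
  · exact (huber_eq_zero hd ht).ge
  · exact intervalIntegral.integral_nonneg ht fun s _ => ramp_nonneg s

theorem huberPow_nonneg (hp : 0 < p) (hd : 0 < d) (t : ℝ) : 0 ≤ huberPow p k d t := by
  rcases le_total t k with ht | ht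
  · exact (huberPow_eq_zero hp hd ht).ge
  · exact intervalIntegral.integral_nonneg ht fun s _ => Real.rpow_nonneg (ramp_nonneg s) p

theorem huber_le (hd : 0 < d) (t : ℝ) : huber k d t ≤ max (t - k) 0 := by
  rcases le_total t k with ht | ht
  · rw [huber_eq_zero hd ht]; exact le_max_right _ _
  · refine le_trans ?_ (le_max_left _ _)
    have := intervalIntegral.integral_mono_on ht (continuous_ramp.intervalIntegrable _ _)
      (continuous_const.intervalIntegrable _ _) (μ := volume) (g := fun _ => (1 : ℝ))
      (fun s _ => ramp_le_one (k := k) (d := d) s)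
    simpa [huber] using this

/-- With `huber_le`, this places the `C¹` truncation between two sharp ones whose levels differ by
`d`. The level must rise at each iteration step anyway, so smoothing costs nothing and the chain
rule for Lipschitz functions is avoided. -/
theorem le_huber (hd : 0 < d) (t : ℝ) : max (t - (k + d)) 0 ≤ huber k d t := by
  refine max_le ?_ (huber_nonneg hd t)
  rcases le_total t (k + d) with ht | ht
  · exact le_trans (by linarith) (huber_nonneg hd t)
  · have h1 : huber k d t = (∫ s in k..(k + d), ramp k d s) + ∫ s in (k + d)..t, ramp k d s :=
      (intervalIntegral.integral_add_adjacent_intervals (continuous_ramp.intervalIntegrable _ _)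
        (continuous_ramp.intervalIntegrable _ _)).symm
    have h2 : ∫ s in (k + d)..t, ramp k d s = t - (k + d) := by
      rw [intervalIntegral.integral_congr (g := fun _ => (1 : ℝ))]
      · simp
      · intro s hs
        rw [uIcc_of_le ht] at hs
        exact ramp_eq_one hd hs.1
    have h3 : 0 ≤ ∫ s in k..(k + d), ramp k d s :=
      intervalIntegral.integral_nonneg (by linarith) fun s _ => ramp_nonneg s
    linarith

/-- Since `ramp` is nondecreasing, `p - 1` of its factors may be replaced by their value at the end
point `t`. -/
theorem huberPow_le (hp : 1 ≤ p) (hd : 0 < d) (t : ℝ) :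
    huberPow p k d t ≤ huber k d t * ramp k d t ^ (p - 1) := by
  rcases le_total t k with ht | ht
  · rw [huberPow_eq_zero (by linarith) hd ht, huber_eq_zero hd ht, zero_mul]
  · unfold huberPow huber
    rw [← intervalIntegral.integral_mul_const]
    refine intervalIntegral.integral_mono_on ht
      ((continuous_ramp_rpow (by linarith)).intervalIntegrable _ _)
      ((continuous_ramp.mul continuous_const).intervalIntegrable _ _) fun s hs => ?_
    have h0 := ramp_nonneg (k := k) (d := d) s
    have e : ramp k d s ^ p = ramp k d s * ramp k d s ^ (p - 1) := by
      rcases h0.eq_or_lt with h | h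
      · rw [← h, Real.zero_rpow (by linarith), zero_mul]
      · rw [← Real.rpow_one_add' h.le (by linarith)]; congr 1; ring
    rw [e]
    gcongr
    exact ramp_mono hd hs.2

theorem huberPow_mono (hp : 0 ≤ p) : Monotone (huberPow p k d) :=
  monotone_of_hasDerivAt_nonneg (fun t => hasDerivAt_huberPow hp t) fun t =>
    Real.rpow_nonneg (ramp_nonneg t) p

/-- A function which is `C¹` on `[ε, ∞)` with bounded derivative extends to the line. -/
theorem exists_hasDerivAt_extension {ε B : ℝ} {H h : ℝ → ℝ} (hH : ∀ t, ε ≤ t → HasDerivAt H (h t) t)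
    (hc : ContinuousOn h (Ici ε)) (hB : ∀ t, ε ≤ t → |h t| ≤ B) :
    ∃ H₁ h₁ : ℝ → ℝ, (∀ t, HasDerivAt H₁ (h₁ t) t) ∧ Continuous h₁ ∧ (∀ t, |h₁ t| ≤ B) ∧
      ∀ t, ε ≤ t → H₁ t = H t ∧ h₁ t = h t := by
  have hcont : Continuous fun t => h (max ε t) :=
    hc.comp_continuous (by fun_prop) fun t => mem_Ici.2 (le_max_left _ _)
  -- The derivative is frozen at its value `h ε` to the left of `ε`.
  refine ⟨fun t => H ε + ∫ s in ε..t, h (max ε s), fun t => h (max ε t), fun t => ?_, hcont,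
    fun t => hB _ (le_max_left _ _), fun t ht => ⟨?_, by simp [ht]⟩⟩
  · exact (intervalIntegral.integral_hasDerivAt_right (hcont.intervalIntegrable _ _)
      (hcont.stronglyMeasurableAtFilter _ _) hcont.continuousAt).const_add _
  · simp only
    rw [intervalIntegral.integral_congr (g := h), intervalIntegral.integral_eq_sub_of_hasDerivAt]
    · ring
    · intro s hs
      rw [uIcc_of_le ht] at hs
      exact hH s hs.1
    · refine ContinuousOn.intervalIntegrable (hc.mono ?_)
      rw [uIcc_of_le ht]
      exact fun s hs => hs.1
    · intro s hs
      rw [uIcc_of_le ht] at hs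
      simp [hs.1]

end Huber

/-! ### Caccioppoli inequalities and De Giorgi classes for `u` and `-log u`. -/

section DeGiorgiClass
open Filter Topology
open scoped ENNReal

variable {N : ℕ} {p C₀ C₁ : ℝ} {U : Set (Euc N)} {u : Euc N → ℝ} {G a : Euc N → Euc N}
  {η : Euc N → ℝ}

theorem IsFlux.memLp_mul_norm (h : IsFlux p C₀ C₁ U u G a) {K : Set (Euc N)}
    (hK : IsCompact K) (hKU : K ⊆ U) {g : Euc N → ℝ}
    (hg : AEStronglyMeasurable g (volume.restrict K)) {B : ℝ}
    (hB : ∀ᵐ x ∂(volume.restrict U), |g x| ≤ B) :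
    MemLp (fun x => g x * ‖G x‖) (ENNReal.ofReal p) (volume.restrict K) := by
  have hG := h.grad.memLpLoc_grad K hKU hK
  refine hG.of_le_mul (c := B) (hg.mul hG.1.norm) ?_
  filter_upwards [ae_restrict_of_ae_restrict_of_subset hKU hB] with x hx
  rw [norm_mul, norm_norm]
  gcongr
  exact hx

/-- Take `H' = ramp ^ p`, so that `η ^ p * H'(u) * |G| ^ p` is the `p`-th power of `η` times the
gradient of `huber k d (u)`. By `huberPow_le` the error term has the form `X ^ (p - 1) * Y` required
by `IsFlux.eLpNorm_le`. -/
theorem IsFlux.caccioppoli (hp : 1 < p) (hC₀ : 0 < C₀) (hC₁ : 0 < C₁) (hU : IsOpen U)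
    (h : IsFlux p C₀ C₁ U u G a)
    (hη : ContDiff ℝ 1 η) (hηc : HasCompactSupport η) (hηU : tsupport η ⊆ U)
    (hη0 : ∀ x, 0 ≤ η x) {k d : ℝ} (hd : 0 < d) :
    eLpNorm (fun x => η x * ramp k d (u x) * ‖G x‖) (ENNReal.ofReal p)
        (volume.restrict (tsupport η)) ≤
      ENNReal.ofReal (p * C₁ / C₀) * eLpNorm (fun x => huber k d (u x) * ‖fderiv ℝ η x‖)
        (ENNReal.ofReal p) (volume.restrict (tsupport η)) := by
  have hp0 : 0 < p := by linarith
  obtain ⟨B, hB⟩ := hηc.exists_bound_of_continuous hη.continuous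
  have hchub : Continuous (huber k d) :=
    continuous_iff_continuousAt.2 fun t => (hasDerivAt_huber t).continuousAt
  have main := h.eLpNorm_le hp hC₀ hC₁ hU hη hηc hηU hη0 (H := huberPow p k d)
    (H' := fun t => ramp k d t ^ p)
    (fun t => hasDerivAt_huberPow hp0.le t) (continuous_ramp_rpow hp0.le) (B := 1)
    (fun t => by
      rw [abs_of_nonneg (Real.rpow_nonneg (ramp_nonneg t) p)]
      exact Real.rpow_le_one (ramp_nonneg t) (ramp_le_one t) hp0.le)
    (X := fun x => η x * ramp k d (u x) * ‖G x‖) (Y := fun x => huber k d (u x) * ‖fderiv ℝ η x‖)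
    (c := 1) one_pos
    (h.memLp_mul_norm hηc.isCompact hηU (hη.continuous.aestronglyMeasurable.mul
      (h.aestronglyMeasurable_comp hηc.isCompact hηU continuous_ramp.measurable)) (B := B * 1)
      (Eventually.of_forall fun x => by
        rw [abs_mul]
        gcongr
        · exact (norm_nonneg _).trans (hB x)
        · exact hB x
        · rw [abs_of_nonneg (ramp_nonneg _)]; exact ramp_le_one _))
    ((h.aestronglyMeasurable_comp hηc.isCompact hηU hchub.measurable).mul
      (hη.continuous_fderiv (by simp)).norm.aestronglyMeasurable)
    (Eventually.of_forall fun x =>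
      mul_nonneg (mul_nonneg (hη0 x) (ramp_nonneg _)) (norm_nonneg _))
    (Eventually.of_forall fun x => mul_nonneg (huber_nonneg hd _) (norm_nonneg _))
    (Eventually.of_forall fun x => by
      rw [one_mul, Real.mul_rpow (mul_nonneg (hη0 x) (ramp_nonneg _)) (norm_nonneg _),
        Real.mul_rpow (hη0 x) (ramp_nonneg _)])
    (Eventually.of_forall fun x => Real.rpow_nonneg (ramp_nonneg _) p)
    (Eventually.of_forall fun x => by
      rw [Real.mul_rpow (mul_nonneg (hη0 x) (ramp_nonneg _)) (norm_nonneg _),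
        Real.mul_rpow (hη0 x) (ramp_nonneg _), abs_of_nonneg (huberPow_nonneg hp0 hd _)]
      have h1 := huberPow_le hp.le hd (k := k) (u x)
      have h2 : 0 ≤ η x ^ (p - 1) := Real.rpow_nonneg (hη0 x) _
      calc η x ^ (p - 1) * huberPow p k d (u x) * ‖fderiv ℝ η x‖ * ‖G x‖ ^ (p - 1)
          ≤ η x ^ (p - 1) * (huber k d (u x) * ramp k d (u x) ^ (p - 1)) * ‖fderiv ℝ η x‖ *
            ‖G x‖ ^ (p - 1) := by gcongr
        _ = _ := by ring)
  rwa [mul_one] at main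

/-- The extra factor `u ^ (1 - p)` in the test function turns `|G|` into `|G| / u`, the size of the
gradient of `log u`. The bound `ε ≤ u` only makes the test function admissible; the constant does
not depend on `ε`. -/
theorem IsFlux.caccioppoli_log (hp : 1 < p) (hC₀ : 0 < C₀) (hC₁ : 0 < C₁) (hU : IsOpen U)
    (h : IsFlux p C₀ C₁ U u G a) {ε : ℝ} (hε0 : 0 < ε)
    (hε : ∀ᵐ x ∂(volume.restrict U), ε ≤ u x)
    (hη : ContDiff ℝ 1 η) (hηc : HasCompactSupport η) (hηU : tsupport η ⊆ U)
    (hη0 : ∀ x, 0 ≤ η x) {k d : ℝ} (hd : 0 < d) :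
    eLpNorm (fun x => η x * ramp k d (-Real.log (u x)) * (u x)⁻¹ * ‖G x‖) (ENNReal.ofReal p)
        (volume.restrict (tsupport η)) ≤
      ENNReal.ofReal (p * C₁ / C₀) * eLpNorm (fun x => huber k d (-Real.log (u x)) * ‖fderiv ℝ η x‖)
        (ENNReal.ofReal p) (volume.restrict (tsupport η)) := by
  have hp0 : 0 < p := by linarith
  obtain ⟨B, hB⟩ := hηc.exists_bound_of_continuous hη.continuous
  have hchub : Continuous (huber k d) :=
    continuous_iff_continuousAt.2 fun t => (hasDerivAt_huber t).continuousAt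
  have hchubP : Continuous (huberPow p k d) :=
    continuous_iff_continuousAt.2 fun t => (hasDerivAt_huberPow hp0.le t).continuousAt
  have hlogc : ContinuousOn (fun s => -Real.log s) (Ici ε) :=
    (Real.continuousOn_log.mono fun s hs => (hε0.trans_le hs).ne').neg
  obtain ⟨H₁, h₁, hd₁, hc₁, hb₁, he₁⟩ := exists_hasDerivAt_extension (ε := ε)
    (B := ε ^ (-p) * ((p - 1) * huberPow p k d (-Real.log ε) + 1))
    (H := fun s => -(s ^ (1 - p) * huberPow p k d (-Real.log s)))
    (h := fun s => s ^ (-p) * ((p - 1) * huberPow p k d (-Real.log s) + ramp k d (-Real.log s) ^ p))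
    (fun s hs => by
      have hs0 : 0 < s := hε0.trans_le hs
      have e1 := Real.hasDerivAt_rpow_const (x := s) (p := 1 - p) (Or.inl hs0.ne')
      have e2 := (hasDerivAt_huberPow (k := k) (d := d) hp0.le (-Real.log s)).comp s
        (Real.hasDerivAt_log hs0.ne').neg
      refine ((e1.mul e2).neg).congr_deriv ?_
      have e3 : s ^ (1 - p) = s ^ (-p) * s := by
        rw [← Real.rpow_add_one hs0.ne']; congr 1; ring
      rw [show 1 - p - 1 = -p by ring, e3]
      simp only [Function.comp_apply, Pi.neg_apply]
      field_simp
      ring)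
    (by
      refine ContinuousOn.mul (continuousOn_id.rpow_const fun s hs => Or.inl ?_) ?_
      · exact (hε0.trans_le hs).ne'
      · exact (continuousOn_const.mul (hchubP.comp_continuousOn hlogc)).add
          ((continuous_ramp_rpow hp0.le).comp_continuousOn hlogc))
    (fun s hs => by
      have hs0 : 0 < s := hε0.trans_le hs
      have i1 := huberPow_nonneg hp0 hd (k := k) (-Real.log s)
      have i2 := ramp_nonneg (k := k) (d := d) (-Real.log s)
      have i3 : 0 ≤ p - 1 := by linarith
      rw [abs_of_nonneg (by positivity)]
      gcongr ?_ * (_ * ?_ + ?_)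
      · exact Real.rpow_le_rpow_of_nonpos hε0 hs (by linarith)
      · exact huberPow_mono hp0.le (by simpa using Real.log_le_log hε0 hs)
      · exact Real.rpow_le_one i2 (ramp_le_one _) hp0.le)
  have main := h.eLpNorm_le hp hC₀ hC₁ hU hη hηc hηU hη0 hd₁ hc₁ hb₁
    (X := fun x => η x * ramp k d (-Real.log (u x)) * (u x)⁻¹ * ‖G x‖)
    (Y := fun x => huber k d (-Real.log (u x)) * ‖fderiv ℝ η x‖)
    (c := 1) one_pos
    (h.memLp_mul_norm hηc.isCompact hηU ((hη.continuous.aestronglyMeasurable.mul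
      (h.aestronglyMeasurable_comp hηc.isCompact hηU
        (continuous_ramp.measurable.comp Real.measurable_log.neg))).mul
      (h.aestronglyMeasurable_comp hηc.isCompact hηU measurable_inv)) (B := B * 1 * ε⁻¹)
      (by
        filter_upwards [hε] with x hx
        have hu0 : 0 < u x := hε0.trans_le hx
        have hB0 := (norm_nonneg _).trans (hB x)
        rw [abs_mul, abs_mul, abs_of_pos (inv_pos.2 hu0), abs_of_nonneg (ramp_nonneg _)]
        gcongr
        · exact ramp_nonneg _
        · exact hB x
        · exact ramp_le_one _))
    ((h.aestronglyMeasurable_comp hηc.isCompact hηU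
        (hchub.measurable.comp Real.measurable_log.neg)).mul
      (hη.continuous_fderiv (by simp)).norm.aestronglyMeasurable)
    (by
      filter_upwards [hε] with x hx
      have hu0 : 0 < u x := hε0.trans_le hx
      exact mul_nonneg (mul_nonneg (mul_nonneg (hη0 x) (ramp_nonneg _)) (inv_pos.2 hu0).le)
        (norm_nonneg _))
    (Eventually.of_forall fun x => mul_nonneg (huber_nonneg hd _) (norm_nonneg _))
    (by
      filter_upwards [hε] with x hx
      have hu0 : 0 < u x := hε0.trans_le hx
      have i0 := hη0 x
      have i1 := huberPow_nonneg hp0 hd (k := k) (-Real.log (u x))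
      have i2 := ramp_nonneg (k := k) (d := d) (-Real.log (u x))
      have i3 : 0 ≤ p - 1 := by linarith
      rw [(he₁ _ hx).2, Real.mul_rpow (by positivity) (norm_nonneg _),
        Real.mul_rpow (by positivity) (by positivity), Real.mul_rpow i0 i2,
        Real.inv_rpow hu0.le, ← Real.rpow_neg hu0.le, one_mul]
      refine mul_le_mul_of_nonneg_right ?_ (by positivity)
      -- Differentiating the power of `u` produces the term with `(p - 1) * huberPow`, which has the
      -- good sign and is dropped.
      calc η x ^ p * ramp k d (-Real.log (u x)) ^ p * u x ^ (-p)
          = η x ^ p * (u x ^ (-p) * (0 + ramp k d (-Real.log (u x)) ^ p)) := by ring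
        _ ≤ η x ^ p * (u x ^ (-p) * ((p - 1) * huberPow p k d (-Real.log (u x)) +
              ramp k d (-Real.log (u x)) ^ p)) := by gcongr; positivity)
    (by
      filter_upwards [hε] with x hx
      have hu0 : 0 < u x := hε0.trans_le hx
      have i1 := huberPow_nonneg hp0 hd (k := k) (-Real.log (u x))
      have i2 := ramp_nonneg (k := k) (d := d) (-Real.log (u x))
      have i3 : 0 ≤ p - 1 := by linarith
      rw [(he₁ _ hx).2]
      positivity)
    (by
      filter_upwards [hε] with x hx
      have hu0 : 0 < u x := hε0.trans_le hx
      have i0 := hη0 x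
      have i1 := huberPow_nonneg hp0 hd (k := k) (-Real.log (u x))
      have i2 := ramp_nonneg (k := k) (d := d) (-Real.log (u x))
      rw [(he₁ _ hx).1, Real.mul_rpow (by positivity) (norm_nonneg _),
        Real.mul_rpow (by positivity) (by positivity), Real.mul_rpow i0 i2,
        Real.inv_rpow hu0.le, ← Real.rpow_neg hu0.le, abs_neg, abs_of_nonneg (by positivity),
        neg_sub]
      have h1 := huberPow_le hp.le hd (k := k) (-Real.log (u x))
      calc η x ^ (p - 1) * (u x ^ (1 - p) * huberPow p k d (-Real.log (u x))) * ‖fderiv ℝ η x‖ *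
            ‖G x‖ ^ (p - 1)
          ≤ η x ^ (p - 1) * (u x ^ (1 - p) * (huber k d (-Real.log (u x)) *
            ramp k d (-Real.log (u x)) ^ (p - 1))) * ‖fderiv ℝ η x‖ * ‖G x‖ ^ (p - 1) := by gcongr
        _ = _ := by ring)
  rwa [mul_one] at main

/-- The logarithmic gradient estimate. -/
theorem IsFlux.log_estimate (hp : 1 < p) (hC₀ : 0 < C₀) (hC₁ : 0 < C₁) (hU : IsOpen U)
    (h : IsFlux p C₀ C₁ U u G a) {ε : ℝ} (hε0 : 0 < ε)
    (hε : ∀ᵐ x ∂(volume.restrict U), ε ≤ u x)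
    (hη : ContDiff ℝ 1 η) (hηc : HasCompactSupport η) (hηU : tsupport η ⊆ U)
    (hη0 : ∀ x, 0 ≤ η x) :
    eLpNorm (fun x => η x * (u x)⁻¹ * ‖G x‖) (ENNReal.ofReal p)
        (volume.restrict (tsupport η)) ≤
      ENNReal.ofReal (p * C₁ * (p - 1)⁻¹ / C₀) * eLpNorm (fun x => ‖fderiv ℝ η x‖)
        (ENNReal.ofReal p) (volume.restrict (tsupport η)) := by
  have hp0 : 0 < p := by linarith
  have hp1 : 0 < p - 1 := by linarith
  obtain ⟨B, hB⟩ := hηc.exists_bound_of_continuous hη.continuous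
  -- The test function is `-η ^ p * u ^ (1 - p)`: both `H` and `H'` are pure powers of `u` which
  -- combine with `|G|` into powers of `|G| / u`, so the right side no longer contains `u`.
  obtain ⟨H₁, h₁, hd₁, hc₁, hb₁, he₁⟩ := exists_hasDerivAt_extension (ε := ε)
    (B := (p - 1) * ε ^ (-p)) (H := fun s => -s ^ (1 - p)) (h := fun s => (p - 1) * s ^ (-p))
    (fun s hs => by
      have hs0 : 0 < s := hε0.trans_le hs
      refine (Real.hasDerivAt_rpow_const (x := s) (p := 1 - p) (Or.inl hs0.ne')).neg.congr_deriv ?_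
      rw [show 1 - p - 1 = -p by ring]
      ring)
    (continuousOn_const.mul
      (continuousOn_id.rpow_const fun s hs => Or.inl (hε0.trans_le hs).ne'))
    (fun s hs => by
      have hs0 : 0 < s := hε0.trans_le hs
      rw [abs_of_nonneg (by positivity)]
      gcongr ?_ * ?_
      exact Real.rpow_le_rpow_of_nonpos hε0 hs (by linarith))
  refine h.eLpNorm_le hp hC₀ hC₁ hU hη hηc hηU hη0 hd₁ hc₁ hb₁
    (X := fun x => η x * (u x)⁻¹ * ‖G x‖) (Y := fun x => ‖fderiv ℝ η x‖)
    (c := (p - 1)⁻¹) (inv_pos.2 hp1) ?_ ?_ ?_ ?_ ?_ ?_ ?_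
  · refine h.memLp_mul_norm hηc.isCompact hηU (hη.continuous.aestronglyMeasurable.mul
      (h.aestronglyMeasurable_comp hηc.isCompact hηU measurable_inv)) (B := B * ε⁻¹) ?_
    filter_upwards [hε] with x hx
    have hu0 : 0 < u x := hε0.trans_le hx
    have hB0 := (norm_nonneg _).trans (hB x)
    rw [abs_mul, abs_of_pos (inv_pos.2 hu0)]
    gcongr
    exact hB x
  · exact (hη.continuous_fderiv (by simp)).norm.aestronglyMeasurable
  · filter_upwards [hε] with x hx
    have hu0 : 0 < u x := hε0.trans_le hx
    exact mul_nonneg (mul_nonneg (hη0 x) (inv_pos.2 hu0).le) (norm_nonneg _)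
  · exact Eventually.of_forall fun x => norm_nonneg _
  · filter_upwards [hε] with x hx
    have hu0 : 0 < u x := hε0.trans_le hx
    have i0 := hη0 x
    rw [(he₁ _ hx).2, Real.mul_rpow (by positivity) (norm_nonneg _),
        Real.mul_rpow i0 (by positivity), Real.inv_rpow hu0.le, ← Real.rpow_neg hu0.le]
    refine le_of_eq ?_
    field_simp
  · filter_upwards [hε] with x hx
    have hu0 : 0 < u x := hε0.trans_le hx
    rw [(he₁ _ hx).2]
    positivity
  · filter_upwards [hε] with x hx
    have hu0 : 0 < u x := hε0.trans_le hx
    have i0 := hη0 x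
    rw [(he₁ _ hx).1, Real.mul_rpow (by positivity) (norm_nonneg _),
        Real.mul_rpow i0 (by positivity), Real.inv_rpow hu0.le, ← Real.rpow_neg hu0.le, abs_neg,
        abs_of_nonneg (by positivity), neg_sub]
    exact le_of_eq (by ring)

/-- A quantitative form of membership in a De Giorgi class. -/
def IsDeGiorgi (p q Λ : ℝ) (U : Set (Euc N)) (w : Euc N → ℝ) : Prop :=
  (∀ K ⊆ U, IsCompact K → AEStronglyMeasurable w (volume.restrict K)) ∧
  ∀ (k d : ℝ) (η : Euc N → ℝ), 0 < d → ContDiff ℝ 1 η → HasCompactSupport η → tsupport η ⊆ U →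
    (∀ x, 0 ≤ η x) →
    eLpNorm (fun x => η x * huber k d (w x)) (ENNReal.ofReal q) volume ≤
      ENNReal.ofReal Λ *
        eLpNorm (fun x => huber k d (w x) * ‖fderiv ℝ η x‖) (ENNReal.ofReal p) volume

/-- The gradient of `η * huber` has one part `Y` from the cutoff and one part `X` from the
truncation; the Caccioppoli inequality bounds `X` by `Y`, and Sobolev converts the sum into an `L^q`
bound free of gradients of the solution. -/
theorem eLpNorm_le_of_sobolev_of_caccioppoli (hp : 1 ≤ p) (hηc : HasCompactSupport η)
    {S c : ℝ} (hS : 0 ≤ S) (hc : 0 ≤ c) {q : ℝ≥0∞}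
    (hsob : ∀ (K : Set (Euc N)) (f : Euc N → ℝ) (F : Euc N → Euc N →L[ℝ] ℝ),
      IsCompact K → IsC1Limit p K f F →
      eLpNorm f q volume ≤ ENNReal.ofReal S * eLpNorm F (ENNReal.ofReal p) volume)
    {f : Euc N → ℝ} {F : Euc N → Euc N →L[ℝ] ℝ} (hf : IsC1Limit p (tsupport η) f F)
    {X Y : Euc N → ℝ} (hX : AEStronglyMeasurable X (volume.restrict (tsupport η)))
    (hY : AEStronglyMeasurable Y (volume.restrict (tsupport η)))
    (hF0 : ∀ x, x ∉ tsupport η → F x = 0) (hY0 : ∀ x, x ∉ tsupport η → Y x = 0)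
    (hF : ∀ᵐ x ∂(volume.restrict (tsupport η)), ‖F x‖ ≤ Y x + X x)
    (hXY : eLpNorm X (ENNReal.ofReal p) (volume.restrict (tsupport η)) ≤
      ENNReal.ofReal c * eLpNorm Y (ENNReal.ofReal p) (volume.restrict (tsupport η))) :
    eLpNorm f q volume ≤ ENNReal.ofReal (S * (1 + c)) * eLpNorm Y (ENNReal.ofReal p) volume := by
  have hp1 : 1 ≤ ENNReal.ofReal p := by simpa using hp
  refine (hsob _ _ _ hηc.isCompact hf).trans ?_
  rw [ENNReal.ofReal_mul hS, mul_assoc]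
  refine mul_le_mul_right ?_ _
  rw [← eLpNorm_restrict_eq_of_support_subset (s := tsupport η) (f := F)
    fun x hx => by_contra fun hx' => hx (hF0 x hx'),
    ← eLpNorm_restrict_eq_of_support_subset (s := tsupport η) (f := Y)
    fun x hx => by_contra fun hx' => hx (hY0 x hx')]
  calc eLpNorm F (ENNReal.ofReal p) (volume.restrict (tsupport η))
      ≤ eLpNorm (Y + X) (ENNReal.ofReal p) (volume.restrict (tsupport η)) := by
        refine eLpNorm_mono_ae ?_
        filter_upwards [hF] with x hx
        exact hx.trans (le_abs_self _)
    _ ≤ _ := eLpNorm_add_le hY hX hp1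
    _ ≤ _ := by
        rw [ENNReal.ofReal_add zero_le_one hc, add_mul, ENNReal.ofReal_one, one_mul]
        gcongr

theorem fderiv_eq_zero_of_notMem_tsupport {x : Euc N} (hx : x ∉ tsupport η) : fderiv ℝ η x = 0 :=
  image_eq_zero_of_notMem_tsupport fun hx' => hx (tsupport_fderiv_subset ℝ hx')

theorem IsFlux.isC1Limit_huber (hp : 1 < p) (hU : IsOpen U) (h : IsFlux p C₀ C₁ U u G a)
    (hη : ContDiff ℝ 1 η) (hηc : HasCompactSupport η) (hηU : tsupport η ⊆ U) (k d : ℝ) :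
    IsC1Limit p (tsupport η) (fun x => η x * huber k d (u x)) fun x =>
      huber k d (u x) • fderiv ℝ η x + (η x * ramp k d (u x)) • innerSL ℝ (G x) :=
  isC1Limit_mul_comp hp.le hU h.grad hη hηc hηU hasDerivAt_huber continuous_ramp (B := 1) fun t => by
    rw [abs_of_nonneg (ramp_nonneg t)]; exact ramp_le_one t

theorem IsC1Limit.congr_ae {K : Set (Euc N)} {f g : Euc N → ℝ} {F F' : Euc N → Euc N →L[ℝ] ℝ}
    (h : IsC1Limit p K f F) (hfg : f =ᵐ[volume] g) (hF : F =ᵐ[volume] F') : IsC1Limit p K g F' := by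
  obtain ⟨hm, φ, h1, hs, hae, hlim⟩ := h
  refine ⟨(memLp_congr_ae hF).1 hm, φ, h1, hs, ?_, hlim.congr fun n => eLpNorm_congr_ae ?_⟩
  · filter_upwards [hae, hfg] with x hx hx'
    rwa [← hx']
  · filter_upwards [hF] with x hx
    simp [hx]

theorem IsFlux.isC1Limit_huber_log (hp : 1 < p) (hU : IsOpen U) (h : IsFlux p C₀ C₁ U u G a)
    {ε : ℝ} (hε0 : 0 < ε) (hε : ∀ᵐ x ∂(volume.restrict U), ε ≤ u x)
    (hη : ContDiff ℝ 1 η) (hηc : HasCompactSupport η) (hηU : tsupport η ⊆ U) (k d : ℝ) :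
    IsC1Limit p (tsupport η) (fun x => η x * huber k d (-Real.log (u x))) fun x =>
      huber k d (-Real.log (u x)) • fderiv ℝ η x -
        (η x * ramp k d (-Real.log (u x)) * (u x)⁻¹) • innerSL ℝ (G x) := by
  have hlogc : ContinuousOn (fun s => -Real.log s) (Ici ε) :=
    (Real.continuousOn_log.mono fun s hs => (hε0.trans_le hs).ne').neg
  obtain ⟨H₁, h₁, hd₁, hc₁, hb₁, he₁⟩ := exists_hasDerivAt_extension (ε := ε) (B := 1 * ε⁻¹)
    (H := fun s => huber k d (-Real.log s)) (h := fun s => -(ramp k d (-Real.log s) * s⁻¹))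
    (fun s hs => by
      have hs0 : 0 < s := hε0.trans_le hs
      have e2 := (hasDerivAt_huber (k := k) (d := d) (-Real.log s)).comp s
        (Real.hasDerivAt_log hs0.ne').neg
      exact e2.congr_deriv (by ring))
    ((continuous_ramp.comp_continuousOn hlogc).mul
      (continuousOn_inv₀.mono fun s hs => (hε0.trans_le hs).ne')).neg
    (fun s hs => by
      have hs0 : 0 < s := hε0.trans_le hs
      rw [abs_neg, abs_mul, abs_of_nonneg (ramp_nonneg _), abs_of_pos (inv_pos.2 hs0)]
      gcongr
      exact ramp_le_one _)
  refine (isC1Limit_mul_comp hp.le hU h.grad hη hηc hηU hd₁ hc₁ hb₁).congr_ae ?_ ?_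
  · filter_upwards [(ae_restrict_iff' hU.measurableSet).1 hε] with x hx
    by_cases hxη : x ∈ tsupport η
    · rw [(he₁ _ (hx (hηU hxη))).1]
    · simp [image_eq_zero_of_notMem_tsupport hxη]
  · filter_upwards [(ae_restrict_iff' hU.measurableSet).1 hε] with x hx
    by_cases hxη : x ∈ tsupport η
    · rw [(he₁ _ (hx (hηU hxη))).1, (he₁ _ (hx (hηU hxη))).2, sub_eq_add_neg, ← neg_smul]
      congr 2
      ring
    · simp [image_eq_zero_of_notMem_tsupport hxη, fderiv_eq_zero_of_notMem_tsupport hxη]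

theorem exists_deGiorgi_const (N : ℕ) {p C₀ C₁ : ℝ} (hp : 1 < p) (hpN : p < N)
    (hC₀ : 0 < C₀) (hC₁ : 0 < C₁) :
    ∃ Λ : ℝ, 0 < Λ ∧ ∀ (U : Set (Euc N)) (u : Euc N → ℝ) (G a : Euc N → Euc N), IsOpen U →
      IsFlux p C₀ C₁ U u G a → IsDeGiorgi p (p⁻¹ - (N : ℝ)⁻¹)⁻¹ Λ U u ∧
      ∀ ε : ℝ, 0 < ε → (∀ᵐ x ∂(volume.restrict U), ε ≤ u x) →
        IsDeGiorgi p (p⁻¹ - (N : ℝ)⁻¹)⁻¹ Λ U fun x => -Real.log (u x) := by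
  obtain ⟨S, hS, hsob⟩ := exists_sobolev_const N hp.le hpN
  have hchub : ∀ k d, Continuous (huber k d) := fun k d =>
    continuous_iff_continuousAt.2 fun t => (hasDerivAt_huber t).continuousAt
  refine ⟨S * (1 + p * C₁ / C₀), by positivity, fun U u G a hU h => ⟨⟨fun K hKU hK =>
    (h.grad.memLpLoc K hKU hK).1, fun k d η hd hη hηc hηU hη0 => ?_⟩, fun ε hε0 hε =>
    ⟨fun K hKU hK => ?_, fun k d η hd hη hηc hηU hη0 => ?_⟩⟩⟩
  · refine eLpNorm_le_of_sobolev_of_caccioppoli hp.le hηc hS.le (by positivity) hsob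
      (h.isC1Limit_huber hp hU hη hηc hηU k d) ?_ ?_ (fun x hx => ?_) (fun x hx => ?_) ?_
      (h.caccioppoli hp hC₀ hC₁ hU hη hηc hηU hη0 hd)
    · exact (hη.continuous.aestronglyMeasurable.mul (h.aestronglyMeasurable_comp hηc.isCompact hηU
        continuous_ramp.measurable)).mul (h.grad.memLpLoc_grad _ hηU hηc.isCompact).1.norm
    · exact (h.aestronglyMeasurable_comp hηc.isCompact hηU (hchub k d).measurable).mul
        (hη.continuous_fderiv (by simp)).norm.aestronglyMeasurable
    · simp [image_eq_zero_of_notMem_tsupport hx, fderiv_eq_zero_of_notMem_tsupport hx]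
    · simp [fderiv_eq_zero_of_notMem_tsupport hx]
    · refine Eventually.of_forall fun x => (norm_add_le _ _).trans (le_of_eq ?_)
      rw [norm_smul, norm_smul, innerSL_apply_norm, Real.norm_of_nonneg (huber_nonneg hd _),
        Real.norm_of_nonneg (mul_nonneg (hη0 x) (ramp_nonneg _))]
  · exact h.aestronglyMeasurable_comp hK hKU Real.measurable_log.neg
  · refine eLpNorm_le_of_sobolev_of_caccioppoli hp.le hηc hS.le (by positivity) hsob
      (h.isC1Limit_huber_log hp hU hε0 hε hη hηc hηU k d) ?_ ?_ (fun x hx => ?_) (fun x hx => ?_) ?_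
      (h.caccioppoli_log hp hC₀ hC₁ hU hε0 hε hη hηc hηU hη0 hd)
    · exact ((hη.continuous.aestronglyMeasurable.mul (h.aestronglyMeasurable_comp hηc.isCompact hηU
        (continuous_ramp.measurable.comp Real.measurable_log.neg))).mul
        (h.aestronglyMeasurable_comp hηc.isCompact hηU measurable_inv)).mul
        (h.grad.memLpLoc_grad _ hηU hηc.isCompact).1.norm
    · exact (h.aestronglyMeasurable_comp hηc.isCompact hηU
        ((hchub k d).measurable.comp Real.measurable_log.neg)).mul
        (hη.continuous_fderiv (by simp)).norm.aestronglyMeasurable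
    · simp [image_eq_zero_of_notMem_tsupport hx, fderiv_eq_zero_of_notMem_tsupport hx]
    · simp [fderiv_eq_zero_of_notMem_tsupport hx]
    · filter_upwards [ae_restrict_of_ae_restrict_of_subset hηU hε] with x hx
      have hu0 : 0 < u x := hε0.trans_le hx
      refine (norm_sub_le _ _).trans (le_of_eq ?_)
      rw [norm_smul, norm_smul, innerSL_apply_norm, Real.norm_of_nonneg (huber_nonneg hd _),
        Real.norm_of_nonneg (mul_nonneg (mul_nonneg (hη0 x) (ramp_nonneg _)) (inv_pos.2 hu0).le)]

end DeGiorgiClass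

/-! ### Geometry of cubes and cutoff functions. -/

section Cubes
open Filter Topology
open scoped ENNReal

variable {N : ℕ}

theorem cube_mono {x₀ : Euc N} {r s : ℝ} (h : r ≤ s) : cube x₀ r ⊆ cube x₀ s :=
  fun _ hx i => (hx i).trans_le (by linarith)

theorem isOpen_cube (x₀ : Euc N) (r : ℝ) : IsOpen (cube x₀ r) := by
  have : cube x₀ r = ⋂ i, {x : Euc N | |x i - x₀ i| < r / 2} := by
    ext x; simp [cube]
  rw [this]
  refine isOpen_iInter_of_finite fun i => isOpen_lt ?_ continuous_const
  fun_prop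

theorem measurableSet_cube (x₀ : Euc N) (r : ℝ) : MeasurableSet (cube x₀ r) :=
  (isOpen_cube x₀ r).measurableSet

/-- The closed cube of side length `r` centred at `x₀`. -/
def closedCube (x₀ : Euc N) (r : ℝ) : Set (Euc N) := {x | ∀ i, |x i - x₀ i| ≤ r / 2}

theorem cube_subset_closedCube (x₀ : Euc N) (r : ℝ) : cube x₀ r ⊆ closedCube x₀ r :=
  fun _ hx i => (hx i).le

theorem closedCube_subset_cube {x₀ : Euc N} {r s : ℝ} (h : r < s) : closedCube x₀ r ⊆ cube x₀ s :=
  fun _ hx i => (hx i).trans_lt (by linarith)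

theorem isCompact_closedCube (x₀ : Euc N) (r : ℝ) : IsCompact (closedCube x₀ r) := by
  have h : IsCompact (Set.pi univ fun i : Fin N => Icc (x₀ i - r / 2) (x₀ i + r / 2)) :=
    isCompact_univ_pi fun i => isCompact_Icc
  have e : closedCube x₀ r = (EuclideanSpace.equiv (Fin N) ℝ).toHomeomorph ⁻¹'
      (Set.pi univ fun i : Fin N => Icc (x₀ i - r / 2) (x₀ i + r / 2)) := by
    ext x
    simp only [closedCube, mem_ofPred_eq, mem_preimage, mem_univ_pi, mem_Icc, abs_le]
    refine forall_congr' fun i => ?_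
    change _ ↔ x₀ i - r / 2 ≤ x i ∧ x i ≤ x₀ i + r / 2
    constructor <;> rintro ⟨h1, h2⟩ <;> constructor <;> linarith
  rw [e]
  exact (Homeomorph.isCompact_preimage _).2 h

theorem convex_cube (x₀ : Euc N) (r : ℝ) : Convex ℝ (cube x₀ r) := by
  intro x hx y hy a b ha hb hab i
  have e : (a • x + b • y) i - x₀ i = a * (x i - x₀ i) + b * (y i - x₀ i) := by
    simp only [PiLp.add_apply, PiLp.smul_apply, smul_eq_mul]
    linear_combination (x₀ i) * hab
  rw [e, abs_lt]
  have h1 := abs_lt.1 (hx i)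
  have h2 := abs_lt.1 (hy i)
  have h3 : r / 2 = a * (r / 2) + b * (r / 2) := by rw [← add_mul, hab, one_mul]
  rcases ha.eq_or_lt with rfl | ha
  · have : b = 1 := by linarith
    subst this
    constructor <;> linarith [h2.1, h2.2]
  · rw [h3]
    constructor
    · nlinarith [mul_lt_mul_of_pos_left h1.1 ha, mul_le_mul_of_nonneg_left h2.1.le hb]
    · nlinarith [mul_lt_mul_of_pos_left h1.2 ha, mul_le_mul_of_nonneg_left h2.2.le hb]

theorem volume_cube_lt_top (x₀ : Euc N) (r : ℝ) : volume (cube x₀ r) < ⊤ :=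
  (measure_mono (cube_subset_closedCube x₀ r)).trans_lt (isCompact_closedCube x₀ r).measure_lt_top

theorem abs_prod_sub_prod_le {ι : Type*} (s : Finset ι) {a b : ι → ℝ}
    (ha : ∀ i, 0 ≤ a i ∧ a i ≤ 1) (hb : ∀ i, 0 ≤ b i ∧ b i ≤ 1) :
    |∏ i ∈ s, a i - ∏ i ∈ s, b i| ≤ ∑ i ∈ s, |a i - b i| := by
  classical
  induction s using Finset.induction_on with
  | empty => simp
  | insert j s hj ih =>
    rw [Finset.prod_insert hj, Finset.prod_insert hj, Finset.sum_insert hj]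
    have e : a j * ∏ i ∈ s, a i - b j * ∏ i ∈ s, b i =
        (a j - b j) * ∏ i ∈ s, a i + b j * (∏ i ∈ s, a i - ∏ i ∈ s, b i) := by ring
    have h1 : |∏ i ∈ s, a i| ≤ 1 := by
      rw [abs_of_nonneg (Finset.prod_nonneg fun i _ => (ha i).1)]
      exact Finset.prod_le_one (fun i _ => (ha i).1) fun i _ => (ha i).2
    have h2 : |b j| ≤ 1 := by rw [abs_of_nonneg (hb j).1]; exact (hb j).2
    rw [e]
    refine (abs_add_le _ _).trans ?_
    rw [abs_mul, abs_mul]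
    have h3 := mul_le_mul_of_nonneg_left h1 (abs_nonneg (a j - b j))
    have h4 := mul_le_mul_of_nonneg_right h2 (abs_nonneg (∏ i ∈ s, a i - ∏ i ∈ s, b i))
    linarith

theorem exists_lipschitz_smoothTransition :
    ∃ L : ℝ, 0 < L ∧ ∀ s t, |Real.smoothTransition s - Real.smoothTransition t| ≤ L * |s - t| := by
  have hc : ContDiff ℝ 1 Real.smoothTransition := Real.smoothTransition.contDiff
  have hcont : Continuous (deriv Real.smoothTransition) := hc.continuous_deriv le_rfl
  obtain ⟨M, hM⟩ := isCompact_Icc (a := (0 : ℝ)) (b := 1) |>.exists_bound_of_continuousOn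
    hcont.continuousOn
  have hall : ∀ t, ‖deriv Real.smoothTransition t‖ ≤ max M 0 := fun t => by
    by_cases ht : t ∈ Icc (0 : ℝ) 1
    · exact (hM t ht).trans (le_max_left _ _)
    · refine le_trans (le_of_eq ?_) (le_max_right _ _)
      rw [norm_eq_zero]
      rw [mem_Icc, not_and_or, not_le, not_le] at ht
      rcases ht with ht | ht
      · have : Real.smoothTransition =ᶠ[𝓝 t] fun _ => 0 := by
          filter_upwards [Iio_mem_nhds ht] with s hs
          exact Real.smoothTransition.zero_of_nonpos (le_of_lt hs)
        rw [this.deriv_eq, deriv_const]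
      · have : Real.smoothTransition =ᶠ[𝓝 t] fun _ => 1 := by
          filter_upwards [Ioi_mem_nhds ht] with s hs
          exact Real.smoothTransition.one_of_one_le (le_of_lt hs)
        rw [this.deriv_eq, deriv_const]
  refine ⟨max M 0 + 1, by positivity, fun s t => ?_⟩
  have := Convex.norm_image_sub_le_of_norm_deriv_le (s := univ)
    (fun x _ => hc.differentiable (by simp) x) (fun x _ => hall x) convex_univ (mem_univ t)
    (mem_univ s)
  simp only [Real.norm_eq_abs] at this
  nlinarith [abs_nonneg (s - t)]

/-- Cutoff functions between concentric cubes. -/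
theorem exists_cutoff (N : ℕ) : ∃ L : ℝ, 0 < L ∧ ∀ s r : ℝ, s < r → ∃ η : Euc N → ℝ,
    IsTestFunction (cube 0 r) η ∧ (∀ x, 0 ≤ η x) ∧ (∀ x, η x ≤ 1) ∧ (∀ x ∈ cube 0 s, η x = 1) ∧
    ∀ x, ‖fderiv ℝ η x‖ ≤ L / (r - s) := by
  obtain ⟨L₀, hL₀, hlip⟩ := exists_lipschitz_smoothTransition
  refine ⟨N * (L₀ * 4 + L₀ * 4) + 1, by positivity, fun s r hsr => ?_⟩
  -- Here `b` is midway between the half-sides `s / 2` and `r / 2`, and `b - δ = s / 2`. Hence each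
  -- factor is `1` on the inner cube, and the support lies in a closed cube of side `2 * b < r`.
  set δ := (r - s) / 4 with hδ
  have hδ0 : 0 < δ := by rw [hδ]; linarith
  set b := (r + s) / 4 with hb
  set S := Real.smoothTransition with hS
  set η : Euc N → ℝ := fun x => ∏ i, (S ((b - x i) / δ) * S ((b + x i) / δ)) with hη
  have h01 : ∀ t, 0 ≤ S t ∧ S t ≤ 1 := fun t =>
    ⟨Real.smoothTransition.nonneg t, Real.smoothTransition.le_one t⟩
  have hf01 : ∀ (x : Euc N) i, 0 ≤ S ((b - x i) / δ) * S ((b + x i) / δ) ∧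
      S ((b - x i) / δ) * S ((b + x i) / δ) ≤ 1 := fun x i =>
    ⟨mul_nonneg (h01 _).1 (h01 _).1, mul_le_one₀ (h01 _).2 (h01 _).1 (h01 _).2⟩
  have hsupp : Function.support η ⊆ closedCube 0 (2 * b) := by
    intro x hx i
    simp only [Function.mem_support, hη] at hx
    have hi := Finset.prod_ne_zero_iff.1 hx i (Finset.mem_univ i)
    have h1 : 0 < (b - x i) / δ := by
      by_contra h
      exact hi (by rw [hS, Real.smoothTransition.zero_of_nonpos (not_lt.1 h), zero_mul])
    have h2 : 0 < (b + x i) / δ := by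
      by_contra h
      exact hi (by rw [hS, Real.smoothTransition.zero_of_nonpos (not_lt.1 h), mul_zero])
    rw [lt_div_iff₀ hδ0] at h1 h2
    rw [PiLp.zero_apply, sub_zero, abs_le]
    constructor <;> linarith
  have hts : tsupport η ⊆ closedCube 0 (2 * b) :=
    closure_minimal hsupp (isCompact_closedCube 0 _).isClosed
  have hsm : ContDiff ℝ ∞ η := by
    refine contDiff_prod fun i _ => ?_
    have hx : ContDiff ℝ ∞ fun x : Euc N => x i := by fun_prop
    exact (Real.smoothTransition.contDiff.comp ((contDiff_const.sub hx).div_const δ)).mul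
      (Real.smoothTransition.contDiff.comp ((contDiff_const.add hx).div_const δ))
  refine ⟨η, ⟨hsm, (isCompact_closedCube 0 _).of_isClosed_subset (isClosed_tsupport _) hts,
    hts.trans (closedCube_subset_cube (by rw [hb]; linarith))⟩,
    fun x => Finset.prod_nonneg fun i _ => (hf01 x i).1,
    fun x => Finset.prod_le_one (fun i _ => (hf01 x i).1) fun i _ => (hf01 x i).2,
    fun x hx => Finset.prod_eq_one fun i _ => ?_, fun x => ?_⟩
  · have := abs_lt.1 (hx i)
    simp only [PiLp.zero_apply, sub_zero] at this
    rw [hS, Real.smoothTransition.one_of_one_le, Real.smoothTransition.one_of_one_le, one_mul]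
    · rw [le_div_iff₀ hδ0, hb, hδ]; linarith
    · rw [le_div_iff₀ hδ0, hb, hδ]; linarith
  · have hη_lip : ∀ x y, |η x - η y| ≤ (N * (L₀ * 4 + L₀ * 4) / (r - s)) * ‖x - y‖ := fun x y => by
      refine (abs_prod_sub_prod_le Finset.univ (hf01 x) (hf01 y)).trans ?_
      have hi : ∀ i ∈ Finset.univ, |S ((b - x i) / δ) * S ((b + x i) / δ) -
          S ((b - y i) / δ) * S ((b + y i) / δ)| ≤ (L₀ * 4 + L₀ * 4) / (r - s) * ‖x - y‖ := by
        intro i _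
        have hxy : |x i - y i| ≤ ‖x - y‖ := by
          simpa using PiLp.norm_apply_le (x - y) i
        have a1 : |S ((b - x i) / δ) - S ((b - y i) / δ)| ≤ L₀ * 4 / (r - s) * ‖x - y‖ := by
          refine (hlip _ _).trans ?_
          rw [← sub_div, abs_div, abs_of_pos hδ0, show b - x i - (b - y i) = -(x i - y i) by ring,
            abs_neg]
          calc L₀ * (|x i - y i| / δ) ≤ L₀ * (‖x - y‖ / δ) := by gcongr
            _ = _ := by rw [hδ]; field_simp
        have a2 : |S ((b + x i) / δ) - S ((b + y i) / δ)| ≤ L₀ * 4 / (r - s) * ‖x - y‖ := by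
          refine (hlip _ _).trans ?_
          rw [← sub_div, abs_div, abs_of_pos hδ0, show b + x i - (b + y i) = x i - y i by ring]
          calc L₀ * (|x i - y i| / δ) ≤ L₀ * (‖x - y‖ / δ) := by gcongr
            _ = _ := by rw [hδ]; field_simp
        -- The product of the two factors belonging to one coordinate is treated by the same
        -- telescoping bound, indexed by `Bool`.
        have a3 := abs_prod_sub_prod_le (Finset.univ : Finset Bool)
          (a := fun c => cond c (S ((b - x i) / δ)) (S ((b + x i) / δ)))
          (b := fun c => cond c (S ((b - y i) / δ)) (S ((b + y i) / δ)))
          (fun c => by cases c <;> exact h01 _) (fun c => by cases c <;> exact h01 _)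
        simp only [Fintype.univ_bool, Finset.mem_singleton, Bool.true_eq_false, not_false_eq_true,
          Finset.prod_insert, Finset.prod_singleton, Finset.sum_insert, Finset.sum_singleton,
          cond_true, cond_false] at a3
        refine a3.trans ((add_le_add a1 a2).trans (le_of_eq (by ring)))
      refine (Finset.sum_le_sum hi).trans (le_of_eq ?_)
      rw [Finset.sum_const, Finset.card_univ, Fintype.card_fin, nsmul_eq_mul]
      ring
    have hrs : 0 < r - s := by linarith
    refine (norm_fderiv_le_of_lip' ℝ (C := N * (L₀ * 4 + L₀ * 4) / (r - s)) (by positivity)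
      (Eventually.of_forall fun y => ?_)).trans ?_
    · exact hη_lip y x
    · gcongr; linarith

end Cubes

/-! ### De Giorgi iteration. -/

section DeGiorgiIteration
open Filter Topology
open scoped ENNReal

variable {N : ℕ} {p q Λ : ℝ} {w : Euc N → ℝ}

theorem IsDeGiorgi.eLpNorm_le {U : Set (Euc N)} (h : IsDeGiorgi p q Λ U w) {L : ℝ}
    (hL : ∀ s r : ℝ, s < r → ∃ η : Euc N → ℝ,
      IsTestFunction (cube 0 r) η ∧ (∀ x, 0 ≤ η x) ∧ (∀ x, η x ≤ 1) ∧ (∀ x ∈ cube 0 s, η x = 1) ∧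
      ∀ x, ‖fderiv ℝ η x‖ ≤ L / (r - s)) {s r : ℝ} (hsr : s < r) (hr : cube 0 r ⊆ U)
    (k : ℝ) {d : ℝ} (hd : 0 < d) :
    eLpNorm (fun x => max (w x - (k + d)) 0) (ENNReal.ofReal q) (volume.restrict (cube 0 s)) ≤
      ENNReal.ofReal Λ * (ENNReal.ofReal (L / (r - s)) *
        eLpNorm (fun x => max (w x - k) 0) (ENNReal.ofReal p) (volume.restrict (cube 0 r))) := by
  obtain ⟨η, hη, hη0, -, hη1, hηL⟩ := hL s r hsr
  have hmain := h.2 k d η hd (hη.contDiff.of_le (by simp)) hη.hasCompactSupport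
    (hη.tsupport_subset.trans hr) hη0
  calc _ ≤ eLpNorm (fun x => η x * huber k d (w x)) (ENNReal.ofReal q)
        (volume.restrict (cube 0 s)) := by
        refine eLpNorm_mono_ae ((ae_restrict_iff' (measurableSet_cube 0 s)).2
          (Eventually.of_forall fun x hx => ?_))
        rw [hη1 x hx, one_mul, Real.norm_of_nonneg (le_max_right _ _),
          Real.norm_of_nonneg (huber_nonneg hd _)]
        exact le_huber hd _
    _ ≤ eLpNorm (fun x => η x * huber k d (w x)) (ENNReal.ofReal q) volume :=
        eLpNorm_mono_measure _ Measure.restrict_le_self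
    _ ≤ _ := hmain
    _ ≤ _ := by
        refine mul_le_mul_right ?_ _
        rw [← eLpNorm_restrict_eq_of_support_subset (s := cube 0 r)]
        · refine eLpNorm_le_mul_eLpNorm_of_ae_le_mul (Eventually.of_forall fun x => ?_) _
          rw [norm_mul, norm_norm, mul_comm, Real.norm_of_nonneg (le_max_right _ _),
            Real.norm_of_nonneg (huber_nonneg hd _)]
          exact mul_le_mul (hηL x) (huber_le hd _) (huber_nonneg hd _)
            ((norm_nonneg _).trans (hηL x))
        · intro x hx
          by_contra hxr
          refine hx ?_
          simp only
          rw [fderiv_eq_zero_of_notMem_tsupport fun hx' => hxr (hη.tsupport_subset hx'),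
            norm_zero, mul_zero]

/-- Hölder on the set where `w > k + d`, whose measure Chebyshev's inequality bounds through `(w -
k)₊`. The positive power of the latter norm makes the iteration superlinear. -/
theorem eLpNorm_max_le_of_lt {μ : Measure (Euc N)} (hp : 0 < p) (hpq : p ≤ q)
    (hw : AEStronglyMeasurable w μ) (k : ℝ) {d : ℝ} (hd : 0 < d) :
    eLpNorm (fun x => max (w x - (k + d)) 0) (ENNReal.ofReal p) μ ≤
      eLpNorm (fun x => max (w x - (k + d)) 0) (ENNReal.ofReal q) μ *
        (ENNReal.ofReal d⁻¹ * eLpNorm (fun x => max (w x - k) 0) (ENNReal.ofReal p) μ) ^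
          (p * (1 / p - 1 / q)) := by
  set f : Euc N → ℝ := fun x => max (w x - (k + d)) 0 with hf
  set g : Euc N → ℝ := fun x => max (w x - k) 0 with hg
  have hgm : AEStronglyMeasurable g μ :=
    (hw.sub aestronglyMeasurable_const).sup aestronglyMeasurable_const
  have hfm : AEStronglyMeasurable f μ :=
    (hw.sub aestronglyMeasurable_const).sup aestronglyMeasurable_const
  set A : Set (Euc N) := {x | ENNReal.ofReal d ≤ ‖g x‖ₑ} with hA
  have hsub : Function.support f ⊆ A := fun x hx => by
    have h1 : 0 < w x - (k + d) := by
      by_contra hcon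
      exact hx (max_eq_right (not_lt.1 hcon))
    change ENNReal.ofReal d ≤ ‖g x‖ₑ
    rw [Real.enorm_eq_ofReal (le_max_right _ _)]
    exact ENNReal.ofReal_le_ofReal (le_trans (by linarith) (le_max_left _ _))
  have hp0 : ENNReal.ofReal p ≠ 0 := by simpa using hp
  have hμA : μ A ≤ (ENNReal.ofReal d⁻¹ * eLpNorm g (ENNReal.ofReal p) μ) ^ p := by
    have := meas_ge_le_mul_pow_eLpNorm_enorm (μ := μ) hp0 ENNReal.ofReal_ne_top hgm
      (ε := ENNReal.ofReal d) (by simpa using hd) (by simp)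
    rw [ENNReal.toReal_ofReal hp.le] at this
    rwa [ENNReal.mul_rpow_of_nonneg _ _ hp.le, ENNReal.ofReal_inv_of_pos hd]
  have hexp : 0 ≤ 1 / p - 1 / q := sub_nonneg.2 (one_div_le_one_div_of_le hp hpq)
  calc eLpNorm f (ENNReal.ofReal p) μ
      = eLpNorm f (ENNReal.ofReal p) (μ.restrict A) :=
        (eLpNorm_restrict_eq_of_support_subset hsub).symm
    _ ≤ eLpNorm f (ENNReal.ofReal q) (μ.restrict A) * μ A ^ (1 / p - 1 / q) := by
        have := eLpNorm_le_eLpNorm_mul_rpow_measure_univ (μ := μ.restrict A)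
          (ENNReal.ofReal_le_ofReal hpq) hfm.restrict
        rwa [ENNReal.toReal_ofReal hp.le, ENNReal.toReal_ofReal (hp.le.trans hpq),
          Measure.restrict_apply_univ] at this
    _ ≤ eLpNorm f (ENNReal.ofReal q) μ *
        ((ENNReal.ofReal d⁻¹ * eLpNorm g (ENNReal.ofReal p) μ) ^ p) ^ (1 / p - 1 / q) := by
        gcongr
        exact Measure.restrict_le_self
    _ = _ := by rw [← ENNReal.rpow_mul]

/-- Fast geometric convergence. -/
theorem exists_geometric_threshold {M δ : ℝ} (hM : 0 < M) (hδ : 0 < δ) :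
    ∃ ν t : ℝ, 0 < ν ∧ 0 < t ∧ t < 1 ∧ ∀ (κ : ℝ) (y : ℕ → ℝ≥0∞), 0 < κ →
      y 0 ≤ ENNReal.ofReal (ν * κ) →
      (∀ n, y (n + 1) ≤ ENNReal.ofReal (M * 2 ^ n) * y n *
        (ENNReal.ofReal (κ / 2 ^ (n + 1))⁻¹ * y n) ^ δ) →
      ∀ n, y n ≤ ENNReal.ofReal (ν * κ * t ^ n) := by
  -- Inserting `y n = ν κ t ^ n` in the recursion, `t` is chosen so that `2 ^ n * (t ^ n * 2 ^ n) ^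
  -- δ = 1`, cancelling the growth of the coefficients. Then `ν` is fixed by `M * (2 * ν) ^ δ = t`,
  -- which supplies the remaining factor `t`.
  set t : ℝ := (2 : ℝ) ^ (-((1 + δ) / δ)) with ht
  have ht0 : 0 < t := by positivity
  have ht1 : t < 1 := by
    refine Real.rpow_lt_one_of_one_lt_of_neg (by norm_num) ?_
    have : 0 < (1 + δ) / δ := by positivity
    linarith
  set ν : ℝ := (t / M) ^ (1 / δ) / 2 with hν
  have hν0 : 0 < ν := by positivity
  have hνM : M * (2 * ν) ^ δ = t := by
    rw [hν, mul_div_cancel₀ _ (two_ne_zero), ← Real.rpow_mul (by positivity), one_div,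
      inv_mul_cancel₀ hδ.ne', Real.rpow_one]
    field_simp
  refine ⟨ν, t, hν0, ht0, ht1, fun κ y hκ h0 hstep n => ?_⟩
  induction n with
  | zero => simpa using h0
  | succ n ih =>
    refine (hstep n).trans ?_
    have htn : (2 : ℝ) ^ n * (t ^ n * 2 ^ n) ^ δ = 1 := by
      have e1 : t ^ n * 2 ^ n = ((2 : ℝ) ^ n) ^ (-(1 / δ)) := by
        rw [← mul_pow, ht, ← Real.rpow_add_one (by norm_num), ← Real.rpow_natCast ((2 : ℝ) ^ _),
          ← Real.rpow_natCast (2 : ℝ), ← Real.rpow_mul (by norm_num), ← Real.rpow_mul (by norm_num)]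
        congr 1
        field_simp
        ring
      rw [e1, ← Real.rpow_mul (by positivity), neg_mul, one_div, inv_mul_cancel₀ hδ.ne',
        Real.rpow_neg_one, mul_inv_cancel₀ (by positivity)]
    calc ENNReal.ofReal (M * 2 ^ n) * y n * (ENNReal.ofReal (κ / 2 ^ (n + 1))⁻¹ * y n) ^ δ
        ≤ ENNReal.ofReal (M * 2 ^ n) * ENNReal.ofReal (ν * κ * t ^ n) *
          (ENNReal.ofReal (κ / 2 ^ (n + 1))⁻¹ * ENNReal.ofReal (ν * κ * t ^ n)) ^ δ := by gcongr
      _ = ENNReal.ofReal (M * 2 ^ n * (ν * κ * t ^ n) *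
          ((κ / 2 ^ (n + 1))⁻¹ * (ν * κ * t ^ n)) ^ δ) := by
          rw [← ENNReal.ofReal_mul (by positivity), ← ENNReal.ofReal_mul (by positivity),
            ENNReal.ofReal_rpow_of_nonneg (by positivity) hδ.le,
            ← ENNReal.ofReal_mul (by positivity)]
      _ = ENNReal.ofReal (ν * κ * t ^ (n + 1)) := by
          congr 1
          have e2 : (κ / 2 ^ (n + 1))⁻¹ * (ν * κ * t ^ n) = (2 * ν) * (t ^ n * 2 ^ n) := by
            rw [pow_succ]; field_simp
          rw [e2, Real.mul_rpow (by positivity) (by positivity)]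
          calc M * 2 ^ n * (ν * κ * t ^ n) * ((2 * ν) ^ δ * (t ^ n * 2 ^ n) ^ δ)
              = (M * (2 * ν) ^ δ) * (2 ^ n * (t ^ n * 2 ^ n) ^ δ) * (ν * κ * t ^ n) := by ring
            _ = _ := by rw [hνM, htn]; ring

/-- The critical mass lemma. -/
theorem exists_critical_mass (N : ℕ) {p q Λ : ℝ} (hp : 0 < p) (hpq : p < q) (hΛ : 0 < Λ) :
    ∃ ν : ℝ, 0 < ν ∧ ∀ w : Euc N → ℝ, IsDeGiorgi p q Λ (cube 0 2) w → ∀ k κ : ℝ, 0 < κ →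
      eLpNorm (fun x => max (w x - k) 0) (ENNReal.ofReal p) (volume.restrict (cube 0 (4 / 3))) ≤
        ENNReal.ofReal (ν * κ) → ∀ᵐ x ∂(volume.restrict (cube 0 1)), w x ≤ k + κ := by
  obtain ⟨L, hL0, hL⟩ := exists_cutoff N
  have hexp : 0 < 1 / p - 1 / q := sub_pos.2 (one_div_lt_one_div_of_lt hp hpq)
  obtain ⟨ν, t, hν, ht0, ht1, hgeo⟩ := exists_geometric_threshold (M := Λ * (6 * L))
    (δ := p * (1 / p - 1 / q)) (by positivity) (by positivity)
  refine ⟨ν, hν, fun w hw k κ hκ h0 => ?_⟩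
  -- The sides shrink from `4 / 3` to `1` while the levels rise from `k` to `k + κ`. The cutoff
  -- slope at step `n` is at most `6 * L * 2 ^ n` and the level increment is `κ / 2 ^ (n + 1)`,
  -- matching `exists_geometric_threshold`.
  set r : ℕ → ℝ := fun n => 1 + 1 / 3 / 2 ^ n with hr
  set l : ℕ → ℝ := fun n => k + κ * (1 - 1 / 2 ^ n) with hl
  set y : ℕ → ℝ≥0∞ := fun n => eLpNorm (fun x => max (w x - l n) 0) (ENNReal.ofReal p)
    (volume.restrict (cube 0 (r n))) with hy
  have hrle : ∀ n, r n ≤ 4 / 3 := fun n => by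
    have : (1 : ℝ) / 3 / 2 ^ n ≤ 1 / 3 := div_le_self (by norm_num) (one_le_pow₀ (by norm_num))
    rw [hr]; linarith
  have hrsub : ∀ n, r n - r (n + 1) = 1 / 6 / 2 ^ n := fun n => by
    simp only [hr, pow_succ]; field_simp; ring
  have hrlt : ∀ n, r (n + 1) < r n := fun n => by
    have h1 := hrsub n
    have h2 : (0 : ℝ) < 1 / 6 / 2 ^ n := by positivity
    linarith
  have hlsucc : ∀ n, l (n + 1) = l n + κ / 2 ^ (n + 1) := fun n => by
    simp only [hl, pow_succ]; field_simp; ring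
  have hwm : AEStronglyMeasurable w (volume.restrict (cube 0 (4 / 3))) :=
    (hw.1 _ (closedCube_subset_cube (by norm_num)) (isCompact_closedCube 0 (4 / 3))).mono_measure
      (Measure.restrict_mono (cube_subset_closedCube _ _) le_rfl)
  have hstep : ∀ n, y (n + 1) ≤ ENNReal.ofReal (Λ * (6 * L) * 2 ^ n) * y n *
        (ENNReal.ofReal (κ / 2 ^ (n + 1))⁻¹ * y n) ^ (p * (1 / p - 1 / q)) := fun n => by
    have hd : 0 < κ / 2 ^ (n + 1) := by positivity
    have s1 := eLpNorm_max_le_of_lt (μ := volume.restrict (cube 0 (r (n + 1)))) hp hpq.le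
      (hwm.mono_measure (Measure.restrict_mono (cube_mono (hrle _)) le_rfl)) (l n) hd
    have s2 := hw.eLpNorm_le hL (hrlt n) (cube_mono ((hrle n).trans (by norm_num))) (l n) hd
    simp only [hy]
    rw [hlsucc]
    refine s1.trans ?_
    gcongr ?_ * (_ * ?_) ^ _
    · refine s2.trans (le_of_eq ?_)
      rw [← mul_assoc, ← ENNReal.ofReal_mul hΛ.le, hrsub]
      congr 2
      field_simp
    · exact eLpNorm_mono_measure _ (Measure.restrict_mono (cube_mono (hrlt n).le) le_rfl)
  have hy0 : y 0 ≤ ENNReal.ofReal (ν * κ) := by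
    have e1 : l 0 = k := by simp [hl]
    have e2 : r 0 = 4 / 3 := by simp only [hr]; norm_num
    simp only [hy, e1, e2]
    exact h0
  have hbound := hgeo κ y hκ hy0 hstep
  have hz : eLpNorm (fun x => max (w x - (k + κ)) 0) (ENNReal.ofReal p)
      (volume.restrict (cube 0 1)) = 0 := by
    refine le_antisymm (ge_of_tendsto' (x := atTop)
      (f := fun n : ℕ => ENNReal.ofReal (ν * κ * t ^ n)) ?_ fun n => ?_) zero_le
    · have := (tendsto_pow_atTop_nhds_zero_of_lt_one ht0.le ht1).const_mul (ν * κ)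
      simpa using ENNReal.tendsto_ofReal this
    · refine le_trans ?_ (hbound n)
      refine (eLpNorm_mono_measure _ (Measure.restrict_mono (cube_mono (s := r n) ?_) le_rfl)).trans
        (eLpNorm_mono fun x => ?_)
      · have : (0 : ℝ) < 1 / 3 / 2 ^ n := by positivity
        rw [hr]; linarith
      · rw [Real.norm_of_nonneg (le_max_right _ _), Real.norm_of_nonneg (le_max_right _ _)]
        have : 0 < κ * (1 / 2 ^ n) := by positivity
        refine max_le_max ?_ le_rfl
        rw [hl]
        linarith
  have hm : AEStronglyMeasurable (fun x => max (w x - (k + κ)) 0) (volume.restrict (cube 0 1)) :=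
    ((hwm.mono_measure (Measure.restrict_mono (cube_mono (by norm_num)) le_rfl)).sub
      aestronglyMeasurable_const).sup aestronglyMeasurable_const
  rw [eLpNorm_eq_zero_iff hm (by simpa using hp)] at hz
  filter_upwards [hz] with x hx
  have := (le_max_left (w x - (k + κ)) 0).trans hx.le
  rw [Pi.zero_apply] at this
  linarith

end DeGiorgiIteration

/-! ### The sup estimate and expansion of positivity at unit scale. -/

section Positivity
open Filter Topology
open scoped ENNReal

variable {N : ℕ} {p C₀ C₁ : ℝ} {U : Set (Euc N)} {u : Euc N → ℝ} {G a : Euc N → Euc N}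

theorem HasWeakGradient.add_const (hp : 1 ≤ p) (h : HasWeakGradient p U u G)
    (c : ℝ) : HasWeakGradient p U (fun x => u x + c) G := by
  refine ⟨fun L hL hLc => ?_, h.memLpLoc_grad, fun φ hφ v => ?_⟩
  · have : IsFiniteMeasure (volume.restrict L) := ⟨by simpa using hLc.measure_lt_top⟩
    exact (h.memLpLoc L hL hLc).add (memLp_const c)
  rw [← h.integral_eq φ hφ v]
  have hz : ∀ x, x ∉ U → fderiv ℝ φ x = 0 := fun x hx =>
    fderiv_eq_zero_of_notMem_tsupport fun hx' => hx (hφ.tsupport_subset hx')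
  have hcd : Continuous fun x => fderiv ℝ φ x v :=
    (hφ.contDiff.continuous_fderiv (by simp)).clm_apply continuous_const
  have hi : Integrable (fun x => fderiv ℝ φ x v) volume :=
    hcd.integrable_of_hasCompactSupport (hφ.hasCompactSupport.fderiv_apply ℝ v)
  have h0 : ∫ x in U, fderiv ℝ φ x v = 0 := by
    rw [setIntegral_eq_integral_of_forall_compl_eq_zero fun x hx => by rw [hz x hx]; rfl]
    have := integral_mul_fderiv_eq_neg_fderiv_mul_of_integrable (μ := (volume : Measure (Euc N)))
      (f := fun _ => (1 : ℝ)) (g := φ) (v := v) (by simp) (by simpa using hi)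
      (by simpa using hφ.contDiff.continuous.integrable_of_hasCompactSupport hφ.hasCompactSupport)
      (fun x _ => differentiableAt_const 1)
      (fun x _ => hφ.contDiff.differentiable (by simp) x)
    simpa using this
  have hiu : Integrable (fun x => u x * fderiv ℝ φ x v) (volume.restrict U) := by
    have hlu : MemLpLoc u 1 U := fun L hL hLc => by
      have : Fact (volume L < ⊤) := ⟨hLc.measure_lt_top⟩
      exact (h.memLpLoc L hL hLc).mono_exponent (by simpa using hp)
    have := hlu.smul_right hcd (hφ.hasCompactSupport.fderiv_apply ℝ v)
      ((tsupport_fderiv_apply_subset ℝ v).trans hφ.tsupport_subset)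
    exact (memLp_one_iff_integrable.1 this).restrict
  simp_rw [add_mul]
  rw [integral_add hiu (hi.restrict.const_mul c), integral_const_mul, h0, mul_zero, add_zero]

/-- Immediate because the flux is a fixed vector field: the dependence of `A` on its second argument
is no longer visible. -/
theorem IsFlux.add_const (hp : 1 ≤ p) (h : IsFlux p C₀ C₁ U u G a) (c : ℝ) :
    IsFlux p C₀ C₁ U (fun x => u x + c) G a :=
  ⟨h.grad.add_const hp c, h.meas, h.growth, h.weak⟩

theorem lt_sobolevExponent (hp : 0 < p) (hpN : p < N) : p < (p⁻¹ - (N : ℝ)⁻¹)⁻¹ := by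
  have h0 : (0 : ℝ) < N := hp.trans hpN
  have h1 : (N : ℝ)⁻¹ < p⁻¹ := inv_strictAnti₀ hp hpN
  have h2 : 0 < (N : ℝ)⁻¹ := by positivity
  rw [lt_inv_comm₀ hp (by linarith)]
  linarith

theorem exists_sup_estimate (N : ℕ) {p C₀ C₁ : ℝ} (hp : 1 < p) (hpN : p < N)
    (hC₀ : 0 < C₀) (hC₁ : 0 < C₁) {A : ℝ} (hA : 0 < A) :
    ∃ α : ℝ, 0 < α ∧ ∀ (u : Euc N → ℝ) (G a : Euc N → Euc N) (m : ℝ), 0 < m →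
      IsFlux p C₀ C₁ (cube 0 2) u G a → (∀ᵐ x ∂(volume.restrict (cube 0 2)), u x ≤ A * m) →
      volume {x | x ∈ cube 0 (4 / 3) ∧ m / 4 ≤ u x} ≤ ENNReal.ofReal α →
      ∀ᵐ x ∂(volume.restrict (cube 0 1)), u x ≤ m / 2 := by
  have hp0 : 0 < p := by linarith
  obtain ⟨Λ, hΛ, hDG⟩ := exists_deGiorgi_const N hp hpN hC₀ hC₁
  have hpq := lt_sobolevExponent hp0 hpN
  obtain ⟨ν, hν, hcrit⟩ := exists_critical_mass N hp0 hpq hΛ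
  refine ⟨(ν / (4 * A)) ^ p, by positivity, fun u G a m hm h hAm hvol => ?_⟩
  have hw := (hDG _ u G a (isOpen_cube _ _) h).1
  -- Level and increment are both `m / 4`. The truncation is at most `A * m` on a set of measure at
  -- most `(ν / (4 * A)) ^ p`, so its `L^p` norm is at most `ν * (m / 4)`.
  have := hcrit u hw (m / 4) (m / 4) (by positivity) ?_
  · filter_upwards [this] with x hx
    linarith
  set Q : Set (Euc N) := cube 0 (4 / 3)
  set f : Euc N → ℝ := fun x => max (u x - m / 4) 0
  have hsupp : Function.support f ⊆ {x | m / 4 ≤ u x} := fun x hx => by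
    by_contra hcon
    have h1 : ¬ m / 4 ≤ u x := hcon
    exact hx (max_eq_right (by linarith))
  rw [← eLpNorm_restrict_eq_of_support_subset hsupp]
  have hb : ∀ᵐ x ∂((volume.restrict Q).restrict {x | m / 4 ≤ u x}), ‖f x‖ ≤ A * m := by
    refine ae_restrict_of_ae ?_
    filter_upwards [ae_restrict_of_ae_restrict_of_subset (cube_mono (by norm_num)) hAm] with x hx
    rw [Real.norm_of_nonneg (le_max_right _ _)]
    exact max_le (by linarith) (by positivity)
  refine (eLpNorm_le_of_ae_bound hb).trans ?_
  have hms : (volume.restrict Q).restrict {x | m / 4 ≤ u x} univ ≤ ENNReal.ofReal ((ν / (4 * A)) ^ p) := by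
    rw [Measure.restrict_apply_univ, Measure.restrict_apply' (measurableSet_cube _ _)]
    refine le_trans (measure_mono fun x hx => ?_) hvol
    exact ⟨hx.2, hx.1⟩
  rw [ENNReal.toReal_ofReal hp0.le]
  calc _ ≤ ENNReal.ofReal ((ν / (4 * A)) ^ p) ^ p⁻¹ * ENNReal.ofReal (A * m) := by gcongr
    _ = ENNReal.ofReal (ν * (m / 4)) := by
      rw [ENNReal.ofReal_rpow_of_nonneg (by positivity) (by positivity),
        ← Real.rpow_mul (by positivity), mul_inv_cancel₀ hp0.ne', Real.rpow_one,
        ← ENNReal.ofReal_mul (by positivity)]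
      congr 1
      field_simp

/-- The function `(-log u + log m)₊` vanishes where `u ≥ m`, so Poincaré and the logarithmic
estimate bound it in `L^p` by a constant `Z`; the iteration turns this into an upper bound for `-log
u`. -/
theorem exists_expansion_of_le (N : ℕ) {p C₀ C₁ : ℝ} (hp : 1 < p) (hpN : p < N)
    (hC₀ : 0 < C₀) (hC₁ : 0 < C₁) {α : ℝ} (hα : 0 < α) :
    ∃ γ : ℝ, 0 < γ ∧ γ ≤ 1 ∧ ∀ (u : Euc N → ℝ) (G a : Euc N → Euc N) (ε m : ℝ), 0 < ε → 0 < m →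
      IsFlux p C₀ C₁ (cube 0 2) u G a → (∀ᵐ x ∂(volume.restrict (cube 0 2)), ε ≤ u x) →
      ENNReal.ofReal α ≤ volume {x | x ∈ cube 0 (4 / 3) ∧ m ≤ u x} →
      ∀ᵐ x ∂(volume.restrict (cube 0 1)), γ * m ≤ u x := by
  have hp0 : 0 < p := by linarith
  have hp1 : 0 < p - 1 := by linarith
  obtain ⟨Λ, hΛ, hDG⟩ := exists_deGiorgi_const N hp hpN hC₀ hC₁
  have hpq := lt_sobolevExponent hp0 hpN
  obtain ⟨ν, hν, hcrit⟩ := exists_critical_mass N hp0 hpq hΛ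
  obtain ⟨L, -, hL⟩ := exists_cutoff N
  obtain ⟨θ, hθ, hθ0, -, hθ1, -⟩ := hL (4 / 3) 2 (by norm_num)
  set Q : Set (Euc N) := cube 0 (4 / 3) with hQ
  obtain ⟨D, hD⟩ : ∃ D : ℝ, ∀ x ∈ Q, ∀ y ∈ Q, ‖x - y‖ ≤ D := by
    obtain ⟨D, hD⟩ := Metric.isBounded_iff.1
      ((isCompact_closedCube (0 : Euc N) (4 / 3)).isBounded.subset (cube_subset_closedCube _ _))
    exact ⟨D, fun x hx y hy => by rw [← dist_eq_norm]; exact hD hx hy⟩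
  have hθ1c : ContDiff ℝ 1 θ := hθ.contDiff.of_le (by simp)
  set V : ℝ≥0∞ := ENNReal.ofReal (p * C₁ * (p - 1)⁻¹ / C₀) * eLpNorm (fun x => ‖fderiv ℝ θ x‖)
        (ENNReal.ofReal p) (volume.restrict (tsupport θ)) with hV
  have hVfin : V ≠ ⊤ := by
    refine ENNReal.mul_ne_top (by simp) ?_
    have : MemLp (fderiv ℝ θ) (ENNReal.ofReal p) volume :=
      (hθ1c.continuous_fderiv (by simp)).memLp_of_hasCompactSupport (hθ.hasCompactSupport.fderiv ℝ)
    exact this.norm.restrict _ |>.2.ne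
  set W : ℝ≥0∞ := (ENNReal.ofReal D ^ p * (volume Q * (2 ^ N * V ^ p))) / ENNReal.ofReal α with hW
  have hWfin : W ≠ ⊤ := by
    refine ENNReal.div_ne_top (ENNReal.mul_ne_top (by simp [hp0.le])
      (ENNReal.mul_ne_top (volume_cube_lt_top _ _).ne
        (ENNReal.mul_ne_top (by simp) (by simp [hp0.le, hVfin])))) (by simpa using hα)
  set Z : ℝ≥0∞ := W ^ (1 / p) with hZ
  have hZfin : Z ≠ ⊤ := ENNReal.rpow_ne_top_of_nonneg (by positivity) hWfin
  -- The increment is taken so large that `ν * κ ≥ Z`; the `1` keeps it positive when `Z = 0`.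
  set κ : ℝ := (Z.toReal + 1) / ν with hκ
  have hZ0 : 0 ≤ Z.toReal := ENNReal.toReal_nonneg
  have hκ0 : 0 < κ := by positivity
  refine ⟨Real.exp (-(1 + κ)), Real.exp_pos _, Real.exp_le_one_iff.2 (by linarith),
    fun u G a ε m hε0 hm h hε hvol => ?_⟩
  have hw := (hDG _ u G a (isOpen_cube _ _) h).2 ε hε0 hε
  have hQ2 : Q ⊆ cube 0 2 := cube_mono (by norm_num)
  -- The level is raised by `1` because `huber` with `d = 1` vanishes up to `-log m` but dominates
  -- only the truncation at `-log m + 1`.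
  have key := hcrit _ hw (-Real.log m + 1) κ hκ0 ?_
  · filter_upwards [key, ae_restrict_of_ae_restrict_of_subset (cube_mono (by norm_num)) hε]
      with x hx hx2
    have hu0 : 0 < u x := hε0.trans_le hx2
    rw [← Real.log_le_log_iff (by positivity) hu0, Real.log_mul (Real.exp_pos _).ne' hm.ne',
      Real.log_exp]
    linarith
  have hlim := h.isC1Limit_huber_log hp (isOpen_cube _ _) hε0 hε hθ1c hθ.hasCompactSupport
    hθ.tsupport_subset (-Real.log m) 1
  set f : Euc N → ℝ := fun x => θ x * huber (-Real.log m) 1 (-Real.log (u x)) with hf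
  have hum : AEMeasurable u (volume.restrict Q) := by
    have := (h.grad.memLpLoc _ (closedCube_subset_cube (by norm_num))
      (isCompact_closedCube 0 (4 / 3))).1.aemeasurable
    exact this.mono_measure (Measure.restrict_mono (cube_subset_closedCube _ _) le_rfl)
  have hQm : MeasurableSet Q := measurableSet_cube _ _
  have hE : ∀ᵐ x ∂(volume.restrict {x | x ∈ Q ∧ m ≤ u x}), f x = 0 := by
    have hnull : NullMeasurableSet {x | m ≤ u x} (volume.restrict Q) :=
      nullMeasurableSet_le aemeasurable_const hum
    have e : (volume : Measure (Euc N)).restrict {x | x ∈ Q ∧ m ≤ u x} =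
        (volume.restrict Q).restrict {x | m ≤ u x} := by
      rw [Measure.restrict_restrict₀ hnull]
      congr 1
      ext x; exact and_comm
    rw [e]
    filter_upwards [ae_restrict_mem₀ hnull] with x hx
    rw [hf]
    simp only
    rw [huber_eq_zero one_pos (by simpa using Real.log_le_log hm hx), mul_zero]
  have hpoin := hlim.poincare hp.le (convex_cube 0 (4 / 3)) hQm (volume_cube_lt_top _ _).ne hD
    (fun x hx => hx.1) hE
  have hgrad : ∫⁻ x in Q, ‖huber (-Real.log m) 1 (-Real.log (u x)) • fderiv ℝ θ x -
        (θ x * ramp (-Real.log m) 1 (-Real.log (u x)) * (u x)⁻¹) • innerSL ℝ (G x)‖ₑ ^ p ≤ V ^ p := by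
    have hlog := h.log_estimate hp hC₀ hC₁ (isOpen_cube _ _) hε0 hε hθ1c hθ.hasCompactSupport
      hθ.tsupport_subset hθ0
    have hQθ : Q ⊆ tsupport θ := fun x hx =>
      subset_tsupport _ (by rw [Function.mem_support, hθ1 x hx]; exact one_ne_zero)
    calc _ ≤ ∫⁻ x in Q, ‖θ x * (u x)⁻¹ * ‖G x‖‖ₑ ^ p := by
          refine lintegral_mono_ae ?_
          filter_upwards [ae_restrict_of_ae_restrict_of_subset hQ2 hε, ae_restrict_mem hQm]
            with x hx hxQ
          have hu0 : 0 < u x := hε0.trans_le hx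
          have hd0 : fderiv ℝ θ x = 0 := by
            have : θ =ᶠ[𝓝 x] fun _ => 1 := by
              filter_upwards [(isOpen_cube 0 (4 / 3)).mem_nhds hxQ] with y hy
              exact hθ1 y hy
            rw [this.fderiv_eq, fderiv_fun_const]; rfl
          gcongr
          rw [enorm_le_iff_norm_le, hd0, smul_zero, zero_sub, norm_neg, norm_smul,
            innerSL_apply_norm, norm_mul (θ x * (u x)⁻¹), norm_norm]
          gcongr ?_ * _
          rw [norm_mul, norm_mul, norm_mul, Real.norm_of_nonneg (ramp_nonneg _)]
          gcongr ?_ * _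
          exact mul_le_of_le_one_right (norm_nonneg _) (ramp_le_one _)
      _ ≤ ∫⁻ x in tsupport θ, ‖θ x * (u x)⁻¹ * ‖G x‖‖ₑ ^ p := lintegral_mono_set hQθ
      _ = _ := (eLpNorm_rpow_eq_lintegral hp0 _ _).symm
      _ ≤ V ^ p := by gcongr
  have hfW : ∫⁻ y in Q, ‖f y‖ₑ ^ p ≤ W := by
    rw [hW, ENNReal.le_div_iff_mul_le (Or.inl (by simpa using hα)) (Or.inl (by simp)), mul_comm]
    refine le_trans ?_ (hpoin.trans ?_)
    · gcongr
    · gcongr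
  calc eLpNorm (fun x => max (-Real.log (u x) - (-Real.log m + 1)) 0) (ENNReal.ofReal p)
        (volume.restrict Q)
      ≤ eLpNorm f (ENNReal.ofReal p) (volume.restrict Q) := by
        refine eLpNorm_mono_ae ?_
        filter_upwards [ae_restrict_mem hQm] with x hx
        simp only [hf]
        rw [hθ1 x hx, one_mul, Real.norm_of_nonneg (le_max_right _ _),
          Real.norm_of_nonneg (huber_nonneg one_pos _)]
        exact le_huber one_pos _
    _ = (∫⁻ y in Q, ‖f y‖ₑ ^ p) ^ (1 / p) := by
        rw [← eLpNorm_rpow_eq_lintegral hp0, ← ENNReal.rpow_mul, mul_one_div_cancel hp0.ne',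
          ENNReal.rpow_one]
    _ ≤ Z := by rw [hZ]; gcongr
    _ ≤ ENNReal.ofReal (ν * κ) := by
        rw [hκ, mul_div_cancel₀ _ hν.ne']
        refine (ENNReal.ofReal_toReal hZfin).symm.le.trans (ENNReal.ofReal_le_ofReal (by linarith))

/-- The constant `γ` is independent of `ε`, so the strictly positive functions `u + 1 / (n + 1)` may
be used and `n` sent to infinity. -/
theorem exists_expansion (N : ℕ) {p C₀ C₁ : ℝ} (hp : 1 < p) (hpN : p < N)
    (hC₀ : 0 < C₀) (hC₁ : 0 < C₁) {α : ℝ} (hα : 0 < α) :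
    ∃ γ : ℝ, 0 < γ ∧ γ ≤ 1 ∧ ∀ (u : Euc N → ℝ) (G a : Euc N → Euc N) (m : ℝ), 0 < m →
      IsFlux p C₀ C₁ (cube 0 2) u G a → (∀ᵐ x ∂(volume.restrict (cube 0 2)), 0 ≤ u x) →
      ENNReal.ofReal α ≤ volume {x | x ∈ cube 0 (4 / 3) ∧ m ≤ u x} →
      ∀ᵐ x ∂(volume.restrict (cube 0 1)), γ * m ≤ u x := by
  obtain ⟨γ, hγ, hγ1, hexp⟩ := exists_expansion_of_le N hp hpN hC₀ hC₁ hα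
  refine ⟨γ, hγ, hγ1, fun u G a m hm h hu hvol => ?_⟩
  have hall : ∀ n : ℕ, ∀ᵐ x ∂(volume.restrict (cube 0 1)), γ * m ≤ u x + 1 / ((n : ℝ) + 1) := by
    intro n
    have hn : (0 : ℝ) < 1 / ((n : ℝ) + 1) := by positivity
    refine hexp _ G a _ m hn hm (h.add_const hp.le _) ?_ (hvol.trans ?_)
    · filter_upwards [hu] with x hx
      linarith
    · exact measure_mono fun x hx => ⟨hx.1, hx.2.trans (by linarith)⟩
  filter_upwards [ae_all_iff.2 hall] with x hx
  refine ge_of_tendsto' (x := atTop) (f := fun n : ℕ => u x + 1 / ((n : ℝ) + 1)) ?_ hx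
  simpa using (tendsto_one_div_add_atTop_nhds_zero_nat (𝕜 := ℝ)).const_add (u x)

end Positivity

/-! ### Invariance under dilations and restriction. -/

section Rescaling
open Filter Topology
open scoped ENNReal

variable {N : ℕ} {p C₀ C₁ : ℝ} {U : Set (Euc N)} {u : Euc N → ℝ} {G a : Euc N → Euc N}

/-- The map `x ↦ x₀ + r x`. -/
noncomputable def dilation (x₀ : Euc N) {r : ℝ} (hr : 0 < r) : Euc N ≃ₜ Euc N :=
  (Homeomorph.smulOfNeZero r hr.ne').trans (Homeomorph.addLeft x₀)

variable (x₀ : Euc N) {r : ℝ} (hr : 0 < r)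

theorem dilation_apply (x : Euc N) : dilation x₀ hr x = x₀ + r • x := rfl

theorem dilation_preimage_cube (s : ℝ) : dilation x₀ hr ⁻¹' cube x₀ (r * s) = cube 0 s := by
  ext x
  refine forall_congr' fun i => ?_
  rw [dilation_apply]
  simp only [PiLp.add_apply, PiLp.smul_apply, smul_eq_mul, add_sub_cancel_left, PiLp.zero_apply,
    sub_zero, abs_mul, abs_of_pos hr, mul_div_assoc]
  exact mul_lt_mul_iff_right₀ hr

theorem map_dilation : Measure.map (dilation x₀ hr) (volume : Measure (Euc N)) =
    ENNReal.ofReal (r ^ N)⁻¹ • volume := by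
  have h1 : (dilation x₀ hr : Euc N → Euc N) = (fun y => x₀ + y) ∘ fun x => r • x := rfl
  rw [h1, ← Measure.map_map (measurable_const_add x₀) (measurable_const_smul r),
    Measure.map_addHaar_smul _ hr.ne', Measure.map_smul, map_add_left_eq_self,
    finrank_euclideanSpace_fin, abs_of_pos (by positivity)]

theorem measurableEmbedding_dilation : MeasurableEmbedding (dilation x₀ hr) :=
  (dilation x₀ hr).measurableEmbedding

theorem volume_preimage_dilation (S : Set (Euc N)) :
    volume (dilation x₀ hr ⁻¹' S) = ENNReal.ofReal (r ^ N)⁻¹ * volume S := by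
  rw [← (measurableEmbedding_dilation x₀ hr).map_apply, map_dilation]
  rfl

theorem map_restrict_dilation (S : Set (Euc N)) :
    Measure.map (dilation x₀ hr) ((volume : Measure (Euc N)).restrict (dilation x₀ hr ⁻¹' S)) =
      ENNReal.ofReal (r ^ N)⁻¹ • volume.restrict S := by
  rw [← (measurableEmbedding_dilation x₀ hr).restrict_map, map_dilation, Measure.restrict_smul]

theorem ae_restrict_dilation_iff (S : Set (Euc N)) {P : Euc N → Prop} :
    (∀ᵐ x ∂(volume.restrict (dilation x₀ hr ⁻¹' S)), P (dilation x₀ hr x)) ↔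
      ∀ᵐ x ∂(volume.restrict S), P x := by
  rw [← (measurableEmbedding_dilation x₀ hr).ae_map_iff, map_restrict_dilation]
  have : ENNReal.ofReal (r ^ N)⁻¹ ≠ 0 := by
    rw [Ne, ENNReal.ofReal_eq_zero, not_le]; positivity
  rw [Measure.ae_ennreal_smul_measure_iff this]

theorem integral_dilation {F : Type*} [NormedAddCommGroup F] [NormedSpace ℝ F] (S : Set (Euc N))
    (f : Euc N → F) :
    ∫ x in dilation x₀ hr ⁻¹' S, f (dilation x₀ hr x) = (r ^ N)⁻¹ • ∫ x in S, f x := by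
  rw [← (measurableEmbedding_dilation x₀ hr).integral_map, map_restrict_dilation,
    integral_smul_measure, ENNReal.toReal_ofReal (by positivity)]

theorem MemLpLoc.comp_dilation {F : Type*} [NormedAddCommGroup F] {f : Euc N → F} {q : ℝ≥0∞}
    (hf : MemLpLoc f q U) :
    MemLpLoc (fun x => f (dilation x₀ hr x)) q (dilation x₀ hr ⁻¹' U) := by
  intro L hL hLc
  have h1 := hf (dilation x₀ hr '' L) (image_subset_iff.2 hL)
    (hLc.image (dilation x₀ hr).continuous)
  have h2 : MemLp f q (Measure.map (dilation x₀ hr) ((volume : Measure (Euc N)).restrict L)) := by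
    have e : L = dilation x₀ hr ⁻¹' (dilation x₀ hr '' L) :=
      ((dilation x₀ hr).injective.preimage_image L).symm
    conv_rhs => rw [e]
    rw [map_restrict_dilation]
    exact h1.smul_measure ENNReal.ofReal_ne_top
  exact (measurableEmbedding_dilation x₀ hr).memLp_map_measure_iff.1 h2

theorem IsTestFunction.comp_dilation_symm {φ : Euc N → ℝ}
    (hφ : IsTestFunction (dilation x₀ hr ⁻¹' U) φ) :
    IsTestFunction U fun y => φ ((dilation x₀ hr).symm y) := by
  refine ⟨?_, hφ.hasCompactSupport.comp_homeomorph (dilation x₀ hr).symm, ?_⟩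
  · refine hφ.contDiff.comp ?_
    have : ((dilation x₀ hr).symm : Euc N → Euc N) = fun y => r⁻¹ • (-x₀ + y) := rfl
    rw [this]
    fun_prop
  · have e := tsupport_comp_eq_preimage φ (dilation x₀ hr).symm
    intro y hy
    have h1 := hφ.tsupport_subset (e.subset hy : (dilation x₀ hr).symm y ∈ tsupport φ)
    simpa using h1

theorem fderiv_comp_dilation_symm {φ : Euc N → ℝ} (hφ : Differentiable ℝ φ) (x v : Euc N) :
    fderiv ℝ φ x v =
      r * fderiv ℝ (fun y => φ ((dilation x₀ hr).symm y)) (dilation x₀ hr x) v := by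
  have h1 : HasFDerivAt ((dilation x₀ hr).symm : Euc N → Euc N)
      (r⁻¹ • ContinuousLinearMap.id ℝ (Euc N)) (dilation x₀ hr x) :=
    ((hasFDerivAt_id _).const_add (-x₀)).const_smul r⁻¹
  have h2 : HasFDerivAt φ (fderiv ℝ φ x) ((dilation x₀ hr).symm (dilation x₀ hr x)) := by
    rw [Homeomorph.symm_apply_apply]; exact (hφ x).hasFDerivAt
  have h3 := (h2.comp _ h1).fderiv
  rw [show (fun y => φ ((dilation x₀ hr).symm y)) = φ ∘ (dilation x₀ hr).symm from rfl, h3]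
  simp
  field_simp

/-- The gradient scales by `r`, and the flux is multiplied by `r ^ (p - 1)` so that both growth
conditions keep the same `C₀` and `C₁`. -/
theorem IsFlux.comp_dilation (h : IsFlux p C₀ C₁ U u G a) :
    IsFlux p C₀ C₁ (dilation x₀ hr ⁻¹' U) (fun x => u (dilation x₀ hr x))
      (fun x => r • G (dilation x₀ hr x)) (fun x => r ^ (p - 1) • a (dilation x₀ hr x)) := by
  refine ⟨⟨h.grad.memLpLoc.comp_dilation x₀ hr, fun L hL hLc =>
    (h.grad.memLpLoc_grad.comp_dilation x₀ hr L hL hLc).const_smul r, fun φ hφ v => ?_⟩, ?_, ?_,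
    fun φ hφ => ?_⟩
  · have hψ := hφ.comp_dilation_symm x₀ hr
    set ψ := fun y => φ ((dilation x₀ hr).symm y) with hψd
    have e1 := integral_dilation x₀ hr U fun y => u y * fderiv ℝ ψ y v
    have e2 := integral_dilation x₀ hr U fun y => inner ℝ (G y) v * ψ y
    rw [h.grad.integral_eq ψ hψ v] at e1
    have l1 : ∀ x, u (dilation x₀ hr x) * fderiv ℝ φ x v =
        r * (u (dilation x₀ hr x) * fderiv ℝ ψ (dilation x₀ hr x) v) := fun x => by
      rw [fderiv_comp_dilation_symm x₀ hr (hφ.contDiff.differentiable (by simp)) x v]; ring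
    have l2 : ∀ x, inner ℝ (r • G (dilation x₀ hr x)) v * φ x =
        r * (inner ℝ (G (dilation x₀ hr x)) v * ψ (dilation x₀ hr x)) := fun x => by
      rw [real_inner_smul_left, hψd]
      simp only [Homeomorph.symm_apply_apply]
      ring
    simp_rw [l1, l2]
    rw [integral_const_mul, integral_const_mul, e1, e2]
    simp only [smul_eq_mul]
    ring
  · have hm : AEStronglyMeasurable a (Measure.map (dilation x₀ hr)
        ((volume : Measure (Euc N)).restrict (dilation x₀ hr ⁻¹' U))) := by
      rw [map_restrict_dilation]
      exact h.meas.smul_measure _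
    exact (hm.comp_measurable (dilation x₀ hr).measurable).const_smul (r ^ (p - 1))
  · refine (ae_restrict_dilation_iff x₀ hr U (P := fun y => C₀ * ‖r • G y‖ ^ p ≤
      inner ℝ (r ^ (p - 1) • a y) (r • G y) ∧ ‖r ^ (p - 1) • a y‖ ≤ C₁ * ‖r • G y‖ ^ (p - 1))).2 ?_
    filter_upwards [h.growth] with y hy
    have hrp : r ^ p = r ^ (p - 1) * r := by
      rw [← Real.rpow_add_one hr.ne']; congr 1; ring
    have hr1 : 0 < r ^ (p - 1) := by positivity
    rw [norm_smul, norm_smul, Real.norm_of_nonneg hr.le, Real.norm_of_nonneg hr1.le,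
      Real.mul_rpow hr.le (norm_nonneg _), Real.mul_rpow hr.le (norm_nonneg _), hrp,
      real_inner_smul_left, real_inner_smul_right]
    constructor
    · calc C₀ * (r ^ (p - 1) * r * ‖G y‖ ^ p) = r ^ (p - 1) * (r * (C₀ * ‖G y‖ ^ p)) := by ring
        _ ≤ _ := by gcongr; exact hy.1
    · calc r ^ (p - 1) * ‖a y‖ ≤ r ^ (p - 1) * (C₁ * ‖G y‖ ^ (p - 1)) := by gcongr; exact hy.2
        _ = _ := by ring
  · have hψ := hφ.comp_dilation_symm x₀ hr
    set ψ := fun y => φ ((dilation x₀ hr).symm y) with hψd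
    have e1 := integral_dilation x₀ hr U fun y => fderiv ℝ ψ y (a y)
    rw [h.weak ψ hψ, smul_zero] at e1
    have l1 : ∀ x, fderiv ℝ φ x (r ^ (p - 1) • a (dilation x₀ hr x)) =
        r * r ^ (p - 1) * fderiv ℝ ψ (dilation x₀ hr x) (a (dilation x₀ hr x)) := fun x => by
      rw [fderiv_comp_dilation_symm x₀ hr (hφ.contDiff.differentiable (by simp)) x, map_smul,
        smul_eq_mul, mul_assoc]
    simp_rw [l1]
    rw [integral_const_mul, e1, mul_zero]

theorem IsFlux.mono {V : Set (Euc N)} (h : IsFlux p C₀ C₁ U u G a) (hU : MeasurableSet U)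
    (hVU : V ⊆ U) : IsFlux p C₀ C₁ V u G a := by
  have ht : ∀ φ, IsTestFunction V φ → IsTestFunction U φ := fun φ hφ =>
    ⟨hφ.contDiff, hφ.hasCompactSupport, hφ.tsupport_subset.trans hVU⟩
  have hz : ∀ φ, IsTestFunction V φ → ∀ x, x ∉ V → φ x = 0 ∧ fderiv ℝ φ x = 0 := fun φ hφ x hx =>
    ⟨image_eq_zero_of_notMem_tsupport fun hx' => hx (hφ.tsupport_subset hx'),
      fderiv_eq_zero_of_notMem_tsupport fun hx' => hx (hφ.tsupport_subset hx')⟩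
  refine ⟨⟨fun L hL => h.grad.memLpLoc L (hL.trans hVU), fun L hL =>
    h.grad.memLpLoc_grad L (hL.trans hVU), fun φ hφ v => ?_⟩,
    h.meas.mono_measure (Measure.restrict_mono hVU le_rfl),
    ae_restrict_of_ae_restrict_of_subset hVU h.growth, fun φ hφ => ?_⟩
  · have := h.grad.integral_eq φ (ht φ hφ) v
    rwa [setIntegral_eq_of_subset_of_forall_sdiff_eq_zero hU hVU fun x hx => by
      rw [(hz φ hφ x hx.2).2]; simp, setIntegral_eq_of_subset_of_forall_sdiff_eq_zero hU hVU
      fun x hx => by rw [(hz φ hφ x hx.2).1]; simp] at this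
  · have := h.weak φ (ht φ hφ)
    rwa [setIntegral_eq_of_subset_of_forall_sdiff_eq_zero hU hVU fun x hx => by
      rw [(hz φ hφ x hx.2).2]; simp] at this

end Rescaling

/-! ### The Harnack inequality: peak selection and propagation of positivity. -/

section Harnack
open Filter Topology
open scoped ENNReal

variable {N : ℕ} {p C₀ C₁ : ℝ}

theorem volume_preimage_dilation_setOf (x₀ : Euc N) {r : ℝ} (hr : 0 < r) (s m : ℝ)
    (u : Euc N → ℝ) :
    volume {x | x ∈ cube 0 s ∧ m ≤ u (dilation x₀ hr x)} =
      ENNReal.ofReal (r ^ N)⁻¹ * volume {x | x ∈ cube x₀ (r * s) ∧ m ≤ u x} := by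
  rw [← volume_preimage_dilation x₀ hr, ← dilation_preimage_cube x₀ hr s]
  rfl

theorem exists_sup_estimate_cube (N : ℕ) {p C₀ C₁ : ℝ} (hp : 1 < p) (hpN : p < N)
    (hC₀ : 0 < C₀) (hC₁ : 0 < C₁) {A : ℝ} (hA : 0 < A) :
    ∃ α : ℝ, 0 < α ∧ ∀ (U : Set (Euc N)) (u : Euc N → ℝ) (G a : Euc N → Euc N),
      IsOpen U → IsFlux p C₀ C₁ U u G a → ∀ (x₀ : Euc N) (r m : ℝ), 0 < r → 0 < m →
      cube x₀ (r * 2) ⊆ U → (∀ᵐ x ∂(volume.restrict (cube x₀ (r * 2))), u x ≤ A * m) →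
      volume {x | x ∈ cube x₀ (r * (4 / 3)) ∧ m / 4 ≤ u x} ≤ ENNReal.ofReal (α * r ^ N) →
      ∀ᵐ x ∂(volume.restrict (cube x₀ r)), u x ≤ m / 2 := by
  obtain ⟨α, hα, hsup⟩ := exists_sup_estimate N hp hpN hC₀ hC₁ hA
  refine ⟨α, hα, fun U u G a hU h x₀ r m hr hm hrU hA hvol => ?_⟩
  have h2 := (h.mono hU.measurableSet hrU).comp_dilation x₀ hr
  rw [dilation_preimage_cube] at h2
  have := hsup _ _ _ m hm h2 ?_ ?_
  · rw [← mul_one r, ← ae_restrict_dilation_iff x₀ hr, dilation_preimage_cube]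
    exact this
  · rw [← dilation_preimage_cube x₀ hr]
    exact (ae_restrict_dilation_iff x₀ hr (cube x₀ (r * 2)) (P := fun x => u x ≤ A * m)).2 hA
  · rw [volume_preimage_dilation_setOf]
    refine (mul_le_mul_right hvol _).trans (le_of_eq ?_)
    rw [← ENNReal.ofReal_mul (by positivity)]
    congr 1
    field_simp

theorem exists_expansion_cube (N : ℕ) {p C₀ C₁ : ℝ} (hp : 1 < p) (hpN : p < N)
    (hC₀ : 0 < C₀) (hC₁ : 0 < C₁) {α : ℝ} (hα : 0 < α) :
    ∃ γ : ℝ, 0 < γ ∧ γ ≤ 1 ∧ ∀ (U : Set (Euc N)) (u : Euc N → ℝ) (G a : Euc N → Euc N),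
      IsOpen U → IsFlux p C₀ C₁ U u G a → (∀ᵐ x ∂(volume.restrict U), 0 ≤ u x) →
      ∀ (x₀ : Euc N) (r m : ℝ), 0 < r → 0 < m → cube x₀ (r * 2) ⊆ U →
      ENNReal.ofReal (α * r ^ N) ≤ volume {x | x ∈ cube x₀ (r * (4 / 3)) ∧ m ≤ u x} →
      ∀ᵐ x ∂(volume.restrict (cube x₀ r)), γ * m ≤ u x := by
  obtain ⟨γ, hγ, hγ1, hexp⟩ := exists_expansion N hp hpN hC₀ hC₁ hα
  refine ⟨γ, hγ, hγ1, fun U u G a hU h hu x₀ r m hr hm hrU hvol => ?_⟩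
  have h2 := (h.mono hU.measurableSet hrU).comp_dilation x₀ hr
  rw [dilation_preimage_cube] at h2
  have := hexp _ _ _ m hm h2 ?_ ?_
  · rw [← mul_one r, ← ae_restrict_dilation_iff x₀ hr, dilation_preimage_cube]
    exact this
  · rw [← dilation_preimage_cube x₀ hr]
    exact (ae_restrict_dilation_iff x₀ hr (cube x₀ (r * 2)) (P := fun x => 0 ≤ u x)).2
      (ae_restrict_of_ae_restrict_of_subset hrU hu)
  · rw [volume_preimage_dilation_setOf]
    refine le_trans (le_of_eq ?_) (mul_le_mul_right hvol _)
    rw [← ENNReal.ofReal_mul (by positivity)]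
    congr 1
    field_simp

theorem volume_cube (x₀ : Euc N) {r : ℝ} (hr : 0 < r) :
    volume (cube x₀ r) = ENNReal.ofReal ((volume (cube (0 : Euc N) 1)).toReal * r ^ N) := by
  have h := volume_preimage_dilation x₀ hr (cube x₀ (r * 1))
  rw [dilation_preimage_cube, mul_one] at h
  rw [h, ENNReal.toReal_mul, ENNReal.toReal_ofReal (by positivity), mul_right_comm,
    inv_mul_cancel₀ (by positivity), one_mul, ENNReal.ofReal_toReal (volume_cube_lt_top _ _).ne]

theorem volume_cube_pos (x₀ : Euc N) {r : ℝ} (hr : 0 < r) : 0 < volume (cube x₀ r) :=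
  (isOpen_cube x₀ r).measure_pos volume ⟨x₀, fun i => by simpa using hr⟩

theorem cube_subset_cube_of_mem {x₀ : Euc N} {r s t : ℝ} (hx₀ : x₀ ∈ cube 0 t) (h : r + t ≤ s) :
    cube x₀ r ⊆ cube 0 s := fun x hx i => by
  have h1 := hx i
  have h2 := hx₀ i
  simp only [PiLp.zero_apply, sub_zero] at h2 ⊢
  have h3 := abs_sub_abs_le_abs_sub (x i) (x₀ i)
  linarith

theorem le_volume_setOf {x₀ : Euc N} {u : Euc N → ℝ} {s t m : ℝ} (hst : s ≤ t)
    (h : ∀ᵐ x ∂(volume.restrict (cube x₀ s)), m ≤ u x) :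
    volume (cube x₀ s) ≤ volume {x | x ∈ cube x₀ t ∧ m ≤ u x} := by
  refine measure_mono_ae ?_
  filter_upwards [(ae_restrict_iff' (measurableSet_cube x₀ s)).1 h] with x hx hxs
  exact ⟨cube_mono hst hxs, hx hxs⟩

/-- Selection of a point around which `u` is large, compared with its size in a neighbourhood. -/
theorem exists_peak {u : Euc N → ℝ} {B β M : ℝ} (hβ : 0 ≤ β) (hM : 0 < M)
    (hB : ∀ᵐ x ∂(volume.restrict (cube (0 : Euc N) 2)), u x ≤ B)
    (hu : ¬ ∀ᵐ x ∂(volume.restrict (cube (0 : Euc N) 1)), u x ≤ M) :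
    ∃ (x₀ : Euc N) (δ m : ℝ), 0 < δ ∧ δ ≤ 1 ∧ 0 < m ∧ M / 2 ≤ m * δ ^ β ∧ x₀ ∈ cube 0 (2 - δ) ∧
      (∀ᵐ x ∂(volume.restrict (cube (0 : Euc N) (2 - δ / 2))), u x ≤ 2 ^ (β + 1) * m) ∧
      ¬ ∀ᵐ x ∂(volume.restrict (cube x₀ (δ / 8))), u x ≤ m := by
  -- `S` compares `u` with the barriers `s * δ ^ (-β)`, which blow up near the boundary of the cube
  -- of side `2`. Local boundedness serves only to make `S` bounded, so that some `s ∈ S` has `2 * s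
  -- ∉ S`; the value of `B` does not enter the estimates.
  set S : Set ℝ := {s | 0 < s ∧ ∃ δ : ℝ, 0 < δ ∧ δ ≤ 1 ∧
    ¬ ∀ᵐ x ∂(volume.restrict (cube (0 : Euc N) (2 - δ))), u x ≤ s * δ ^ (-β)} with hS
  have hMS : M ∈ S := ⟨hM, 1, one_pos, le_rfl, by
    rw [Real.one_rpow, mul_one]; norm_num; simpa using hu⟩
  have hbdd : BddAbove S := by
    refine ⟨B, fun s hs => ?_⟩
    obtain ⟨hs0, δ, hδ, hδ1, hn⟩ := hs
    by_contra hcon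
    refine hn ?_
    filter_upwards [ae_restrict_of_ae_restrict_of_subset (cube_mono (by linarith)) hB] with x hx
    have h1 : 1 ≤ δ ^ (-β) := Real.one_le_rpow_of_pos_of_le_one_of_nonpos hδ hδ1 (by linarith)
    nlinarith [not_le.1 hcon]
  have hMs : M ≤ sSup S := le_csSup hbdd hMS
  obtain ⟨s, hsS, hs⟩ := exists_lt_of_lt_csSup ⟨M, hMS⟩ (show sSup S / 2 < sSup S by linarith)
  have h2s : 2 * s ∉ S := fun h => by linarith [le_csSup hbdd h]
  obtain ⟨hs0, δ, hδ, hδ1, hn⟩ := hsS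
  have hm : 0 < s * δ ^ (-β) := by positivity
  have hup : ∀ᵐ x ∂(volume.restrict (cube (0 : Euc N) (2 - δ / 2))),
      u x ≤ 2 ^ (β + 1) * (s * δ ^ (-β)) := by
    have : ∀ᵐ x ∂(volume.restrict (cube (0 : Euc N) (2 - δ / 2))),
        u x ≤ 2 * s * (δ / 2) ^ (-β) := by
      by_contra hcon
      -- As `2 * s ∉ S`, the barrier with doubled height holds at `δ / 2`: halving the distance
      -- costs `2 ^ β`, which explains the factor `2 ^ (β + 1)`.
      exact h2s ⟨by linarith, δ / 2, by linarith, by linarith, hcon⟩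
    filter_upwards [this] with x hx
    refine hx.trans (le_of_eq ?_)
    rw [Real.div_rpow hδ.le (by norm_num), Real.rpow_neg (by norm_num : (0 : ℝ) ≤ 2),
      Real.rpow_add_one (by norm_num)]
    field_simp
  -- Otherwise the set where `u` exceeds the barrier would be locally null, hence null.
  obtain ⟨x₀, hx₀, hx₀n⟩ : ∃ x₀ ∈ cube (0 : Euc N) (2 - δ),
      ¬ ∀ᵐ x ∂(volume.restrict (cube x₀ (δ / 8))), u x ≤ s * δ ^ (-β) := by
    by_contra hcon
    push Not at hcon
    refine hn ?_
    rw [ae_restrict_iff' (measurableSet_cube _ _), ae_iff]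
    refine measure_null_of_locally_null _ fun x hx => ?_
    simp only [mem_ofPred_eq, Classical.not_imp, not_le] at hx
    have h1 := hcon x hx.1
    rw [ae_restrict_iff' (measurableSet_cube _ _), ae_iff] at h1
    refine ⟨{y | ¬(y ∈ cube (0 : Euc N) (2 - δ) → u y ≤ s * δ ^ (-β))} ∩ cube x (δ / 8),
      inter_mem self_mem_nhdsWithin (mem_nhdsWithin_of_mem_nhds
        ((isOpen_cube _ _).mem_nhds fun i => by simpa using hδ)), ?_⟩
    refine measure_mono_null (fun y hy => ?_) h1
    obtain ⟨hy1, hy2⟩ := hy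
    simp only [mem_ofPred_eq, Classical.not_imp] at hy1 ⊢
    exact ⟨hy2, hy1.2⟩
  refine ⟨x₀, δ, s * δ ^ (-β), hδ, hδ1, hm, ?_, hx₀, hup, hx₀n⟩
  rw [mul_assoc, ← Real.rpow_add hδ, neg_add_cancel, Real.rpow_zero, mul_one]
  linarith

/-- The Harnack inequality on the unit cube. -/
theorem exists_harnack_const (N : ℕ) {p C₀ C₁ : ℝ} (hp : 1 < p) (hpN : p < N)
    (hC₀ : 0 < C₀) (hC₁ : 0 < C₁) :
    ∃ c : ℝ, 0 < c ∧ ∀ (u : Euc N → ℝ) (G a : Euc N → Euc N) (B M : ℝ),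
      IsFlux p C₀ C₁ (cube 0 8) u G a → (∀ᵐ x ∂(volume.restrict (cube 0 8)), 0 ≤ u x) →
      (∀ᵐ x ∂(volume.restrict (cube 0 2)), u x ≤ B) → 0 < M →
      (¬ ∀ᵐ x ∂(volume.restrict (cube 0 1)), u x ≤ M) →
      ∀ᵐ x ∂(volume.restrict (cube 0 1)), c * M ≤ u x := by
  set v : ℝ := (volume (cube (0 : Euc N) 1)).toReal with hv
  have hv0 : 0 < v := ENNReal.toReal_pos (volume_cube_pos 0 one_pos).ne' (volume_cube_lt_top _ _).ne
  obtain ⟨γ₂, hγ₂, hγ₂1, hdouble⟩ := exists_expansion_cube N hp hpN hC₀ hC₁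
    (α := v * (1 / 2) ^ N) (by positivity)
  obtain ⟨γ₃, hγ₃, -, hfinal⟩ := exists_expansion_cube N hp hpN hC₀ hC₁
    (α := v * (1 / 6) ^ N) (by positivity)
  -- The order of choices avoids circularity: `γ₂` depends only on the density of a half-size cube,
  -- `β` on `γ₂`, and then `α` and `γ₁` on `β`.
  set β : ℝ := -Real.logb 2 γ₂ with hβ
  have hβ0 : 0 ≤ β := neg_nonneg.2 (Real.logb_nonpos one_lt_two hγ₂.le hγ₂1)
  have hγβ : γ₂ = 2 ^ (-β) := by
    rw [hβ, neg_neg, Real.rpow_logb (by norm_num) (by norm_num) hγ₂]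
  obtain ⟨α, hα, hsup⟩ := exists_sup_estimate_cube N hp hpN hC₀ hC₁
    (A := 2 ^ β) (by positivity)
  obtain ⟨γ₁, hγ₁, -, hfirst⟩ := exists_expansion_cube N hp hpN hC₀ hC₁ hα
  refine ⟨γ₃ * (γ₁ / 4 * (1 / 8) ^ β), by positivity, fun u G a B M h hu hB hM hn => ?_⟩
  obtain ⟨x₀, δ, m, hδ, hδ1, hm, hmM, hx₀, hup, hx₀n⟩ := exists_peak hβ0 hM hB hn
  have hU : IsOpen (cube (0 : Euc N) 8) := isOpen_cube 0 8
  set r := δ / 8 with hr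
  have hr0 : 0 < r := by positivity
  have hx₀2 : x₀ ∈ cube (0 : Euc N) 2 := cube_mono (by linarith) hx₀
  have hsub : ∀ s, s ≤ 6 → cube x₀ s ⊆ cube 0 8 := fun s hs =>
    cube_subset_cube_of_mem hx₀2 (by linarith)
  have h1 : ∀ᵐ x ∂(volume.restrict (cube x₀ r)), γ₁ * (m / 2) ≤ u x := by
    refine hfirst _ u G a hU h hu x₀ r (m / 2) hr0 (by positivity) (hsub _ (by linarith)) ?_
    by_contra hcon
    refine hx₀n ?_
    -- Were `u ≥ m / 2` only on a small fraction of the cube, the sup estimate with `2 * m` would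
    -- give `u ≤ m` near `x₀`, against the choice of the peak. The required bound is the one from
    -- the peak, since `2 ^ β * (2 * m) = 2 ^ (β + 1) * m`.
    have h3 := hsup _ u G a hU h x₀ r (2 * m) hr0 (by positivity) (hsub _ (by linarith)) ?_ ?_
    · simpa using h3
    · have hs : cube x₀ (r * 2) ⊆ cube 0 (2 - δ / 2) :=
        cube_subset_cube_of_mem hx₀ (by rw [hr]; linarith)
      filter_upwards [ae_restrict_of_ae_restrict_of_subset hs hup] with x hx
      rw [Real.rpow_add_one (by norm_num)] at hx
      linarith
    · rw [show 2 * m / 4 = m / 2 by ring]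
      exact (not_le.1 hcon).le
  have hiter : ∀ j : ℕ, 2 ^ j * r ≤ 1 →
      ∀ᵐ x ∂(volume.restrict (cube x₀ (2 ^ j * r))), γ₂ ^ j * (γ₁ * (m / 2)) ≤ u x := by
    intro j
    induction j with
    | zero => intro _; simpa using h1
    | succ j ih =>
      intro hj
      have hj' : 2 ^ j * r ≤ 1 / 2 := by rw [pow_succ] at hj; linarith
      have hpos : 0 < 2 ^ (j + 1) * r := by positivity
      have := hdouble _ u G a hU h hu x₀ (2 ^ (j + 1) * r) (γ₂ ^ j * (γ₁ * (m / 2))) hpos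
        (by positivity) (hsub _ (by linarith)) ?_
      · filter_upwards [this] with x hx
        rw [pow_succ]
        linarith
      · refine le_trans (le_of_eq ?_) (le_volume_setOf (s := 2 ^ j * r) ?_ (ih (by linarith)))
        · rw [volume_cube x₀ (by positivity), ← hv, mul_assoc, ← mul_pow]
          congr 3
          rw [pow_succ]; ring
        · rw [pow_succ]; nlinarith [show 0 < 2 ^ j * r by positivity]
  -- The last doubling before side `1`, so that `1 / 2 < 2 ^ j * r ≤ 1`; the loss `γ₂ ^ j = (2 ^ j)
  -- ^ (-β)` is then at worst `r ^ β`.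
  obtain ⟨j, hj1, hj2⟩ := exists_nat_pow_near (x := 1 / r) (y := (2 : ℝ))
    (by rw [le_div_iff₀ hr0]; linarith) one_lt_two
  rw [le_div_iff₀ hr0] at hj1
  rw [div_lt_iff₀ hr0] at hj2
  have hγj : r ^ β ≤ γ₂ ^ j := by
    have e : γ₂ ^ j = ((2 : ℝ) ^ j)⁻¹ ^ β := by
      rw [hγβ, ← Real.rpow_natCast, ← Real.rpow_mul (by norm_num), ← Real.rpow_natCast (2 : ℝ),
        ← Real.rpow_neg (by norm_num), ← Real.rpow_mul (by norm_num)]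
      congr 1; ring
    rw [e]
    refine Real.rpow_le_rpow hr0.le ?_ hβ0
    rwa [le_inv_comm₀ hr0 (by positivity), ← one_div, le_div_iff₀ hr0]
  have hlow : ∀ᵐ x ∂(volume.restrict (cube x₀ (1 / 2))), γ₁ / 4 * (1 / 8) ^ β * M ≤ u x := by
    have hsubj : cube x₀ (1 / 2) ⊆ cube x₀ (2 ^ j * r) :=
      cube_mono (by rw [pow_succ] at hj2; linarith)
    filter_upwards [ae_restrict_of_ae_restrict_of_subset hsubj (hiter j hj1)] with x hx
    refine le_trans ?_ hx
    calc γ₁ / 4 * (1 / 8) ^ β * M = γ₁ / 2 * (1 / 8) ^ β * (M / 2) := by ring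
      _ ≤ γ₁ / 2 * (1 / 8) ^ β * (m * δ ^ β) := by gcongr
      _ = r ^ β * (γ₁ * (m / 2)) := by
        rw [hr, div_eq_mul_one_div δ 8, Real.mul_rpow hδ.le (by norm_num)]; ring
      _ ≤ γ₂ ^ j * (γ₁ * (m / 2)) := by gcongr
  -- Side `3` suffices: `x₀` lies in the cube of side `2`, so this cube contains the unit cube, and
  -- its double of side `6` still lies in the cube of side `8`. The cube of side `1 / 2` occupies
  -- the fraction `(1 / 6) ^ N` of it.
  have hfin := hfinal _ u G a hU h hu x₀ 3 (γ₁ / 4 * (1 / 8) ^ β * M) (by norm_num) (by positivity)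
    (hsub _ (by norm_num)) ?_
  · have hsub3 : cube (0 : Euc N) 1 ⊆ cube x₀ 3 := fun x hx i => by
      have a1 := hx i
      have a2 := hx₀2 i
      simp only [PiLp.zero_apply, sub_zero] at a1 a2
      have a3 := abs_sub (x i) (x₀ i)
      linarith
    filter_upwards [ae_restrict_of_ae_restrict_of_subset hsub3 hfin] with x hx
    linarith
  · refine le_trans (le_of_eq ?_) (le_volume_setOf (s := 1 / 2) (by norm_num) hlow)
    rw [volume_cube x₀ (by norm_num), ← hv, mul_assoc, ← mul_pow]
    norm_num

end Harnack

/-! ### The theorem, by rescaling to the unit cube. -/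

theorem mainTheorem4 (N : ℕ) (p C₀ C₁ : ℝ) (hp : 1 < p) (hpN : p < N)
    (hC₀ : 0 < C₀) (hC₁ : 0 < C₁) :
    ∃ C : ℝ, 0 < C ∧
      ∀ R : ℝ, 0 < R →
      ∀ A : EuclideanSpace ℝ (Fin N) → ℝ → EuclideanSpace ℝ (Fin N) → EuclideanSpace ℝ (Fin N),
        HasPGrowth p C₀ C₁ (cube 0 (8 * R)) A →
      ∀ u : EuclideanSpace ℝ (Fin N) → ℝ,
        IsWeakSolution p (cube 0 (8 * R)) A u →
        MemLpLoc u ⊤ (cube 0 (8 * R)) →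
        (∀ᵐ x ∂(volume.restrict (cube 0 (8 * R))), 0 ≤ u x) →
        essSup u (volume.restrict (cube 0 R)) ≤ C * essInf u (volume.restrict (cube 0 R)) := by
  obtain ⟨c, hc, hmain⟩ := exists_harnack_const N hp hpN hC₀ hC₁
  refine ⟨c⁻¹, inv_pos.2 hc, fun R hR A hA u ⟨G, hG, hm, hweak⟩ hbd hu => ?_⟩
  have hflux : IsFlux p C₀ C₁ (cube 0 (8 * R)) u G fun x => A x (u x) (G x) :=
    ⟨hG, hm, hA.mono fun x hx => hx _ _, hweak⟩
  have h8 := hflux.comp_dilation 0 hR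
  have hu8 := (ae_restrict_dilation_iff 0 hR (cube 0 (8 * R)) (P := fun x => 0 ≤ u x)).2 hu
  rw [mul_comm, dilation_preimage_cube] at h8 hu8
  obtain ⟨B, hB⟩ : ∃ B : ℝ, ∀ᵐ x ∂(volume.restrict (cube 0 (R * 2))), u x ≤ B := by
    have hL := hbd (closedCube 0 (R * 2)) (closedCube_subset_cube (by linarith))
      (isCompact_closedCube _ _)
    have hb := enorm_ae_le_eLpNormEssSup u (volume.restrict (closedCube 0 (R * 2)))
    rw [← eLpNorm_exponent_top] at hb
    refine ⟨(eLpNorm u ⊤ (volume.restrict (closedCube 0 (R * 2)))).toReal, ?_⟩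
    filter_upwards [ae_restrict_of_ae_restrict_of_subset (cube_subset_closedCube _ _) hb] with x hx
    have h1 := ENNReal.toReal_mono hL.2.ne hx
    rw [toReal_enorm] at h1
    exact (Real.le_norm_self _).trans h1
  have hB2 := (ae_restrict_dilation_iff 0 hR (cube 0 (R * 2)) (P := fun x => u x ≤ B)).2 hB
  rw [dilation_preimage_cube] at hB2
  have key : ∀ M : ℝ, 0 < M → (¬ ∀ᵐ x ∂(volume.restrict (cube 0 R)), u x ≤ M) →
      ∀ᵐ x ∂(volume.restrict (cube 0 R)), c * M ≤ u x := by
    intro M hM hn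
    have h1 := hmain _ _ _ B M h8 hu8 hB2 hM fun hcon => hn ?_
    · rw [← mul_one R, ← ae_restrict_dilation_iff 0 hR, dilation_preimage_cube]
      exact h1
    · rw [← mul_one R, ← ae_restrict_dilation_iff 0 hR, dilation_preimage_cube]
      exact hcon
  have hne : Filter.NeBot (ae (volume.restrict (cube (0 : Euc N) R))) := by
    rw [ae_neBot, Ne, Measure.restrict_eq_zero]
    exact (volume_cube_pos 0 hR).ne'
  have hub : ∀ᵐ x ∂(volume.restrict (cube 0 R)), u x ≤ B :=
    ae_restrict_of_ae_restrict_of_subset (cube_mono (by linarith)) hB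
  have hlb : ∀ᵐ x ∂(volume.restrict (cube 0 R)), 0 ≤ u x :=
    ae_restrict_of_ae_restrict_of_subset (cube_mono (by linarith)) hu
  -- Real-valued `essSup` and `essInf` have their intended meaning only for essentially bounded
  -- functions, so both bounds must be supplied.
  have hbu : Filter.IsBoundedUnder (· ≤ ·) (ae (volume.restrict (cube 0 R))) u := ⟨B, hub⟩
  have hbl : Filter.IsBoundedUnder (· ≥ ·) (ae (volume.restrict (cube 0 R))) u := ⟨0, hlb⟩
  have hinf : ∀ b : ℝ, (∀ᵐ x ∂(volume.restrict (cube 0 R)), b ≤ u x) →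
      b ≤ essInf u (volume.restrict (cube 0 R)) := fun b hb =>
    Filter.le_liminf_of_le hbu.isCoboundedUnder_ge hb
  have hsup : ∀ b : ℝ, (∀ᵐ x ∂(volume.restrict (cube 0 R)), u x ≤ b) →
      essSup u (volume.restrict (cube 0 R)) ≤ b := fun b hb =>
    Filter.limsup_le_of_le hbl.isCoboundedUnder_le hb
  have hI0 := hinf 0 hlb
  have hc' : 0 ≤ c⁻¹ * essInf u (volume.restrict (cube 0 R)) := by positivity
  by_contra! hcon
  -- Any `M` strictly below the supremum is exceeded on a set of positive measure, so `c * M` bounds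
  -- the infimum below; `M > c⁻¹ * essInf` contradicts this.
  obtain ⟨M, hM1, hM2⟩ := exists_between hcon
  have h1 := hinf (c * M) (key M (hc'.trans_lt hM1) fun h => (hsup M h).not_gt hM2)
  rw [inv_mul_lt_iff₀ hc] at hM1
  exact h1.not_gt hM1
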